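/- Let $0<q<1$, $N\ge 1$, $t\ge 0$, and let $a_i\ge 0$, $\alpha_i$ ($1\le i\le N$) be real numbers with $a_j<\alpha_i$ for all $i,j$. Write $(x;q)_\infty=\prod_{k\ge0}(1-xq^k)$, $(q;q)_m=\prod_{k=1}^m(1-q^k)$, $q^c=(q^{c_1},\dots,q^{c_N})$, $A=\sum_{j=1}^N a_j$, and $$\Pi(z;q^\alpha,t)=\prod_{i,j=1}^N\frac1{(q^{\alpha_i}/z_j;q)_\infty}\prod_{j=1}^N e^{z_jt},\qquad m_N^q(z)=\frac1{(2\pi i)^NN!}\prod_{1\le i<j\le N}(z_i/z_j;q)_\infty(z_j/z_i;q)_\infty .$$ For a signature $\lambda=(\lambda_1\ge\dots\ge\lambda_N)\in\mathbb Z^N$ let $$P_\lambda(x)=\sum\prod_{j=1}^N x_j^{\sum_{i=1}^{j}\lambda^{(j)}_i-\sum_{i=1}^{j-1}\lambda^{(j-1)}_i}\prod_{i=1}^{j-1}\frac{(q;q)_{\lambda^{(j)}_i-\lambda^{(j)}_{i+1}}}{(q;q)_{\lambda^{(j)}_i-\lambda^{(j-1)}_i}(q;q)_{\lambda^{(j-1)}_i-\lambda^{(j)}_{i+1}}},$$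 where the sum is over all integer arrays $(\lambda^{(j)}_i)_{1\le i\le j\le N}$ with $\lambda^{(N)}=\lambda$ and $\lambda^{(j+1)}_{i+1}\le\lambda^{(j)}_i\le\lambda^{(j+1)}_i$, and let $$Q_\lambda(q^\alpha,t)=\prod_{i=1}^{N-1}(q^{\lambda_i-\lambda_{i+1}+1};q)_\infty\int_{|z_1|=\dots=|z_N|=1}\prod_{i=1}^N\frac{dz_i}{z_i}\,P_\lambda(1/z)\,\Pi(z;q^\alpha,t)\,m_N^q(z).$$ The two-sided $q$-Whittaker measure gives $\lambda$ the weight $W_t(\lambda)=P_\lambda(q^a)Q_\lambda(q^\alpha,t)/\Pi(q^a;q^\alpha,t)$, and $\langle f(\lambda)\rangle=\sum_\lambda f(\lambda)W_t(\lambda)$. Let $\zeta\in\mathbb C\setminus[0,\infty)$, $\epsilon>0$, and let $\mathbb T=\{|w|=r\}$ be positively oriented, where $q^{a_i}<r$ and $q^{a_i}r^{N-1}<q^{-\epsilon}$ for all $i$ (the unit circle, $r=1$, is admissible whenever all $a_i>0$). Then the series defining $\langle 1/(\zeta q^{\lambda_N};q)_\infty\rangle$ converges absolutely, the integrals below converge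 absolutely, and $$\left\langle\frac1{(\zeta q^{\lambda_N};q)_\infty}\right\rangle=-(q;q)_\infty^{N-2}\int_{i\mathbb R-\epsilon}ds\,\frac{\pi}{\sin\pi(s-A)}(-\zeta)^{s-A}(q^{s-A+1};q)_\infty(q^{A-s};q)_\infty\int_{\mathbb T^{N-1}}\prod_{j=2}^N\frac{dw_j}{w_j}\,m_N^q(w)\frac{\Pi(w;q^\alpha,t)}{\Pi(q^a;q^\alpha,t)}\prod_{i,j=1}^N\frac1{(q^{a_i}/w_j;q)_\infty},$$ where $w_1=q^s/(w_2\cdots w_N)$ ($w_1=q^s$ if $N=1$), powers of $-\zeta$ use the principal branch, and $i\mathbb R-\epsilon$ is oriented upwards. -/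

import Mathlib

open scoped Nat

noncomputable section

namespace QWhittaker

/-- The infinite `q`-Pochhammer symbol `(x; q)_∞ = ∏_{k ≥ 0} (1 - x q^k)`. -/
def qPochInf (x q : ℂ) : ℂ := ∏' k : ℕ, (1 - x * q ^ k)

/-- The finite symbol `(q; q)_m = ∏_{k = 1}^{m} (1 - q^k)`, indexed by an integer `m`; it is only
used for `m ≥ 0`. -/
def qFact (q : ℂ) (m : ℤ) : ℂ := ∏ k ∈ Finset.range m.toNat, (1 - q ^ (k + 1))

/-- The set `Λ_N` of signatures `λ_1 ≥ ⋯ ≥ λ_N` of integers, of either sign. -/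
def Signature (N : ℕ) : Type := {lam : Fin N → ℤ // Antitone lam}

/-- The `q`-Whittaker function `P_λ(x_1, …, x_N)`. This is the sum over all triangular arrays
`λ^{(j)}_i` (`1 ≤ i ≤ j ≤ N`, `λ^{(N)} = λ`) of integers that interlace,
`λ^{(j)}_{i+1} ≤ λ^{(j-1)}_i ≤ λ^{(j)}_i`, of the product over `j = 1, …, N` of
`x_j ^ (|λ^{(j)}| - |λ^{(j-1)}|)` and of
`∏_{i=1}^{j-1} (q;q)_{λ^{(j)}_i - λ^{(j)}_{i+1}}
  / ((q;q)_{λ^{(j)}_i - λ^{(j-1)}_i} (q;q)_{λ^{(j-1)}_i - λ^{(j)}_{i+1}})`,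
written row by row: `mu` is the row `λ^{(N-1)}`. -/
def whittakerP (q : ℂ) : (N : ℕ) → (Fin N → ℤ) → (Fin N → ℂ) → ℂ
  | 0, _, _ => 1
  | n + 1, lam, x =>
    ∑ mu ∈ Finset.Icc (fun i : Fin n => lam i.succ) (fun i : Fin n => lam i.castSucc),
      x (Fin.last n) ^ (∑ i, lam i - ∑ i, mu i) *
        (∏ i : Fin n, qFact q (lam i.castSucc - lam i.succ) /
          (qFact q (lam i.castSucc - mu i) * qFact q (mu i - lam i.succ))) *
        whittakerP q n mu (fun i => x i.castSucc)

/-- The point `q^c = (q^{c_1}, …, q^{c_N})`. -/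
def qPow {N : ℕ} (q : ℝ) (c : Fin N → ℝ) : Fin N → ℂ := fun i => ((q ^ c i : ℝ) : ℂ)

/-- `Π(z; u, t) = ∏_{i,j} 1 / (u_i / z_j; q)_∞ · ∏_j e^{z_j t}`. -/
def PiFn {N : ℕ} (q : ℝ) (z u : Fin N → ℂ) (t : ℝ) : ℂ :=
  (∏ i, ∏ j, (qPochInf (u i / z j) q)⁻¹) * ∏ j, Complex.exp (z j * t)

/-- The density
`m_N^q(z) = 1 / ((2πi)^N N!) · ∏_{i<j} (z_i/z_j; q)_∞ (z_j/z_i; q)_∞`. -/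
def sklyanin {N : ℕ} (q : ℝ) (z : Fin N → ℂ) : ℂ :=
  1 / ((2 * Real.pi * Complex.I) ^ N * (N ! : ℂ)) *
    ∏ i, ∏ j ∈ Finset.Ioi i, qPochInf (z i / z j) q * qPochInf (z j / z i) q

/-- The dual function
`Q_λ(u, t) = ∏_{i=1}^{N-1} (q^{λ_i - λ_{i+1} + 1}; q)_∞ ·
  ∫_{𝕋^N} ∏_i dz_i/z_i · P_λ(1/z) Π(z; u, t) m_N^q(z)`, with `N = n + 1`
and the unit circle `𝕋`. -/
def whittakerQ {n : ℕ} (q : ℝ) (lam : Fin (n + 1) → ℤ) (u : Fin (n + 1) → ℂ) (t : ℝ) : ℂ :=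
  (∏ i : Fin n, qPochInf ((q : ℂ) ^ (lam i.castSucc - lam i.succ + 1)) q) *
    torusIntegral
      (fun z : Fin (n + 1) → ℂ =>
        (∏ i, 1 / z i) *
          (whittakerP q (n + 1) lam (fun i => 1 / z i) * PiFn q z u t * sklyanin q z))
      (fun _ => 0) (fun _ => 1)

/-- The weight `W_t(λ) = P_λ(q^a) Q_λ(q^α, t) / Π(q^a; q^α, t)` of the two-sided `q`-Whittaker
measure. -/
def weight {n : ℕ} (q : ℝ) (a α : Fin (n + 1) → ℝ) (t : ℝ) (lam : Signature (n + 1)) : ℂ :=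
  whittakerP q (n + 1) lam.1 (qPow q a) * whittakerQ q lam.1 (qPow q α) t /
    PiFn q (qPow q a) (qPow q α) t

/-- The point `(w_1, w_2, …, w_N)` with `w_1 = q^s / (w_2 ⋯ w_N)`, where `N = n + 1` and `v` lists
`w_2, …, w_N`; for `N = 1` it is `w_1 = q^s`. -/
def point {n : ℕ} (q : ℝ) (s : ℂ) (v : Fin n → ℂ) : Fin (n + 1) → ℂ :=
  Fin.cons ((q : ℂ) ^ s / ∏ j, v j) v

/-- The integrand of the inner integral over `w_2, …, w_N`, including the factors `1 / w_j`. -/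
def innerIntegrand {n : ℕ} (q : ℝ) (a α : Fin (n + 1) → ℝ) (t : ℝ) (s : ℂ) (v : Fin n → ℂ) : ℂ :=
  (∏ j, 1 / v j) *
    (sklyanin q (point q s v) *
      (PiFn q (point q s v) (qPow q α) t / PiFn q (qPow q a) (qPow q α) t) *
      ∏ i, ∏ j, 1 / qPochInf (qPow q a i / point q s v j) q)

/-- The integrand of the outer integral, as a function of `s`; the inner integral is over the
`(N-1)`-fold product of the positively oriented circle `|w| = r`. -/
def outerIntegrand {n : ℕ} (q : ℝ) (a α : Fin (n + 1) → ℝ) (t : ℝ) (ζ : ℂ) (r : ℝ) (s : ℂ) : ℂ :=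
  (Real.pi / Complex.sin (Real.pi * (s - ∑ j, (a j : ℂ)))) *
    (-ζ) ^ (s - ∑ j, (a j : ℂ)) *
    qPochInf ((q : ℂ) ^ (s - ∑ j, (a j : ℂ) + 1)) q *
    qPochInf ((q : ℂ) ^ (∑ j, (a j : ℂ) - s)) q *
    torusIntegral (innerIntegrand q a α t s) (fun _ => 0) (fun _ => r)

end QWhittaker

end

/-! ### The q-Vandermonde convolution. -/

noncomputable section

namespace QWhittaker

/-! Write `N = n + 1`, `x = q^a`, `A = ∑ a_j`, and `y = 1/z` for the variables of the torus integral
defining `Q_λ`. The proof sums over `λ` under that integral, and then recognises the remaining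
one-variable series as a periodized Mellin–Barnes kernel.

Summation over `λ`. Translating `λ` by `l` multiplies `P_λ(x) P_λ(y)` by `w^l`, where `w = ∏ x_i ∏
y_i`. A sum over signatures therefore splits into a sum over the last row and a sum over the
differences to it. The Cauchy identity (`hasSum_cauchy`) is the case where the last row carries
weight `1/(q;q)_l` with `l ≥ 0`. Dividing it by Euler's `∑ w^l/(q;q)_l = 1/(w;q)_∞` isolates the sum
over differences, and any summable function of `λ_N` may then be inserted (`hasSum_signature`). For
the observable this leaves the bilateral series `∑_l w^l/(ζ q^l;q)_∞`.

The Cauchy identity follows by induction on the number of variables from the branching rule, which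
is the definition of `P`, and a Pieri rule. The Pieri rule follows by induction from a commutation
relation between branching and Pieri coefficients (`hasSum_phi_mul_psi`). For that relation, the
q-Vandermonde convolution introduces an auxiliary row that decouples the entries of the summed row
on both sides, and a reflection matches the decoupled sums. Symmetry of `P` is never needed. All
coefficients are non-negative, so absolute convergence comes from the same identities at the moduli
of the variables.

Contours. The integrand is holomorphic where all `|z_j|` are large, so the unit torus can be moved
to `|z_1| = q^{-ε}/r^n`, `|z_j| = r`. Substituting `z_1 = q^s/(z_2 ⋯ z_N)` makes `w = q^{-(s-A)}`
depend on `s` alone, with `s` running over one vertical period `τ = 2πi/log q`.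

The kernel. With `u = s - A`, the product of `(q^{-u};q)_∞` and the bilateral series must be matched
with the sum over `τℤ` of the translates of `π (-ζ)^u (q^{u+1};q)_∞ (q^{-u};q)_∞ / sin πu`. Both are
`τ`-periodic, holomorphic for `Re u < 0`, and satisfy `D(u-1) = -ζ⁻¹ q^u D(u)`. This equation links
consecutive Laurent coefficients in `q^u`, so the solution space is at most one-dimensional
(`eq_zero_of_quasiPeriodic`), and the values at `u = -1` fix the constant
(`mellinPeriodization_eq`). Unfolding the periodization turns the integral over a period into the
integral over the whole line. -/

/-- The real number `(q; q)_m`. -/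
def qf (q : ℝ) (m : ℤ) : ℝ := ∏ k ∈ Finset.range m.toNat, (1 - q ^ (k + 1))

/-- The reciprocal `1 / (q; q)_m`, extended by zero to negative `m`. -/
def qg (q : ℝ) (m : ℤ) : ℝ := if 0 ≤ m then (qf q m)⁻¹ else 0

lemma qf_pos {q : ℝ} (hq0 : 0 < q) (hq1 : q < 1) (m : ℤ) : 0 < qf q m :=
  Finset.prod_pos fun k _ => sub_pos.2 (pow_lt_one₀ hq0.le hq1 (Nat.succ_ne_zero k))

lemma qg_of_neg {q : ℝ} {m : ℤ} (hm : m < 0) : qg q m = 0 := by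
  simp [qg, not_le.2 hm]

lemma qg_zero (q : ℝ) : qg q 0 = 1 := by simp [qg, qf]

lemma qg_nonneg {q : ℝ} (hq0 : 0 < q) (hq1 : q < 1) (m : ℤ) : 0 ≤ qg q m := by
  unfold qg
  split_ifs
  · exact (inv_pos.2 (qf_pos hq0 hq1 m)).le
  · exact le_rfl

lemma qf_mul_qg {q : ℝ} (hq0 : 0 < q) (hq1 : q < 1) {m : ℤ} (hm : 0 ≤ m) :
    qf q m * qg q m = 1 := by
  simp [qg, hm, (qf_pos hq0 hq1 m).ne']

/-- Extension by zero makes the recurrence valid at every integer: at `m = 0` the factor `1 - q^0`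
vanishes. The telescoping arguments below then need no boundary cases. -/
lemma qg_sub_one {q : ℝ} (hq0 : 0 < q) (hq1 : q < 1) (m : ℤ) :
    qg q (m - 1) = (1 - q ^ m) * qg q m := by
  rcases lt_trichotomy m 0 with h | rfl | h
  · rw [qg_of_neg h, qg_of_neg (by omega), mul_zero]
  · rw [qg_of_neg (by omega)]; simp
  · obtain ⟨k, rfl⟩ : ∃ k : ℕ, m = k + 1 := ⟨(m - 1).toNat, by omega⟩
    have h1 : (1 - q ^ (k + 1)) ≠ 0 :=
      (sub_pos.2 (pow_lt_one₀ hq0.le hq1 (Nat.succ_ne_zero k))).ne'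
    have h2 := (qf_pos hq0 hq1 k).ne'
    have h3 : qf q ((k : ℤ) + 1) = qf q k * (1 - q ^ (k + 1)) := by
      have : ((k : ℤ) + 1).toNat = k + 1 := by omega
      simp [qf, this, Finset.prod_range_succ]
    have h4 : q ^ ((k : ℤ) + 1) = q ^ (k + 1) := by norm_cast
    rw [add_sub_cancel_right, qg, qg, if_pos (by omega), if_pos (by omega), h3, h4]
    field_simp

lemma sum_Icc_int_eq_sum_range {M : Type*} [AddCommMonoid M] (f : ℤ → M) (p : ℤ) (m : ℕ) :
    ∑ ν ∈ Finset.Icc p (p + m), f ν = ∑ k ∈ Finset.range (m + 1), f (p + k) := by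
  symm
  refine Finset.sum_nbij' (fun k : ℕ => p + k) (fun ν : ℤ => (ν - p).toNat) ?_ ?_ ?_ ?_ ?_
  · intro k hk; simp at hk ⊢; omega
  · intro k hk; simp at hk ⊢; omega
  · intro k hk; simp
  · intro k hk; simp at hk ⊢; omega
  · intro k hk; rfl

/-- The `q`-Vandermonde convolution, over a range starting from zero. -/
lemma qVandermonde_range {q : ℝ} (hq0 : 0 < q) (hq1 : q < 1) (l n : ℤ) (m : ℕ) :
    ∑ k ∈ Finset.range (m + 1), q ^ ((m - k : ℤ) * (n - k)) * qg q (m - k) * qg q (n - k) *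
      qg q k * qg q (l - m - n + k) =
    qf q l * qg q (l - m) * qg q (l - n) * qg q m * qg q n := by
  induction m with
  | zero =>
    simp only [zero_add, Finset.range_one, Finset.sum_singleton, Nat.cast_zero, sub_zero, zero_mul,
      zpow_zero, qg_zero, add_zero, one_mul, mul_one]
    rcases lt_or_ge n 0 with h | h
    · simp [qg_of_neg h]
    rcases lt_or_ge l 0 with h' | h'
    · simp [qg_of_neg (show l - n < 0 by omega)]
    · rw [qf_mul_qg hq0 hq1 h']; ring
  | succ m ih =>
    have hM : (1 - q ^ ((m : ℤ) + 1)) ≠ 0 := by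
      have : q ^ ((m : ℤ) + 1) = q ^ (m + 1) := by norm_cast
      rw [this]
      exact (sub_pos.2 (pow_lt_one₀ hq0.le hq1 (Nat.succ_ne_zero m))).ne'
    have hq := hq0.ne'
    -- A creative-telescoping certificate: `(1 - q^{m+1})` times the summand for `m + 1`, minus `(1
    -- - q^{l-m})` times the summand for `m`, equals `G (k + 1) - G k`. Since `qg` vanishes at `-1`,
    -- `G` vanishes at `k = 0` and `k = m + 2`, so the sums obey the first-order recurrence of the
    -- right-hand side.
    set G : ℕ → ℝ := fun k => -(q ^ ((m - k : ℤ) * (n - k) + (m + 1) + n - 2 * k) *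
      qg q (m + 1 - k) * qg q (n - k) * qg q (k - 1) * qg q (l - m - n + k - 1)) with hG
    have key : ∀ k : ℕ, (1 - q ^ ((m : ℤ) + 1)) *
          (q ^ (((m + 1 : ℕ) - k : ℤ) * (n - k)) * qg q ((m + 1 : ℕ) - k) * qg q (n - k) *
            qg q k * qg q (l - (m + 1 : ℕ) - n + k)) -
        (1 - q ^ (l - m)) * (q ^ ((m - k : ℤ) * (n - k)) * qg q (m - k) * qg q (n - k) *
          qg q k * qg q (l - m - n + k)) = G (k + 1) - G k := by
      intro k
      have e1 : qg q (m - k) = (1 - q ^ ((m : ℤ) + 1 - k)) * qg q (m + 1 - k) := by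
        rw [← qg_sub_one hq0 hq1]; congr 1; ring
      have e2 : qg q (l - (m + 1) - n + k) =
          (1 - q ^ (l - m - n + k)) * qg q (l - m - n + k) := by
        rw [← qg_sub_one hq0 hq1]; congr 1; ring
      have e3 : qg q (n - (k + 1)) = (1 - q ^ (n - k)) * qg q (n - k) := by
        rw [← qg_sub_one hq0 hq1]; congr 1; ring
      have e4 := qg_sub_one hq0 hq1 k
      have e5 := qg_sub_one hq0 hq1 (l - m - n + k)
      simp only [hG, Nat.cast_add, Nat.cast_one]
      rw [show (m : ℤ) + 1 - (k + 1) = m - k by ring, show (k : ℤ) + 1 - 1 = k by ring,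
        show l - m - n + ((k : ℤ) + 1) - 1 = l - m - n + k by ring, e2, e3, e4, e5, e1]
      rw [show ((m : ℤ) + 1 - k) * (n - k) = (m - k) * (n - k) + n - k by ring,
        show ((m : ℤ) - (k + 1)) * (n - (k + 1)) + (m + 1) + n - 2 * (k + 1) =
          (m - k) * (n - k) by ring]
      simp only [zpow_add₀ hq, zpow_sub₀ hq, zpow_one, two_mul]
      field_simp
      ring
    have hsum : (1 - q ^ ((m : ℤ) + 1)) * (∑ k ∈ Finset.range (m + 1 + 1),
        q ^ (((m + 1 : ℕ) - k : ℤ) * (n - k)) * qg q ((m + 1 : ℕ) - k) * qg q (n - k) *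
            qg q k * qg q (l - (m + 1 : ℕ) - n + k)) =
        (1 - q ^ (l - m)) * (∑ k ∈ Finset.range (m + 1 + 1), q ^ ((m - k : ℤ) * (n - k)) *
          qg q (m - k) * qg q (n - k) * qg q k * qg q (l - m - n + k)) := by
      rw [← sub_eq_zero, Finset.mul_sum, Finset.mul_sum, ← Finset.sum_sub_distrib,
        Finset.sum_congr rfl (fun k _ => key k), Finset.sum_range_sub]
      have h0 : G 0 = 0 := by simp [hG, qg_of_neg (show (-1 : ℤ) < 0 by omega)]
      have h1 : G (m + 1 + 1) = 0 := by
        simp [hG, qg_of_neg (show (-1 : ℤ) < 0 by omega)]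
      rw [h0, h1, sub_zero]
    rw [Finset.sum_range_succ _ (m + 1)] at hsum
    conv at hsum => rhs; rw [Finset.sum_range_succ _ (m + 1)]
    rw [ih, qg_of_neg (show ((m : ℤ) - (m + 1 : ℕ)) < 0 by push_cast; omega)] at hsum
    rw [Finset.sum_range_succ _ (m + 1)]
    apply mul_left_cancel₀ hM
    rw [hsum]
    have e1 : qg q (l - (m + 1 : ℕ)) = (1 - q ^ (l - m)) * qg q (l - m) := by
      rw [← qg_sub_one hq0 hq1]; congr 1; push_cast; ring
    have e2 : qg q m = (1 - q ^ ((m : ℤ) + 1)) * qg q (m + 1 : ℕ) := by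
      push_cast; rw [← qg_sub_one hq0 hq1]; congr 1; ring
    rw [e1, e2]
    ring

/-- The limiting form of the `q`-Vandermonde convolution, over a range starting from zero. -/
lemma qVandermonde_lim_range {q : ℝ} (hq0 : 0 < q) (hq1 : q < 1) (n : ℤ) (m : ℕ) :
    ∑ k ∈ Finset.range (m + 1), q ^ ((m - k : ℤ) * (n - k)) * qg q (m - k) * qg q (n - k) *
      qg q k = qg q m * qg q n := by
  induction m with
  | zero => simp [qg_zero]
  | succ m ih =>
    have hM : (1 - q ^ ((m : ℤ) + 1)) ≠ 0 := by
      have : q ^ ((m : ℤ) + 1) = q ^ (m + 1) := by norm_cast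
      rw [this]
      exact (sub_pos.2 (pow_lt_one₀ hq0.le hq1 (Nat.succ_ne_zero m))).ne'
    have hq := hq0.ne'
    -- The previous certificate with the factors containing `l` removed, as in the limit `l → ∞`;
    -- the coefficient `1 - q^{l-m}` becomes `1`.
    set G : ℕ → ℝ := fun k => -(q ^ ((m - k : ℤ) * (n - k) + (m + 1) + n - 2 * k) *
      qg q (m + 1 - k) * qg q (n - k) * qg q (k - 1)) with hG
    have key : ∀ k : ℕ, (1 - q ^ ((m : ℤ) + 1)) *
          (q ^ (((m + 1 : ℕ) - k : ℤ) * (n - k)) * qg q ((m + 1 : ℕ) - k) * qg q (n - k) *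
            qg q k) -
        (q ^ ((m - k : ℤ) * (n - k)) * qg q (m - k) * qg q (n - k) *
          qg q k) = G (k + 1) - G k := by
      intro k
      have e1 : qg q (m - k) = (1 - q ^ ((m : ℤ) + 1 - k)) * qg q (m + 1 - k) := by
        rw [← qg_sub_one hq0 hq1]; congr 1; ring
      have e3 : qg q (n - (k + 1)) = (1 - q ^ (n - k)) * qg q (n - k) := by
        rw [← qg_sub_one hq0 hq1]; congr 1; ring
      have e4 := qg_sub_one hq0 hq1 k
      simp only [hG, Nat.cast_add, Nat.cast_one]
      rw [show (m : ℤ) + 1 - (k + 1) = m - k by ring, show (k : ℤ) + 1 - 1 = k by ring,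
        e3, e4, e1]
      rw [show ((m : ℤ) + 1 - k) * (n - k) = (m - k) * (n - k) + n - k by ring,
        show ((m : ℤ) - (k + 1)) * (n - (k + 1)) + (m + 1) + n - 2 * (k + 1) =
          (m - k) * (n - k) by ring]
      simp only [zpow_add₀ hq, zpow_sub₀ hq, zpow_one, two_mul]
      field_simp
      ring
    have hsum : (1 - q ^ ((m : ℤ) + 1)) * (∑ k ∈ Finset.range (m + 1 + 1),
        q ^ (((m + 1 : ℕ) - k : ℤ) * (n - k)) * qg q ((m + 1 : ℕ) - k) * qg q (n - k) *
            qg q k) =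
        (∑ k ∈ Finset.range (m + 1 + 1), q ^ ((m - k : ℤ) * (n - k)) *
          qg q (m - k) * qg q (n - k) * qg q k) := by
      rw [← sub_eq_zero, Finset.mul_sum, ← Finset.sum_sub_distrib,
        Finset.sum_congr rfl (fun k _ => key k), Finset.sum_range_sub]
      have h0 : G 0 = 0 := by simp [hG, qg_of_neg (show (-1 : ℤ) < 0 by omega)]
      have h1 : G (m + 1 + 1) = 0 := by
        simp [hG, qg_of_neg (show (-1 : ℤ) < 0 by omega)]
      rw [h0, h1, sub_zero]
    rw [Finset.sum_range_succ _ (m + 1)] at hsum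
    conv at hsum => rhs; rw [Finset.sum_range_succ _ (m + 1)]
    rw [ih, qg_of_neg (show ((m : ℤ) - (m + 1 : ℕ)) < 0 by push_cast; omega)] at hsum
    rw [Finset.sum_range_succ _ (m + 1)]
    apply mul_left_cancel₀ hM
    rw [hsum]
    have e2 : qg q m = (1 - q ^ ((m : ℤ) + 1)) * qg q (m + 1 : ℕ) := by
      push_cast; rw [← qg_sub_one hq0 hq1]; congr 1; ring
    rw [e2]
    ring

/-- A translate by `p` of `qVandermonde_range`; enlarging the index set only adds zero terms. Its
role is decoupling: on the left `l` and `p` are tied together by `qf q (l - p)`, while each summand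
on the right is a function of `l` times a function of `p`. -/
lemma qVandermonde {q : ℝ} (hq0 : 0 < q) (hq1 : q < 1) (l m n p : ℤ) {I : Finset ℤ}
    (hI : Finset.Icc p m ⊆ I) :
    qf q (l - p) * qg q (l - m) * qg q (l - n) * qg q (m - p) * qg q (n - p) =
    ∑ ν ∈ I, q ^ ((m - ν) * (n - ν)) * qg q (m - ν) * qg q (n - ν) * qg q (ν - p) *
      qg q (l - m - n + ν) := by
  rw [← Finset.sum_subset hI]
  · rcases lt_or_ge m p with h | h
    · rw [qg_of_neg (show m - p < 0 by omega), Finset.Icc_eq_empty (by omega)]; simp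
    · obtain ⟨k, rfl⟩ : ∃ k : ℕ, m = p + k := ⟨(m - p).toNat, by omega⟩
      rw [sum_Icc_int_eq_sum_range]
      have := qVandermonde_range hq0 hq1 (l - p) (n - p) k
      rw [show p + (k : ℤ) - p = k by ring, show l - (p + k) = l - p - k by ring,
        show l - n = l - p - (n - p) by ring, ← this]
      refine Finset.sum_congr rfl fun j _ => ?_
      ring_nf
  · intro ν _ hν
    rw [Finset.mem_Icc, not_and_or, not_le, not_le] at hν
    rcases hν with h | h
    · rw [qg_of_neg (show ν - p < 0 by omega)]; ring
    · rw [qg_of_neg (show m - ν < 0 by omega)]; ring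

/-- The version for the first entry of a row, which has no neighbour `l` above it. -/
lemma qVandermonde_lim {q : ℝ} (hq0 : 0 < q) (hq1 : q < 1) (m n p : ℤ) {I : Finset ℤ}
    (hI : Finset.Icc p m ⊆ I) :
    qg q (m - p) * qg q (n - p) =
    ∑ ν ∈ I, q ^ ((m - ν) * (n - ν)) * qg q (m - ν) * qg q (n - ν) * qg q (ν - p) := by
  rw [← Finset.sum_subset hI]
  · rcases lt_or_ge m p with h | h
    · rw [qg_of_neg (show m - p < 0 by omega), Finset.Icc_eq_empty (by omega)]; simp
    · obtain ⟨k, rfl⟩ : ∃ k : ℕ, m = p + k := ⟨(m - p).toNat, by omega⟩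
      rw [sum_Icc_int_eq_sum_range]
      have := qVandermonde_lim_range hq0 hq1 (n - p) k
      rw [show p + (k : ℤ) - p = k by ring, ← this]
      refine Finset.sum_congr rfl fun j _ => ?_
      ring_nf
  · intro ν _ hν
    rw [Finset.mem_Icc, not_and_or, not_le, not_le] at hν
    rcases hν with h | h
    · rw [qg_of_neg (show ν - p < 0 by omega)]; ring
    · rw [qg_of_neg (show m - ν < 0 by omega)]; ring

end QWhittaker
end

/-! ### Infinite q-Pochhammer symbols and Euler's expansion. -/

noncomputable section

namespace QWhittaker

open Filter Topology

section Pochhammer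

variable {q : ℝ}

lemma summable_norm_neg_mul_pow (hq0 : 0 < q) (hq1 : q < 1) (x : ℂ) :
    Summable fun k : ℕ => ‖-(x * (q : ℂ) ^ k)‖ := by
  simp only [norm_neg, norm_mul, norm_pow, Complex.norm_real, Real.norm_of_nonneg hq0.le]
  exact (summable_geometric_of_lt_one hq0.le hq1).mul_left _

lemma multipliable_qPochInf (hq0 : 0 < q) (hq1 : q < 1) (x : ℂ) :
    Multipliable fun k : ℕ => 1 - x * (q : ℂ) ^ k := by
  simpa only [sub_eq_add_neg] using
    multipliable_one_add_of_summable (summable_norm_neg_mul_pow hq0 hq1 x)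

lemma qPochInf_ne_zero (hq0 : 0 < q) (hq1 : q < 1) {x : ℂ}
    (h : ∀ k : ℕ, 1 - x * (q : ℂ) ^ k ≠ 0) : qPochInf x q ≠ 0 := by
  simpa only [qPochInf, sub_eq_add_neg] using
    tprod_one_add_ne_zero_of_summable (f := fun k : ℕ => -(x * (q : ℂ) ^ k))
      (by simpa only [sub_eq_add_neg] using h) (summable_norm_neg_mul_pow hq0 hq1 x)

lemma one_sub_mul_pow_ne_zero (hq0 : 0 < q) (hq1 : q < 1) {x : ℂ} (hx : ‖x‖ < 1) (k : ℕ) :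
    1 - x * (q : ℂ) ^ k ≠ 0 := by
  intro h
  have h1 : x * (q : ℂ) ^ k = 1 := (sub_eq_zero.1 h).symm
  have h2 : ‖x‖ * q ^ k = 1 := by
    have := congrArg norm h1
    simpa [abs_of_pos hq0] using this
  have h3 : q ^ k ≤ 1 := pow_le_one₀ hq0.le hq1.le
  nlinarith [norm_nonneg x, pow_pos hq0 k]

lemma qPochInf_ne_zero_of_norm_lt (hq0 : 0 < q) (hq1 : q < 1) {x : ℂ} (hx : ‖x‖ < 1) :
    qPochInf x q ≠ 0 :=
  qPochInf_ne_zero hq0 hq1 (one_sub_mul_pow_ne_zero hq0 hq1 hx)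

lemma qPochInf_eq (hq0 : 0 < q) (hq1 : q < 1) (x : ℂ) :
    qPochInf x q = (1 - x) * qPochInf (x * q) q := by
  have h := (multipliable_qPochInf hq0 hq1 (x * q))
  have h' : Multipliable fun k : ℕ => 1 - x * (q : ℂ) ^ (k + 1) := by
    refine h.congr fun k => ?_
    rw [pow_succ', mul_assoc]
  have h2 := tprod_eq_zero_mul' (f := fun k : ℕ => 1 - x * (q : ℂ) ^ k) h'
  rw [pow_zero, mul_one] at h2
  refine h2.trans (congrArg _ ?_)
  refine tprod_congr fun k => ?_
  ring

lemma qPochInf_zero_left : qPochInf 0 q = 1 := by simp [qPochInf]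

lemma differentiable_qPochInf (hq0 : 0 < q) (hq1 : q < 1) :
    Differentiable ℂ fun x : ℂ => qPochInf x q := by
  rw [← differentiableOn_univ]
  have : HasProdLocallyUniformlyOn (fun (k : ℕ) (x : ℂ) => 1 + -(x * (q : ℂ) ^ k))
      (fun x => ∏' k : ℕ, (1 + -(x * (q : ℂ) ^ k))) Set.univ := by
    apply hasProdLocallyUniformlyOn_of_forall_compact isOpen_univ
    intro K _ hcK
    obtain ⟨C, hC⟩ := hcK.isBounded.exists_norm_le
    refine ((summable_geometric_of_lt_one hq0.le hq1).mul_left C).hasProdUniformlyOn_nat_one_add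
      hcK (.of_forall fun n x hx => ?_) (fun _ => by fun_prop)
    simp only [norm_neg, norm_mul, norm_pow, Complex.norm_real, Real.norm_of_nonneg hq0.le]
    exact mul_le_mul_of_nonneg_right (hC x hx) (by positivity)
  have h2 := this.differentiableOn (.of_forall fun _ => by
    simpa [Finset.prod_fn] using DifferentiableOn.finsetProd (fun _ _ => by fun_prop)) isOpen_univ
  simpa only [qPochInf, sub_eq_add_neg] using h2

lemma continuous_qPochInf (hq0 : 0 < q) (hq1 : q < 1) : Continuous fun x : ℂ => qPochInf x q :=
  (differentiable_qPochInf hq0 hq1).continuous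

lemma tendsto_finite_qPochInf (hq0 : 0 < q) (hq1 : q < 1) (x : ℂ) :
    Tendsto (fun n => ∏ k ∈ Finset.range n, (1 - x * (q : ℂ) ^ k)) atTop (𝓝 (qPochInf x q)) :=
  (multipliable_qPochInf hq0 hq1 x).hasProd.tendsto_prod_nat

lemma qg_pos (hq0 : 0 < q) (hq1 : q < 1) {m : ℤ} (hm : 0 ≤ m) : 0 < qg q m := by
  simp [qg, hm, qf_pos hq0 hq1 m]

lemma qg_succ (hq0 : 0 < q) (hq1 : q < 1) (k : ℕ) :
    qg q k = (1 - q ^ (k + 1)) * qg q ((k + 1 : ℕ) : ℤ) := by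
  have := qg_sub_one hq0 hq1 ((k : ℤ) + 1)
  push_cast
  rw [add_sub_cancel_right] at this
  rw [this]
  norm_cast

lemma summable_qg_mul_pow (hq0 : 0 < q) (hq1 : q < 1) {w : ℂ} (hw : ‖w‖ < 1) :
    Summable fun k : ℕ => (qg q k : ℂ) * w ^ k := by
  rcases eq_or_ne w 0 with rfl | hw0
  · refine summable_of_ne_finset_zero (s := {0}) fun k hk => ?_
    rw [zero_pow (by simpa using hk), mul_zero]
  refine summable_of_ratio_test_tendsto_lt_one hw (.of_forall fun k => ?_) ?_
  · exact mul_ne_zero (by exact_mod_cast (qg_pos hq0 hq1 (by positivity)).ne') (pow_ne_zero _ hw0)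
  · have h1 : Tendsto (fun k : ℕ => (1 - q ^ (k + 1))⁻¹ * ‖w‖) atTop (𝓝 ((1 - 0)⁻¹ * ‖w‖)) := by
      refine Tendsto.mul_const _ (Tendsto.inv₀ (tendsto_const_nhds.sub ?_) (by norm_num))
      exact (tendsto_pow_atTop_nhds_zero_of_lt_one hq0.le hq1).comp (tendsto_add_atTop_nat 1)
    rw [sub_zero, inv_one, one_mul] at h1
    refine h1.congr fun k => ?_
    have hk := qg_pos hq0 hq1 (m := ((k + 1 : ℕ) : ℤ)) (by positivity)
    have hk' : 0 < 1 - q ^ (k + 1) := sub_pos.2 (pow_lt_one₀ hq0.le hq1 (Nat.succ_ne_zero k))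
    rw [qg_succ hq0 hq1 k]
    simp only [norm_mul, norm_pow, Complex.norm_real, Real.norm_of_nonneg hk.le,
      Real.norm_of_nonneg hk'.le]
    have : ‖w‖ ≠ 0 := norm_ne_zero_iff.2 hw0
    field_simp
    ring

/-- Euler's expansion `∑ w^k / (q; q)_k = 1 / (w; q)_∞`. -/
lemma hasSum_qg_mul_pow (hq0 : 0 < q) (hq1 : q < 1) {w : ℂ} (hw : ‖w‖ < 1) :
    HasSum (fun k : ℕ => (qg q k : ℂ) * w ^ k) (qPochInf w q)⁻¹ := by
  set S : ℂ → ℂ := fun w => ∑' k : ℕ, (qg q k : ℂ) * w ^ k with hS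
  have hnorm : ∀ n : ℕ, ‖w * (q : ℂ) ^ n‖ ≤ ‖w‖ := by
    intro n
    simp only [norm_mul, norm_pow, Complex.norm_real, Real.norm_of_nonneg hq0.le]
    exact mul_le_of_le_one_right (norm_nonneg _) (pow_le_one₀ hq0.le hq1.le)
  -- The recurrence of `qg` gives a functional equation for the series. Iterating it and letting `v
  -- q^n → 0`, where the series tends to `1`, produces the infinite product.
  have step : ∀ v : ℂ, ‖v‖ < 1 → (1 - v) * S v = S (v * q) := by
    intro v hv
    have h1 := summable_qg_mul_pow hq0 hq1 hv
    have hvq : ‖v * q‖ < 1 := by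
      simp only [norm_mul, Complex.norm_real, Real.norm_of_nonneg hq0.le]
      nlinarith [norm_nonneg v]
    have h2 := summable_qg_mul_pow hq0 hq1 hvq
    have h3 : S v - S (v * q) = v * S v := by
      simp only [hS]
      rw [← h1.tsum_sub h2, (h1.sub h2).tsum_eq_zero_add, ← tsum_mul_left]
      simp only [pow_zero, sub_self, zero_add]
      refine tsum_congr fun k => ?_
      rw [qg_succ hq0 hq1 k]
      push_cast
      ring
    linear_combination h3
  have iter : ∀ n : ℕ, (∏ k ∈ Finset.range n, (1 - w * (q : ℂ) ^ k)) * S w =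
      S (w * (q : ℂ) ^ n) := by
    intro n
    induction n with
    | zero => simp
    | succ n ih =>
      rw [Finset.prod_range_succ, mul_right_comm, ih, mul_comm,
        step _ ((hnorm n).trans_lt hw), pow_succ, mul_assoc]
  have hlim : Tendsto (fun n : ℕ => S (w * (q : ℂ) ^ n)) atTop (𝓝 1) := by
    have h0 : (1 : ℂ) = ∑' k : ℕ, (if k = 0 then 1 else 0 : ℂ) := by simp
    rw [h0]
    refine tendsto_tsum_of_dominated_convergence (summable_qg_mul_pow hq0 hq1 hw).norm
      (fun k => ?_) (.of_forall fun n k => ?_)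
    · rcases Nat.eq_zero_or_pos k with rfl | hk
      · simp [qg_zero]
      · have : Tendsto (fun n : ℕ => (qg q k : ℂ) * (w * (q : ℂ) ^ n) ^ k) atTop
            (𝓝 ((qg q k : ℂ) * (w * 0) ^ k)) := by
          refine Tendsto.const_mul _ (Tendsto.pow (Tendsto.const_mul _ ?_) _)
          refine tendsto_pow_atTop_nhds_zero_of_norm_lt_one ?_
          simpa [abs_of_pos hq0] using hq1
        simpa [hk.ne'] using this
    · rw [norm_mul, norm_mul, norm_pow, norm_pow]
      gcongr
      exact hnorm n
  have h1 : qPochInf w q * S w = 1 :=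
    tendsto_nhds_unique ((tendsto_finite_qPochInf hq0 hq1 w).mul_const (S w))
      (by simpa only [iter] using hlim)
  rw [← eq_inv_of_mul_eq_one_right h1]
  exact (summable_qg_mul_pow hq0 hq1 hw).hasSum

/-- The value `(q^{m+1}; q)_∞ = (q; q)_∞ / (q; q)_m`. -/
lemma qPochInf_zpow_succ (hq0 : 0 < q) (hq1 : q < 1) {m : ℤ} (hm : 0 ≤ m) :
    qPochInf ((q : ℂ) ^ (m + 1)) q = qPochInf q q * (qg q m : ℂ) := by
  obtain ⟨k, rfl⟩ := Int.eq_ofNat_of_zero_le hm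
  induction k with
  | zero => simp [qg_zero]
  | succ k ih =>
    have h1 := qPochInf_eq hq0 hq1 ((q : ℂ) ^ ((k : ℤ) + 1))
    rw [ih (by positivity), qg_succ hq0 hq1 k] at h1
    have hk' : (1 - (q : ℂ) ^ ((k : ℤ) + 1)) ≠ 0 := by
      have : 0 < 1 - q ^ (k + 1) := sub_pos.2 (pow_lt_one₀ hq0.le hq1 (Nat.succ_ne_zero k))
      have h2 : ((1 - q ^ (k + 1) : ℝ) : ℂ) ≠ 0 := by exact_mod_cast this.ne'
      intro h3
      apply h2
      rw [← h3]
      push_cast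
      norm_cast
    apply mul_left_cancel₀ hk'
    have h4 : (q : ℂ) ^ (((k + 1 : ℕ) : ℤ) + 1) = (q : ℂ) ^ ((k : ℤ) + 1) * q := by
      rw [← zpow_add_one₀ (by exact_mod_cast hq0.ne')]; push_cast; rfl
    rw [h4, ← h1]
    push_cast
    have h5 : (q : ℂ) ^ ((k : ℤ) + 1) = (q : ℂ) ^ (k + 1) := by norm_cast
    rw [h5]
    ring

end Pochhammer

end QWhittaker
end

/-! ### Commutation of branching and Pieri coefficients. -/

noncomputable section

namespace QWhittaker

/-- The branching coefficient `ψ_{λ/μ}` between `n + 1` and `n` rows, zero off interlacing pairs. -/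
def psi (q : ℝ) {n : ℕ} (lam : Fin (n + 1) → ℤ) (mu : Fin n → ℤ) : ℝ :=
  ∏ i : Fin n, qf q (lam i.castSucc - lam i.succ) *
    (qg q (lam i.castSucc - mu i) * qg q (mu i - lam i.succ))

/-- The Pieri coefficient `φ_{λ/κ}` between signatures with `n` rows, zero off interlacing pairs. -/
def phi (q : ℝ) : {n : ℕ} → (Fin n → ℤ) → (Fin n → ℤ) → ℝ
  | 0, _, _ => 1
  | _ + 1, lam, kap => (∏ i, qg q (lam i - kap i)) *
      ∏ j : Fin _, qf q (kap j.castSucc - kap j.succ) * qg q (kap j.castSucc - lam j.succ)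

section Commutation

variable {q : ℝ} {n : ℕ}

/-- The product of the intervals between consecutive rows. -/
def rowBox (kap : Fin (n + 1) → ℤ) : Finset (Fin n → ℤ) :=
  Fintype.piFinset fun i => Finset.Icc (kap i.succ) (kap i.castSucc)

/-- The lower bounds of the decoupled sums. -/
def lowerRow (kap : Fin (n + 1) → ℤ) (mu nu : Fin n → ℤ) : Fin (n + 1) → ℤ :=
  Fin.snoc (fun i => kap i.castSucc + mu i - nu i) (kap (Fin.last n))

lemma lowerRow_castSucc (kap : Fin (n + 1) → ℤ) (mu nu : Fin n → ℤ) (i : Fin n) :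
    lowerRow kap mu nu i.castSucc = kap i.castSucc + mu i - nu i := by simp [lowerRow]

lemma lowerRow_last (kap : Fin (n + 1) → ℤ) (mu nu : Fin n → ℤ) :
    lowerRow kap mu nu (Fin.last n) = kap (Fin.last n) := by simp [lowerRow]

lemma sum_lowerRow (kap : Fin (n + 1) → ℤ) (mu nu : Fin n → ℤ) :
    ∑ j, lowerRow kap mu nu j = ∑ j, kap j + ∑ i, mu i - ∑ i, nu i := by
  rw [Fin.sum_univ_castSucc, Fin.sum_univ_castSucc (f := kap)]
  simp only [lowerRow_castSucc, lowerRow_last, Finset.sum_sub_distrib, Finset.sum_add_distrib]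
  ring

/-- The Gaussian weight of the auxiliary row. -/
def auxWeight (q : ℝ) (k m v : ℤ) : ℝ := q ^ ((k - v) * (m - v)) * qg q (k - v) * qg q (m - v)

/-- For each `i`, the factors joining `λ_i`, `λ_{i+1}`, `κ_i`, `μ_i` form the left side of
`qVandermonde`. Expanding all of them introduces the row `ν`, after which no factor contains two
entries of `λ`. The hypothesis places the ranges `[λ_{i+1}, κ_i]` inside a box independent of `λ`,
so that the sums over `λ` and `ν` can later be exchanged. -/
lemma phi_mul_psi_eq_sum (hq0 : 0 < q) (hq1 : q < 1) (lam kap : Fin (n + 1) → ℤ)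
    (mu : Fin n → ℤ) (h : ∀ i : Fin n, kap i.succ ≤ lam i.succ) :
    phi q lam kap * psi q lam mu = ∑ nu ∈ rowBox kap,
      (∏ i : Fin n, qf q (kap i.castSucc - kap i.succ)) *
        ((∏ j, qg q (lam j - lowerRow kap mu nu j)) *
        ∏ i, auxWeight q (kap i.castSucc) (mu i) (nu i) * qg q (nu i - lam i.succ)) := by
  have h1 : ∀ nu : Fin n → ℤ, (∏ i : Fin n, qf q (kap i.castSucc - kap i.succ)) *
        ((∏ j, qg q (lam j - lowerRow kap mu nu j)) *
        ∏ i, auxWeight q (kap i.castSucc) (mu i) (nu i) * qg q (nu i - lam i.succ)) =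
      (∏ i : Fin n, qf q (kap i.castSucc - kap i.succ)) *
        qg q (lam (Fin.last n) - kap (Fin.last n)) *
        ∏ i : Fin n, (q ^ ((kap i.castSucc - nu i) * (mu i - nu i)) * qg q (kap i.castSucc - nu i) *
          qg q (mu i - nu i) * qg q (nu i - lam i.succ) *
          qg q (lam i.castSucc - kap i.castSucc - mu i + nu i)) := by
    intro nu
    rw [Fin.prod_univ_castSucc, lowerRow_last]
    simp only [lowerRow_castSucc, auxWeight]
    rw [mul_right_comm _ (qg q _), ← Finset.prod_mul_distrib, mul_comm (∏ i : Fin n, _) (qg q _),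
      ← mul_assoc]
    congr 1
    refine Finset.prod_congr rfl fun i _ => ?_
    rw [show lam i.castSucc - (kap i.castSucc + mu i - nu i) =
      lam i.castSucc - kap i.castSucc - mu i + nu i by ring]
    ring
  rw [Finset.sum_congr rfl fun nu _ => h1 nu, ← Finset.mul_sum, rowBox,
    ← Finset.prod_univ_sum (fun i : Fin n => Finset.Icc (kap i.succ) (kap i.castSucc))
      (fun i v => q ^ ((kap i.castSucc - v) * (mu i - v)) * qg q (kap i.castSucc - v) *
          qg q (mu i - v) * qg q (v - lam i.succ) *
          qg q (lam i.castSucc - kap i.castSucc - mu i + v))]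
  rw [Finset.prod_congr rfl fun i _ => (qVandermonde hq0 hq1 (lam i.castSucc) (kap i.castSucc)
    (mu i) (lam i.succ) (Finset.Icc_subset_Icc_left (h i))).symm]
  rw [phi, psi, Fin.prod_univ_castSucc]
  simp only [Finset.prod_mul_distrib]
  ring

/-- Here `ν'_{i-1}` and `ν'_i` play the roles of `l` and `p`, with `m = κ_i` and `n = μ_i`. Nothing
lies above the first entry, so that slot uses `qVandermonde_lim`. The decoupled factors of `ν'_i`
are those that `λ_{i+1}` has in `phi_mul_psi_eq_sum`, with the same auxiliary weights. -/
lemma psi_mul_phi_eq_sum (hq0 : 0 < q) (hq1 : q < 1) (kap : Fin (n + 1) → ℤ)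
    (mu nu' : Fin n → ℤ) (h : ∀ i : Fin n, kap i.succ ≤ nu' i) :
    psi q kap nu' * phi q mu nu' = ∑ nu ∈ rowBox kap,
      (∏ i : Fin n, qf q (kap i.castSucc - kap i.succ)) *
        ((∏ i : Fin n, qg q (nu' i - lowerRow kap mu nu i.succ)) *
        ∏ i, auxWeight q (kap i.castSucc) (mu i) (nu i) * qg q (nu i - nu' i)) := by
  cases n with
  | zero => simp [psi, phi, rowBox]
  | succ m =>
    set s : Fin (m + 1) → ℤ → ℝ := Fin.cons
      (fun v => q ^ ((kap 0 - v) * (mu 0 - v)) * qg q (kap 0 - v) * qg q (mu 0 - v) *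
        qg q (v - nu' 0))
      (fun j v => q ^ ((kap j.succ.castSucc - v) * (mu j.succ - v)) *
        qg q (kap j.succ.castSucc - v) * qg q (mu j.succ - v) * qg q (v - nu' j.succ) *
        qg q (nu' j.castSucc - kap j.succ.castSucc - mu j.succ + v)) with hs
    have h1 : ∀ nu : Fin (m + 1) → ℤ, (∏ i : Fin (m + 1), qf q (kap i.castSucc - kap i.succ)) *
        ((∏ i : Fin (m + 1), qg q (nu' i - lowerRow kap mu nu i.succ)) *
        ∏ i, auxWeight q (kap i.castSucc) (mu i) (nu i) * qg q (nu i - nu' i)) =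
        (∏ i : Fin (m + 1), qf q (kap i.castSucc - kap i.succ)) *
          qg q (nu' (Fin.last m) - kap (Fin.last (m + 1))) * ∏ i, s i (nu i) := by
      intro nu
      rw [Fin.prod_univ_castSucc (fun i : Fin (m + 1) => qg q _), Fin.succ_last, lowerRow_last,
        Fin.prod_univ_succ (fun i : Fin (m + 1) => auxWeight q _ _ _ * _),
        Fin.prod_univ_succ (fun i => s i (nu i))]
      simp only [hs, Fin.cons_zero, Fin.cons_succ, Fin.succ_castSucc, lowerRow_castSucc, auxWeight,
        Fin.castSucc_zero]
      have h2 : ∀ j : Fin m, nu' j.castSucc - (kap j.succ.castSucc + mu j.succ - nu j.succ) =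
        nu' j.castSucc - kap j.succ.castSucc - mu j.succ + nu j.succ := fun j => by ring
      simp only [h2, Finset.prod_mul_distrib]
      ring
    rw [Finset.sum_congr rfl fun nu _ => h1 nu, ← Finset.mul_sum, rowBox,
      ← Finset.prod_univ_sum (fun i : Fin (m + 1) => Finset.Icc (kap i.succ) (kap i.castSucc)) s,
      Fin.prod_univ_succ (fun i => ∑ v ∈ Finset.Icc (kap i.succ) (kap i.castSucc), s i v)]
    simp only [hs, Fin.cons_zero, Fin.cons_succ, Fin.castSucc_zero]
    rw [← qVandermonde_lim hq0 hq1 (kap 0) (mu 0) (nu' 0)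
        (Finset.Icc_subset_Icc_left (h 0)),
      Finset.prod_congr (s₁ := (Finset.univ : Finset (Fin m))) rfl
        fun j _ => (qVandermonde hq0 hq1 (nu' j.castSucc)
        (kap j.succ.castSucc) (mu j.succ) (nu' j.succ)
        (Finset.Icc_subset_Icc_left (h j.succ))).symm]
    rw [psi, phi]
    simp only [Finset.prod_mul_distrib]
    rw [Fin.prod_univ_castSucc (fun i : Fin (m + 1) => qg q (nu' i - kap i.succ)),
      Fin.prod_univ_succ (fun i : Fin (m + 1) => qg q (mu i - nu' i)),
      Fin.prod_univ_succ (fun i : Fin (m + 1) => qg q (kap i.castSucc - nu' i))]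
    simp only [Fin.succ_castSucc, Fin.castSucc_zero, Fin.succ_last]
    ring

lemma qg_ne_zero_iff (hq0 : 0 < q) (hq1 : q < 1) {m : ℤ} : qg q m ≠ 0 ↔ 0 ≤ m :=
  ⟨fun h => not_lt.1 fun h' => h (qg_of_neg h'), fun h => (qg_pos hq0 hq1 h).ne'⟩

lemma phi_eq_zero_of_notMem (lam kap : Fin (n + 1) → ℤ)
    (h : (fun i => lam i.succ) ∉ rowBox kap) : phi q lam kap = 0 := by
  simp only [rowBox, Fintype.mem_piFinset, Finset.mem_Icc, not_forall, not_and_or, not_le] at h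
  obtain ⟨i, h | h⟩ := h
  · rw [phi, Finset.prod_eq_zero (Finset.mem_univ i.succ) (qg_of_neg (by omega)), zero_mul]
  · rw [phi]
    refine mul_eq_zero_of_right _ (Finset.prod_eq_zero (Finset.mem_univ i) ?_)
    rw [qg_of_neg (by omega), mul_zero]

/-- The decoupled sums on the two sides of the commutation relation are exchanged by a
reflection. -/
lemma sum_rowBox_reflect (hq0 : 0 < q) (hq1 : q < 1) (kap : Fin (n + 1) → ℤ) (mu nu : Fin n → ℤ)
    (hnu : nu ∈ rowBox kap) (hmu : ∀ i, nu i ≤ mu i) {w : ℂ} (hw : w ≠ 0) :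
    ∑ l ∈ rowBox kap, ((∏ i, qg q (l i - lowerRow kap mu nu i.succ) * qg q (nu i - l i) : ℝ) : ℂ) *
      w ^ (∑ i, l i) =
    w ^ (∑ i, nu i + ∑ i : Fin n, lowerRow kap mu nu i.succ) *
      ∑ l ∈ rowBox kap, ((∏ i, qg q (l i - lowerRow kap mu nu i.succ) * qg q (nu i - l i) : ℝ) : ℂ) *
      w ^ (-∑ i, l i) := by
  have hB : ∀ j, kap j ≤ lowerRow kap mu nu j := by
    intro j
    refine Fin.lastCases ?_ (fun i => ?_) j
    · rw [lowerRow_last]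
    · rw [lowerRow_castSucc]; have := hmu i; omega
  set B : Fin n → ℤ := fun i => lowerRow kap mu nu i.succ with hBdef
  set c : (Fin n → ℤ) → ℝ := fun l => ∏ i, qg q (l i - B i) * qg q (nu i - l i) with hc
  have hsupp : ∀ l, l ∉ rowBox kap → c l = 0 := by
    intro l hl
    by_contra h
    apply hl
    simp only [hc, Finset.prod_ne_zero_iff, Finset.mem_univ, true_imp_iff, mul_ne_zero_iff,
      qg_ne_zero_iff hq0 hq1] at h
    simp only [rowBox, Fintype.mem_piFinset, Finset.mem_Icc] at hnu ⊢
    intro i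
    have h1 := h i
    have h2 := hnu i
    have h3 := hB i.succ
    simp only [hBdef] at h1
    omega
  -- Since `c` vanishes off the box, the sums extend to all of `ℤⁿ`, where `l ↦ ν + B - l` is a
  -- bijection. It exchanges the two factors in each slot, hence fixes `c`, and reverses the sign of
  -- the exponent up to the constant `|ν| + |B|`.
  have e1 : ∀ f : (Fin n → ℤ) → ℂ, ∑ l ∈ rowBox kap, (c l : ℂ) * f l = ∑' l, (c l : ℂ) * f l := by
    intro f
    refine (tsum_eq_sum fun l hl => ?_).symm
    rw [hsupp l hl]; simp
  change ∑ l ∈ rowBox kap, (c l : ℂ) * w ^ (∑ i, l i) = w ^ (∑ i, nu i + ∑ i, B i) *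
    ∑ l ∈ rowBox kap, (c l : ℂ) * w ^ (-∑ i, l i)
  rw [e1, e1, ← (Equiv.subLeft (nu + B)).tsum_eq, ← tsum_mul_left]
  refine tsum_congr fun l => ?_
  have e2 : c (Equiv.subLeft (nu + B) l) = c l := by
    simp only [hc, Equiv.subLeft_apply, Pi.sub_apply, Pi.add_apply]
    refine Finset.prod_congr rfl fun i _ => ?_
    rw [mul_comm]
    congr 2 <;> ring
  rw [e2]
  simp only [Equiv.subLeft_apply, Pi.sub_apply, Pi.add_apply, Finset.sum_sub_distrib,
    Finset.sum_add_distrib]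
  rw [sub_eq_add_neg, zpow_add₀ hw (_ + _)]
  ring

lemma hasSum_qg_mul_zpow (hq0 : 0 < q) (hq1 : q < 1) {w : ℂ} (hw0 : w ≠ 0) (hw : ‖w‖ < 1) (b : ℤ) :
    HasSum (fun l : ℤ => (qg q (l - b) : ℂ) * w ^ l) (w ^ b * (qPochInf w q)⁻¹) := by
  have h := (hasSum_qg_mul_pow hq0 hq1 hw).mul_left (w ^ b)
  have hinj : Function.Injective (fun k : ℕ => (k : ℤ) + b) := fun a c h => by simpa using h
  rw [← hinj.hasSum_iff]
  · refine h.congr_fun ?_ |> fun h' => h'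
    intro k
    simp only [Function.comp, add_sub_cancel_right, zpow_add₀ hw0, zpow_natCast]
    ring
  · intro l hl
    rw [qg_of_neg, Complex.ofReal_zero, zero_mul]
    by_contra h'
    exact hl ⟨(l - b).toNat, by simp; omega⟩

/-- The commutation relation between branching and Pieri coefficients. -/
theorem hasSum_phi_mul_psi (hq0 : 0 < q) (hq1 : q < 1) (kap : Fin (n + 1) → ℤ) (mu : Fin n → ℤ)
    {w : ℂ} (hw0 : w ≠ 0) (hw : ‖w‖ < 1) :
    HasSum (fun lam : Fin (n + 1) → ℤ => ((phi q lam kap * psi q lam mu : ℝ) : ℂ) *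
        w ^ (∑ j, lam j - ∑ j, kap j - ∑ i, mu i))
      ((qPochInf w q)⁻¹ * ∑ nu ∈ rowBox kap, ((psi q kap nu * phi q mu nu : ℝ) : ℂ) *
        w ^ (-∑ i, nu i)) := by
  set K : ℝ := ∏ i : Fin n, qf q (kap i.castSucc - kap i.succ) with hK
  set A : (Fin n → ℤ) → ℝ := fun nu => ∏ i, auxWeight q (kap i.castSucc) (mu i) (nu i) with hA
  set c : (Fin n → ℤ) → (Fin n → ℤ) → ℝ := fun nu l =>
    ∏ i, qg q (l i - lowerRow kap mu nu i.succ) * qg q (nu i - l i) with hc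
  -- Only the first entry of `λ` is unbounded. The others are confined to `rowBox kap` by the Pieri
  -- coefficient, so the sum is a finite sum of Euler series in the first entry, and these produce
  -- `1/(w;q)_∞`.
  rw [← (Fin.consEquiv fun _ : Fin (n + 1) => ℤ).hasSum_iff]
  have hfib : ∀ l : Fin n → ℤ, HasSum (fun l0 : ℤ =>
      ((phi q (Fin.cons l0 l : Fin (n + 1) → ℤ) kap *
        psi q (Fin.cons l0 l : Fin (n + 1) → ℤ) mu : ℝ) : ℂ) *
        w ^ (∑ j, (Fin.cons l0 l : Fin (n + 1) → ℤ) j - ∑ j, kap j - ∑ i, mu i))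
      (if l ∈ rowBox kap then ∑ nu ∈ rowBox kap, ((K * A nu * c nu l : ℝ) : ℂ) *
        (w ^ (∑ i, l i - ∑ j, kap j - ∑ i, mu i) *
          (w ^ (lowerRow kap mu nu 0) * (qPochInf w q)⁻¹)) else 0) := by
    intro l
    split_ifs with hl
    · have h1 : ∀ l0 : ℤ, ((phi q (Fin.cons l0 l : Fin (n + 1) → ℤ) kap *
          psi q (Fin.cons l0 l : Fin (n + 1) → ℤ) mu : ℝ) : ℂ) *
          w ^ (∑ j, (Fin.cons l0 l : Fin (n + 1) → ℤ) j - ∑ j, kap j - ∑ i, mu i) =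
          ∑ nu ∈ rowBox kap, ((K * A nu * c nu l : ℝ) : ℂ) *
            (w ^ (∑ i, l i - ∑ j, kap j - ∑ i, mu i) *
              ((qg q (l0 - lowerRow kap mu nu 0) : ℂ) * w ^ l0)) := by
        intro l0
        rw [phi_mul_psi_eq_sum hq0 hq1 _ kap mu (fun i => by
          rw [rowBox, Fintype.mem_piFinset] at hl
          simpa using (Finset.mem_Icc.1 (hl i)).1)]
        rw [Complex.ofReal_sum, Finset.sum_mul]
        refine Finset.sum_congr rfl fun nu _ => ?_
        simp only [Fin.prod_univ_succ (fun j => qg q _), Fin.sum_univ_succ (fun j =>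
          (Fin.cons l0 l : Fin (n + 1) → ℤ) j), Fin.cons_zero, Fin.cons_succ, hK, hA, hc,
          Finset.prod_mul_distrib]
        rw [show l0 + ∑ i, l i - ∑ j, kap j - ∑ i, mu i =
          (∑ i, l i - ∑ j, kap j - ∑ i, mu i) + l0 by ring, zpow_add₀ hw0 _ l0]
        push_cast
        ring
      simp only [h1]
      exact hasSum_sum fun nu _ => ((hasSum_qg_mul_zpow hq0 hq1 hw0 hw _).mul_left _).mul_left _
    · have h1 : ∀ l0 : ℤ, phi q (Fin.cons l0 l : Fin (n + 1) → ℤ) kap = 0 :=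
        fun l0 => phi_eq_zero_of_notMem _ _ (by simpa using hl)
      simp only [h1, zero_mul, Complex.ofReal_zero]
      exact hasSum_zero
  have hsupp : ∀ l : Fin n → ℤ, ∀ l0 : ℤ, l ∉ rowBox kap →
      phi q (Fin.cons l0 l : Fin (n + 1) → ℤ) kap = 0 :=
    fun l l0 hl => phi_eq_zero_of_notMem _ _ (by simpa using hl)
  have htot : HasSum ((fun lam : Fin (n + 1) → ℤ => ((phi q lam kap * psi q lam mu : ℝ) : ℂ) *
        w ^ (∑ j, lam j - ∑ j, kap j - ∑ i, mu i)) ∘ (Fin.consEquiv fun _ : Fin (n + 1) => ℤ))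
      (∑ l ∈ rowBox kap, ∑ nu ∈ rowBox kap, ((K * A nu * c nu l : ℝ) : ℂ) *
        (w ^ (∑ i, l i - ∑ j, kap j - ∑ i, mu i) *
          (w ^ (lowerRow kap mu nu 0) * (qPochInf w q)⁻¹))) := by
    have h2 : ∀ l ∈ rowBox kap, HasSum (fun p : ℤ × (Fin n → ℤ) => if p.2 = l then
        ((phi q (Fin.cons p.1 p.2 : Fin (n + 1) → ℤ) kap *
        psi q (Fin.cons p.1 p.2 : Fin (n + 1) → ℤ) mu : ℝ) : ℂ) *
        w ^ (∑ j, (Fin.cons p.1 p.2 : Fin (n + 1) → ℤ) j - ∑ j, kap j - ∑ i, mu i) else 0)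
        (∑ nu ∈ rowBox kap, ((K * A nu * c nu l : ℝ) : ℂ) *
        (w ^ (∑ i, l i - ∑ j, kap j - ∑ i, mu i) *
          (w ^ (lowerRow kap mu nu 0) * (qPochInf w q)⁻¹))) := by
      intro l hl
      have h3 := hfib l
      rw [if_pos hl] at h3
      have hinj : Function.Injective (fun l0 : ℤ => (l0, l)) := fun a b h => by simpa using h
      rw [← hinj.hasSum_iff]
      · simpa [Function.comp_def] using h3
      · rintro ⟨l0, l'⟩ hne
        rw [if_neg]
        rintro rfl
        exact hne ⟨l0, rfl⟩
    refine (hasSum_sum h2).congr_fun ?_ |> fun h => h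
    rintro ⟨l0, l⟩
    simp only [Function.comp, Fin.consEquiv, Equiv.coe_fn_mk]
    by_cases hl : l ∈ rowBox kap
    · rw [Finset.sum_ite_eq, if_pos hl]
    · rw [Finset.sum_ite_eq, if_neg hl, hsupp l l0 hl]; simp
  convert htot using 1
  rw [Finset.sum_comm]
  have hR : ∀ nu' ∈ rowBox kap, ((psi q kap nu' * phi q mu nu' : ℝ) : ℂ) * w ^ (-∑ i, nu' i) =
      ∑ nu ∈ rowBox kap, ((K * A nu * c nu nu' : ℝ) : ℂ) * w ^ (-∑ i, nu' i) := by
    intro nu' hnu'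
    rw [psi_mul_phi_eq_sum hq0 hq1 kap mu nu' (fun i => by
          rw [rowBox, Fintype.mem_piFinset] at hnu'
          exact (Finset.mem_Icc.1 (hnu' i)).1), Complex.ofReal_sum, Finset.sum_mul]
    refine Finset.sum_congr rfl fun nu _ => ?_
    simp only [hK, hA, hc, Finset.prod_mul_distrib]
    push_cast
    ring
  rw [Finset.sum_congr rfl hR, Finset.sum_comm, Finset.mul_sum]
  refine Finset.sum_congr rfl fun nu hnu => ?_
  -- For `ν ≤ μ` the reflection turns `w^{|l|}` into `w^{-|l|}`; the leftover powers of `w` cancel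
  -- because `|lowerRow| = |κ| + |μ| - |ν|`. Otherwise the auxiliary weight is zero.
  by_cases hmu : ∀ i, nu i ≤ mu i
  · have h4 := sum_rowBox_reflect hq0 hq1 kap mu nu hnu hmu hw0
    have h5 := sum_lowerRow kap mu nu
    rw [Fin.sum_univ_succ] at h5
    have h6 : ∀ l : Fin n → ℤ, ((K * A nu * c nu l : ℝ) : ℂ) *
        (w ^ (∑ i, l i - ∑ j, kap j - ∑ i, mu i) *
          (w ^ (lowerRow kap mu nu 0) * (qPochInf w q)⁻¹)) =
        ((K * A nu : ℝ) : ℂ) * (qPochInf w q)⁻¹ *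
          w ^ (-∑ i, nu i - ∑ i : Fin n, lowerRow kap mu nu i.succ) *
          ((c nu l : ℂ) * w ^ (∑ i, l i)) := by
      intro l
      have : w ^ (∑ i, l i - ∑ j, kap j - ∑ i, mu i) * w ^ (lowerRow kap mu nu 0) =
          w ^ (-∑ i, nu i - ∑ i : Fin n, lowerRow kap mu nu i.succ) * w ^ (∑ i, l i) := by
        rw [← zpow_add₀ hw0, ← zpow_add₀ hw0]
        congr 1
        linarith
      push_cast
      linear_combination (K : ℂ) * A nu * c nu l * (qPochInf w q)⁻¹ * this
    rw [Finset.sum_congr rfl fun l _ => h6 l, ← Finset.mul_sum, h4, ← mul_assoc, mul_assoc _ (w ^ _)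
      (w ^ _), ← zpow_add₀ hw0, Finset.mul_sum, Finset.mul_sum]
    refine Finset.sum_congr rfl fun l _ => ?_
    rw [show (-∑ i, nu i - ∑ i : Fin n, lowerRow kap mu nu i.succ +
      (∑ i, nu i + ∑ i : Fin n, lowerRow kap mu nu i.succ)) = 0 by ring, zpow_zero]
    simp only [hc]
    push_cast
    ring
  · push Not at hmu
    obtain ⟨i, hi⟩ := hmu
    have hA0 : A nu = 0 := by
      simp only [hA]
      refine Finset.prod_eq_zero (Finset.mem_univ i) ?_
      rw [auxWeight, qg_of_neg (show mu i - nu i < 0 by omega), mul_zero]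
    simp [hA0]

end Commutation

end QWhittaker
end

/-! ### Interchange of sums, the branching rule and the Pieri rule. -/

noncomputable section

namespace QWhittaker

section Swap

variable {α β : Type*}

lemma hasSum_of_eq {f g : α → ℂ} {s s' : ℂ} (h : HasSum f s) (hfg : ∀ a, g a = f a)
    (hs : s' = s) : HasSum g s' := by
  rw [hs, funext hfg]
  exact h

/-- Interchange of two summations under absolute summability. -/
lemma hasSum_of_hasSum_swap {F : α → β → ℂ} {F' : α → β → ℝ} {g : β → ℂ} {g' : β → ℝ} {h : α → ℂ}
    {S : ℂ} (hF : ∀ a b, ‖F a b‖ ≤ F' a b) (hF' : ∀ b, HasSum (fun a => F' a b) (g' b))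
    (hg' : Summable g') (hg : ∀ b, HasSum (fun a => F a b) (g b))
    (hh : ∀ a, HasSum (fun b => F a b) (h a)) (hS : HasSum g S) : HasSum h S := by
  have h1 : Summable fun p : β × α => F' p.2 p.1 := by
    rw [summable_prod_of_nonneg fun p => (norm_nonneg _).trans (hF p.2 p.1)]
    exact ⟨fun b => (hF' b).summable, by simpa only [(hF' _).tsum_eq] using hg'⟩
  have h2 : Summable fun p : β × α => F p.2 p.1 := h1.of_norm_bounded fun p => hF p.2 p.1
  obtain ⟨T, hT⟩ := h2
  have h3 : T = S := (hT.prod_fiberwise hg).unique hS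
  subst h3
  have h4 : HasSum (fun p : α × β => F p.1 p.2) T := 
    (Equiv.prodComm β α).hasSum_iff.1 hT
  exact h4.prod_fiberwise hh

/-- Complex numbers that are non-negative reals. -/
def IsNN (z : ℂ) : Prop := z = (‖z‖ : ℂ)

lemma IsNN.ofReal {r : ℝ} (hr : 0 ≤ r) : IsNN (r : ℂ) := by
  simp [IsNN, abs_of_nonneg hr]

lemma IsNN.mul {z w : ℂ} (hz : IsNN z) (hw : IsNN w) : IsNN (z * w) := by
  unfold IsNN at *
  rw [norm_mul, Complex.ofReal_mul, ← hz, ← hw]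

lemma IsNN.zpow {z : ℂ} (hz : IsNN z) (k : ℤ) : IsNN (z ^ k) := by
  unfold IsNN at *
  rw [norm_zpow, Complex.ofReal_zpow, ← hz]

lemma IsNN.sum {ι : Type*} {s : Finset ι} {f : ι → ℂ} (h : ∀ i ∈ s, IsNN (f i)) :
    IsNN (∑ i ∈ s, f i) := by
  have : ∑ i ∈ s, f i = ((∑ i ∈ s, ‖f i‖ : ℝ) : ℂ) := by
    rw [Complex.ofReal_sum]
    exact Finset.sum_congr rfl fun i hi => h i hi
  rw [this]
  exact IsNN.ofReal (Finset.sum_nonneg fun i _ => norm_nonneg _)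

lemma IsNN.norm_sum {ι : Type*} {s : Finset ι} {f : ι → ℂ} (h : ∀ i ∈ s, IsNN (f i)) :
    ‖∑ i ∈ s, f i‖ = ∑ i ∈ s, ‖f i‖ := by
  have : ∑ i ∈ s, f i = ((∑ i ∈ s, ‖f i‖ : ℝ) : ℂ) := by
    rw [Complex.ofReal_sum]
    exact Finset.sum_congr rfl fun i hi => h i hi
  rw [this, Complex.norm_real, Real.norm_of_nonneg (Finset.sum_nonneg fun i _ => norm_nonneg _)]

/-- For non-negative terms the norm is the real part. This supplies the majorant in
`hasSum_of_hasSum_swap`: an identity applied to the moduli of the variables also gives the sum of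
the norms. -/
lemma HasSum.norm_of_isNN {f : α → ℂ} {s : ℂ} (h : HasSum f s) (hf : ∀ a, IsNN (f a)) :
    HasSum (fun a => ‖f a‖) ‖s‖ := by
  have h1 : HasSum (fun a => ‖f a‖) s.re := by
    have h2 := Complex.hasSum_re h
    refine h2.congr_fun fun a => ?_
    rw [hf a]
    simp
  have h3 : HasSum f ((s.re : ℝ) : ℂ) := by
    rw [← Complex.hasSum_ofReal] at h1
    refine h1.congr_fun fun a => ?_
    exact hf a
  have h4 : s = ((s.re : ℝ) : ℂ) := h.unique h3
  have h5 : 0 ≤ s.re := h1.nonneg fun a => norm_nonneg _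
  have h6 : ‖s‖ = s.re := by rw [h4]; simpa using h5
  rwa [h6]

end Swap

section Branching

variable {q : ℝ} {n : ℕ}

lemma qFact_eq (m : ℤ) : qFact (q : ℂ) m = (qf q m : ℂ) := by
  simp [qFact, qf]

lemma psi_nonneg (hq0 : 0 < q) (hq1 : q < 1) (lam : Fin (n + 1) → ℤ) (mu : Fin n → ℤ) :
    0 ≤ psi q lam mu :=
  Finset.prod_nonneg fun _ _ => mul_nonneg (qf_pos hq0 hq1 _).le
    (mul_nonneg (qg_nonneg hq0 hq1 _) (qg_nonneg hq0 hq1 _))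

lemma phi_nonneg (hq0 : 0 < q) (hq1 : q < 1) (lam kap : Fin n → ℤ) : 0 ≤ phi q lam kap := by
  cases n with
  | zero => exact zero_le_one
  | succ m =>
    rw [phi]
    exact mul_nonneg (Finset.prod_nonneg fun _ _ => qg_nonneg hq0 hq1 _)
      (Finset.prod_nonneg fun _ _ => mul_nonneg (qf_pos hq0 hq1 _).le (qg_nonneg hq0 hq1 _))

lemma psi_eq_zero_of_notMem {lam : Fin (n + 1) → ℤ} {mu : Fin n → ℤ} (h : mu ∉ rowBox lam) :
    psi q lam mu = 0 := by
  simp only [rowBox, Fintype.mem_piFinset, Finset.mem_Icc, not_forall, not_and_or, not_le] at h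
  obtain ⟨i, h | h⟩ := h
  · refine Finset.prod_eq_zero (Finset.mem_univ i) ?_
    rw [qg_of_neg (show mu i - lam i.succ < 0 by omega)]; ring
  · refine Finset.prod_eq_zero (Finset.mem_univ i) ?_
    rw [qg_of_neg (show lam i.castSucc - mu i < 0 by omega)]; ring

/-- The branching rule. -/
lemma whittakerP_succ (lam : Fin (n + 1) → ℤ) (x : Fin (n + 1) → ℂ) :
    whittakerP q (n + 1) lam x = ∑ mu ∈ rowBox lam,
      (psi q lam mu : ℂ) * x (Fin.last n) ^ (∑ i, lam i - ∑ i, mu i) *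
        whittakerP q n mu (fun i => x i.castSucc) := by
  rw [whittakerP, rowBox, Pi.Icc_eq]
  refine Finset.sum_congr rfl fun mu hmu => ?_
  rw [mul_comm (x _ ^ _)]
  congr 2
  rw [psi, Complex.ofReal_prod]
  refine Finset.prod_congr rfl fun i _ => ?_
  rw [Fintype.mem_piFinset] at hmu
  have := Finset.mem_Icc.1 (hmu i)
  simp only [qFact_eq, qg, if_pos (show 0 ≤ lam i.castSucc - mu i by omega),
    if_pos (show 0 ≤ mu i - lam i.succ by omega)]
  push_cast
  rw [div_eq_mul_inv, mul_inv]

lemma hasSum_whittakerP_succ (lam : Fin (n + 1) → ℤ) (x : Fin (n + 1) → ℂ) :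
    HasSum (fun mu : Fin n → ℤ =>
      (psi q lam mu : ℂ) * x (Fin.last n) ^ (∑ i, lam i - ∑ i, mu i) *
        whittakerP q n mu (fun i => x i.castSucc)) (whittakerP q (n + 1) lam x) := by
  rw [whittakerP_succ]
  refine hasSum_sum_of_ne_finset_zero fun mu hmu => ?_
  rw [psi_eq_zero_of_notMem hmu]
  simp

/-- `P_λ` is a Laurent polynomial with non-negative coefficients, because the branching coefficients
are non-negative. -/
lemma whittakerP_abs (hq0 : 0 < q) (hq1 : q < 1) : ∀ {n : ℕ} (lam : Fin n → ℤ) (x : Fin n → ℂ),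
    IsNN (whittakerP q n lam (fun i => (‖x i‖ : ℂ))) ∧
      ‖whittakerP q n lam x‖ ≤ ‖whittakerP q n lam (fun i => (‖x i‖ : ℂ))‖
  | 0, lam, x => ⟨by simp [whittakerP, IsNN], by simp [whittakerP]⟩
  | n + 1, lam, x => by
    have ih := fun mu : Fin n → ℤ => whittakerP_abs hq0 hq1 mu (fun i => x i.castSucc)
    have h1 : ∀ mu ∈ rowBox lam, IsNN ((psi q lam mu : ℂ) *
        (‖x (Fin.last n)‖ : ℂ) ^ (∑ i, lam i - ∑ i, mu i) *
        whittakerP q n mu (fun i => (‖x i.castSucc‖ : ℂ))) := fun mu _ =>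
      ((IsNN.ofReal (psi_nonneg hq0 hq1 lam mu)).mul ((IsNN.ofReal (norm_nonneg _)).zpow _)).mul
        (ih mu).1
    rw [whittakerP_succ, whittakerP_succ]
    refine ⟨IsNN.sum h1, ?_⟩
    rw [IsNN.norm_sum h1]
    refine (norm_sum_le _ _).trans (Finset.sum_le_sum fun mu _ => ?_)
    rw [norm_mul, norm_mul, norm_mul, norm_mul, norm_zpow, norm_zpow, Complex.norm_real ‖_‖,
      norm_norm]
    exact mul_le_mul_of_nonneg_left (ih mu).2 (by positivity)

/-- If `λ` is not weakly decreasing, no row interlaces with it and the branching sum is empty. Sums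
over all integer vectors therefore reduce to sums over signatures. -/
lemma antitone_of_whittakerP_ne_zero {lam : Fin (n + 1) → ℤ} {x : Fin (n + 1) → ℂ}
    (h : whittakerP q (n + 1) lam x ≠ 0) : Antitone lam := by
  rw [whittakerP_succ] at h
  obtain ⟨mu, hmu, -⟩ := Finset.exists_ne_zero_of_sum_ne_zero h
  rw [rowBox, Fintype.mem_piFinset] at hmu
  rw [Fin.antitone_iff_succ_le]
  intro i
  have := Finset.mem_Icc.1 (hmu i)
  omega

/-- The Pieri rule. -/
theorem hasSum_phi_mul_whittakerP (hq0 : 0 < q) (hq1 : q < 1) {y : ℂ} (hy : y ≠ 0) :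
    ∀ {n : ℕ} (x : Fin n → ℂ) (_ : ∀ i, x i ≠ 0) (_ : ∀ i, ‖x i * y‖ < 1) (kap : Fin n → ℤ),
    HasSum (fun lam : Fin n → ℤ => (phi q lam kap : ℂ) * y ^ (∑ i, lam i - ∑ i, kap i) *
      whittakerP q n lam x) ((∏ i, (qPochInf (x i * y) q)⁻¹) * whittakerP q n kap x)
  | 0, x, _, _, kap => by
    have : ∀ lam : Fin 0 → ℤ, lam = kap := fun lam => Subsingleton.elim _ _
    convert hasSum_single kap (fun lam hlam => (hlam (this lam)).elim) using 1
    simp [phi, whittakerP]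
  | n + 1, x, hx, hxy, kap => by
    have ih := fun nu => hasSum_phi_mul_whittakerP hq0 hq1 hy (fun i : Fin n => x i.castSucc)
      (fun i => hx _) (fun i => hxy _) nu
    set xl := x (Fin.last n) with hxl
    have hxl0 : xl ≠ 0 := hx _
    have hw0 : xl * y ≠ 0 := mul_ne_zero hxl0 hy
    have hw1 : ‖xl * y‖ < 1 := hxy _
    set W : (Fin n → ℤ) → ℂ := fun mu => whittakerP q n mu (fun i => x i.castSucc) with hW
    have hzp : ∀ (z : ℂ) (_ : z ≠ 0) (v : ℂ) (_ : v ≠ 0) (a b c : ℤ),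
        v ^ (a - b) * z ^ (a - c) = (z * v) ^ (a - b - c) * (v ^ c * z ^ b) := by
      intro z hz v hv a b c
      rw [mul_zpow, zpow_sub₀ hv, zpow_sub₀ hz, zpow_sub₀ hz, zpow_sub₀ hv, zpow_sub₀ hz,
        zpow_sub₀ hv]
      field_simp
    have hzp' : ∀ (z : ℂ) (_ : z ≠ 0) (v : ℂ) (_ : v ≠ 0) (b c d : ℤ),
        (z * v) ^ (-d) * (v ^ c * z ^ b) = z ^ (b - d) * v ^ (c - d) := by
      intro z hz v hv b c d
      rw [mul_zpow, zpow_sub₀ hv, zpow_sub₀ hz, zpow_neg, zpow_neg]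
      field_simp
    -- For a fixed row `μ` the sum over `λ` is the commutation relation at `z v`. The variables are
    -- kept general because the identity is needed at the given values and again at their moduli.
    have hcol : ∀ (z : ℂ) (_ : z ≠ 0) (v : ℂ) (_ : v ≠ 0) (_ : ‖z * v‖ < 1) (t : ℂ)
        (mu : Fin n → ℤ),
        HasSum (fun lam : Fin (n + 1) → ℤ => (phi q lam kap : ℂ) * v ^ (∑ i, lam i - ∑ i, kap i) *
          ((psi q lam mu : ℂ) * z ^ (∑ i, lam i - ∑ i, mu i) * t))
          ((qPochInf (z * v) q)⁻¹ * ∑ nu ∈ rowBox kap,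
            ((psi q kap nu : ℂ) * z ^ (∑ i, kap i - ∑ i, nu i)) *
              ((phi q mu nu : ℂ) * v ^ (∑ i, mu i - ∑ i, nu i) * t)) := by
      intro z hz v hv hzv t mu
      refine hasSum_of_eq ((hasSum_phi_mul_psi hq0 hq1 kap mu (mul_ne_zero hz hv) hzv).mul_right
        (v ^ (∑ i, mu i) * z ^ (∑ i, kap i) * t)) (fun lam => ?_) ?_
      · have := hzp z hz v hv (∑ i, lam i) (∑ i, kap i) (∑ i, mu i)
        push_cast
        linear_combination (phi q lam kap : ℂ) * psi q lam mu * t * this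
      · rw [mul_assoc, Finset.sum_mul]
        congr 1
        refine Finset.sum_congr rfl fun nu _ => ?_
        have := hzp' z hz v hv (∑ i, kap i) (∑ i, mu i) (∑ i, nu i)
        push_cast
        linear_combination -(psi q kap nu : ℂ) * phi q mu nu * t * this
    refine hasSum_of_hasSum_swap
      (F := fun lam mu => (phi q lam kap : ℂ) * y ^ (∑ i, lam i - ∑ i, kap i) *
        ((psi q lam mu : ℂ) * xl ^ (∑ i, lam i - ∑ i, mu i) * W mu))
      (F' := fun lam mu => ‖(phi q lam kap : ℂ) * (‖y‖ : ℂ) ^ (∑ i, lam i - ∑ i, kap i) *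
        ((psi q lam mu : ℂ) * (‖xl‖ : ℂ) ^ (∑ i, lam i - ∑ i, mu i) * (‖W mu‖ : ℂ))‖)
      (fun lam mu => ?_) (fun mu => HasSum.norm_of_isNN (hcol _ ?_ _ ?_ ?_ _ mu) fun lam => ?_) ?_
      (fun mu => hcol xl hxl0 y hy hw1 (W mu) mu)
      (fun lam => (hasSum_whittakerP_succ lam x).mul_left _) ?_
    · simp [norm_zpow]
    · exact_mod_cast norm_ne_zero_iff.2 hxl0
    · exact_mod_cast norm_ne_zero_iff.2 hy
    · simpa using hw1
    · exact ((IsNN.ofReal (phi_nonneg hq0 hq1 _ _)).mul ((IsNN.ofReal (norm_nonneg _)).zpow _)).mul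
        (((IsNN.ofReal (psi_nonneg hq0 hq1 _ _)).mul ((IsNN.ofReal (norm_nonneg _)).zpow _)).mul
          (IsNN.ofReal (norm_nonneg _)))
    -- The column sums of the majorant are finite combinations of norms of terms of the Pieri series
    -- in one variable fewer, so the inductive hypothesis gives their summability.
    · refine Summable.norm (Summable.mul_left _ (summable_sum fun nu _ => Summable.mul_left _ ?_))
      have h1 := (ih nu).summable.norm
      have h2 : Summable fun mu : Fin n → ℤ =>
          ((‖(phi q mu nu : ℂ) * y ^ (∑ i, mu i - ∑ i, nu i) * W mu‖ : ℝ) : ℂ) :=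
        Complex.summable_ofReal.2 h1
      refine h2.congr fun mu => ?_
      rw [norm_mul, norm_mul, norm_zpow, Complex.norm_real,
        Real.norm_of_nonneg (phi_nonneg hq0 hq1 _ _)]
      push_cast
      rfl
    · have h1 : HasSum (fun mu => ∑ nu ∈ rowBox kap,
            ((psi q kap nu : ℂ) * xl ^ (∑ i, kap i - ∑ i, nu i)) *
              ((phi q mu nu : ℂ) * y ^ (∑ i, mu i - ∑ i, nu i) * W mu)) _ :=
        hasSum_sum fun nu _ => (ih nu).mul_left _
      refine hasSum_of_eq (h1.mul_left ((qPochInf (xl * y) q)⁻¹)) (fun _ => rfl) ?_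
      rw [Fin.prod_univ_castSucc, whittakerP_succ, Finset.mul_sum, Finset.mul_sum]
      refine Finset.sum_congr rfl fun nu _ => ?_
      simp only [hxl]
      ring

end Branching

end QWhittaker
end

/-! ### The Cauchy identity and sums over signatures. -/

noncomputable section

namespace QWhittaker

section Cauchy

variable {q : ℝ} {n : ℕ}

/-- A signature extended by a zero row. -/
def padZero (nu : Fin n → ℤ) : Fin (n + 1) → ℤ := Fin.snoc nu 0

lemma padZero_castSucc (nu : Fin n → ℤ) (i : Fin n) : padZero nu i.castSucc = nu i := by
  simp [padZero]

lemma padZero_last (nu : Fin n → ℤ) : padZero nu (Fin.last n) = 0 := by simp [padZero]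

lemma sum_padZero (nu : Fin n → ℤ) : ∑ i, padZero nu i = ∑ i, nu i := by
  rw [Fin.sum_univ_castSucc]
  simp [padZero_castSucc, padZero_last]

/-- The coefficient `b_ν` of the Cauchy identity. -/
def cauchyCoeff (q : ℝ) (nu : Fin n → ℤ) : ℝ :=
  ∏ j : Fin n, qg q (nu j - padZero nu j.succ)

lemma cauchyCoeff_succ (lam : Fin (n + 1) → ℤ) : cauchyCoeff q lam =
    (∏ j : Fin n, qg q (lam j.castSucc - lam j.succ)) * qg q (lam (Fin.last n)) := by
  rw [cauchyCoeff, Fin.prod_univ_castSucc, Fin.succ_last, padZero_last, sub_zero]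
  congr 1
  refine Finset.prod_congr rfl fun j _ => ?_
  rw [Fin.succ_castSucc, padZero_castSucc]

lemma cauchyCoeff_nonneg (hq0 : 0 < q) (hq1 : q < 1) (nu : Fin n → ℤ) : 0 ≤ cauchyCoeff q nu :=
  Finset.prod_nonneg fun _ _ => qg_nonneg hq0 hq1 _

lemma qg_mul_qf_mul (hq0 : 0 < q) (hq1 : q < 1) (a b c : ℤ) :
    qg q (a - c) * qf q (a - c) * (qg q (a - b) * qg q (b - c)) = qg q (a - b) * qg q (b - c) := by
  by_cases h : 0 ≤ a - b ∧ 0 ≤ b - c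
  · rw [mul_comm (qg q (a - c)), qf_mul_qg hq0 hq1 (by omega), one_mul]
  · rw [not_and_or, not_le, not_le] at h
    rcases h with h | h <;> rw [qg_of_neg h] <;> ring

/-- Once the factors `(q;q)` of the consecutive differences cancel, both sides are the product of
`qg` over all the interlacing gaps between `λ` and `(ν, 0)`. The identity trades a branching step in
one set of variables for a Pieri step in the other. -/
lemma cauchyCoeff_mul_phi_padZero (hq0 : 0 < q) (hq1 : q < 1) (lam : Fin (n + 1) → ℤ)
    (nu : Fin n → ℤ) :
    cauchyCoeff q nu * phi q lam (padZero nu) = cauchyCoeff q lam * psi q lam nu := by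
  have h1 : cauchyCoeff q nu * phi q lam (padZero nu) = qg q (lam 0 - padZero nu 0) *
      ∏ j : Fin n, qg q (nu j - padZero nu j.succ) * qf q (nu j - padZero nu j.succ) *
        (qg q (nu j - lam j.succ) * qg q (lam j.succ - padZero nu j.succ)) := by
    rw [cauchyCoeff, phi, Fin.prod_univ_succ]
    simp only [Finset.prod_mul_distrib, padZero_castSucc]
    ring
  have h2 : cauchyCoeff q lam * psi q lam nu = qg q (lam (Fin.last n)) *
      ∏ j : Fin n, qg q (lam j.castSucc - lam j.succ) * qf q (lam j.castSucc - lam j.succ) *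
        (qg q (lam j.castSucc - nu j) * qg q (nu j - lam j.succ)) := by
    rw [cauchyCoeff_succ, psi]
    simp only [Finset.prod_mul_distrib]
    ring
  rw [h1, h2]
  simp only [qg_mul_qf_mul hq0 hq1]
  have h3 : qg q (lam 0 - padZero nu 0) * ∏ j : Fin n, qg q (lam j.succ - padZero nu j.succ) =
      (∏ j : Fin n, qg q (lam j.castSucc - nu j)) * qg q (lam (Fin.last n)) := by
    rw [← Fin.prod_univ_succ (fun j => qg q (lam j - padZero nu j)), Fin.prod_univ_castSucc]
    simp only [padZero_castSucc, padZero_last, sub_zero]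
  simp only [Finset.prod_mul_distrib]
  linear_combination (∏ j : Fin n, qg q (nu j - lam j.succ)) * h3

/-- The companion exchange: both sides are the product of `qg` over the gaps `ν_i - κ_i` and `κ_i -
ν_{i+1}`, with a zero appended to `ν`. -/
lemma cauchyCoeff_mul_psi_padZero (hq0 : 0 < q) (hq1 : q < 1) (nu kap : Fin n → ℤ) :
    cauchyCoeff q nu * psi q (padZero nu) kap = cauchyCoeff q kap * phi q nu kap := by
  cases n with
  | zero => simp [cauchyCoeff, psi, phi]
  | succ m =>
    have h0 : cauchyCoeff q nu * psi q (padZero nu) kap =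
        ∏ i : Fin (m + 1), qg q (nu i - padZero nu i.succ) * qf q (nu i - padZero nu i.succ) *
        (qg q (nu i - kap i) * qg q (kap i - padZero nu i.succ)) := by
      rw [cauchyCoeff, psi]
      simp only [Finset.prod_mul_distrib, padZero_castSucc]
      ring
    have h2 : cauchyCoeff q kap * phi q nu kap = qg q (nu 0 - kap 0) * qg q (kap (Fin.last m)) *
        ∏ j : Fin m, qg q (kap j.castSucc - kap j.succ) * qf q (kap j.castSucc - kap j.succ) *
          (qg q (kap j.castSucc - nu j.succ) * qg q (nu j.succ - kap j.succ)) := by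
      rw [cauchyCoeff_succ, phi, Fin.prod_univ_succ]
      simp only [Finset.prod_mul_distrib]
      ring
    rw [h0, h2]
    simp only [qg_mul_qf_mul hq0 hq1, Finset.prod_mul_distrib]
    rw [Fin.prod_univ_succ, Fin.prod_univ_castSucc (fun i : Fin (m + 1) => qg q (kap i - _)),
      Fin.succ_last, padZero_last, sub_zero]
    simp only [Fin.succ_castSucc, padZero_castSucc]
    ring

/-- The Cauchy identity. -/
theorem hasSum_cauchy (hq0 : 0 < q) (hq1 : q < 1) : ∀ {n : ℕ} (x y : Fin n → ℂ)
    (_ : ∀ i, x i ≠ 0) (_ : ∀ i, y i ≠ 0) (_ : ∀ i j, ‖x i * y j‖ < 1),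
    HasSum (fun lam : Fin n → ℤ => (cauchyCoeff q lam : ℂ) * whittakerP q n lam x *
      whittakerP q n lam y) (∏ i, ∏ j, (qPochInf (x i * y j) q)⁻¹)
  | 0, x, y, _, _, _ => by
    have : ∀ lam : Fin 0 → ℤ, lam = 0 := fun lam => Subsingleton.elim _ _
    refine hasSum_of_eq (hasSum_single (0 : Fin 0 → ℤ) (fun lam hlam => (hlam (this lam)).elim))
      (fun _ => rfl) ?_
    simp [cauchyCoeff, whittakerP]
  | n + 1, x, y, hx, hy, hxy => by
    have ih : ∀ x y : Fin (n + 1) → ℂ, (∀ i, x i ≠ 0) → (∀ i, y i ≠ 0) →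
        (∀ i j, ‖x i * y j‖ < 1) → _ := fun x y hx hy hxy =>
      hasSum_cauchy hq0 hq1 (fun i : Fin n => x i.castSucc) (fun i : Fin n => y i.castSucc)
        (fun _ => hx _) (fun _ => hy _) (fun _ _ => hxy _ _)
    have habs : ∀ x : Fin (n + 1) → ℂ, (∀ i, x i ≠ 0) → ∀ i, ((‖x i‖ : ℝ) : ℂ) ≠ 0 :=
      fun x hx i => by exact_mod_cast norm_ne_zero_iff.2 (hx i)
    have habs2 : ∀ x y : Fin (n + 1) → ℂ, (∀ i j, ‖x i * y j‖ < 1) →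
        ∀ i j, ‖((‖x i‖ : ℝ) : ℂ) * ((‖y j‖ : ℝ) : ℂ)‖ < 1 := fun x y hxy i j => by
      simpa using hxy i j
    have hP := fun {m : ℕ} (lam : Fin m → ℤ) (x : Fin m → ℂ) => whittakerP_abs hq0 hq1 lam x
    -- the sum over the Pieri step in the second set of variables
    have hcol : ∀ x y : Fin (n + 1) → ℂ, (∀ i, x i ≠ 0) → (∀ i, y i ≠ 0) →
        (∀ i j, ‖x i * y j‖ < 1) → ∀ kap : Fin n → ℤ,
        HasSum (fun nu : Fin n → ℤ => (cauchyCoeff q kap : ℂ) *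
          whittakerP q n kap (fun i => x i.castSucc) *
          ((phi q nu kap : ℂ) * x (Fin.last n) ^ (∑ i, nu i - ∑ i, kap i) *
            whittakerP q n nu (fun i => y i.castSucc)))
          ((∏ i : Fin n, (qPochInf (y i.castSucc * x (Fin.last n)) q)⁻¹) *
            ((cauchyCoeff q kap : ℂ) * whittakerP q n kap (fun i => x i.castSucc) *
              whittakerP q n kap (fun i => y i.castSucc))) := by
      intro x y hx hy hxy kap
      refine hasSum_of_eq ((hasSum_phi_mul_whittakerP hq0 hq1 (hx (Fin.last n))
        (fun i : Fin n => y i.castSucc) (fun i => hy _)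
        (fun i => by rw [mul_comm]; exact hxy _ _) kap).mul_left _) (fun _ => rfl) ?_
      ring
    -- Removal of the last `x`: branch `P_{(ν,0)}(x)` to `κ`, convert the coefficient to `b_κ
    -- φ_{ν/κ}`, sum over `ν` by Pieri in the shortened `y`, and sum over `κ` by induction.
    have hmid : ∀ x y : Fin (n + 1) → ℂ, (∀ i, x i ≠ 0) → (∀ i, y i ≠ 0) →
        (∀ i j, ‖x i * y j‖ < 1) →
        HasSum (fun nu : Fin n → ℤ => (cauchyCoeff q nu : ℂ) *
          whittakerP q (n + 1) (padZero nu) x * whittakerP q n nu (fun i => y i.castSucc))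
          ((∏ i : Fin n, (qPochInf (y i.castSucc * x (Fin.last n)) q)⁻¹) *
            ∏ i : Fin n, ∏ j : Fin n, (qPochInf (x i.castSucc * y j.castSucc) q)⁻¹) := by
      intro x y hx hy hxy
      refine hasSum_of_hasSum_swap
        (F := fun nu kap => (cauchyCoeff q kap : ℂ) *
          whittakerP q n kap (fun i => x i.castSucc) *
          ((phi q nu kap : ℂ) * x (Fin.last n) ^ (∑ i, nu i - ∑ i, kap i) *
            whittakerP q n nu (fun i => y i.castSucc)))
        (F' := fun nu kap => ‖(cauchyCoeff q kap : ℂ) *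
          whittakerP q n kap (fun i => (‖x i.castSucc‖ : ℂ)) *
          ((phi q nu kap : ℂ) * (‖x (Fin.last n)‖ : ℂ) ^ (∑ i, nu i - ∑ i, kap i) *
            whittakerP q n nu (fun i => (‖y i.castSucc‖ : ℂ)))‖)
        (fun nu kap => ?_)
        (fun kap => HasSum.norm_of_isNN (hcol _ _ (habs x hx) (habs y hy) (habs2 x y hxy) kap)
          fun nu => ?_) ?_ (fun kap => hcol x y hx hy hxy kap) (fun nu => ?_)
        ((ih x y hx hy hxy).mul_left _)
      · simp only [norm_mul, norm_zpow, Complex.norm_real, norm_norm]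
        gcongr
        · exact (hP _ _).2
        · exact (hP _ _).2
      · exact ((IsNN.ofReal (cauchyCoeff_nonneg hq0 hq1 _)).mul (hP _ _).1).mul
          (((IsNN.ofReal (phi_nonneg hq0 hq1 _ _)).mul
            ((IsNN.ofReal (norm_nonneg _)).zpow _)).mul (hP _ _).1)
      · exact ((ih _ _ (habs x hx) (habs y hy) (habs2 x y hxy)).mul_left _).summable.norm
      · refine hasSum_of_eq (((hasSum_whittakerP_succ (padZero nu) x).mul_left
          (cauchyCoeff q nu : ℂ)).mul_right (whittakerP q n nu (fun i => y i.castSucc)))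
          (fun kap => ?_) rfl
        have h1 : (cauchyCoeff q nu : ℂ) * psi q (padZero nu) kap =
            cauchyCoeff q kap * phi q nu kap := by
          exact_mod_cast cauchyCoeff_mul_psi_padZero hq0 hq1 nu kap
        rw [sum_padZero]
        linear_combination -(x (Fin.last n) ^ (∑ i, nu i - ∑ i, kap i)) *
          whittakerP q n kap (fun i => x i.castSucc) * whittakerP q n nu (fun i => y i.castSucc) * h1
    -- Removal of the last `y`: the branching coefficient of `P_λ(y)` becomes `b_ν φ_{λ/(ν,0)}`, and
    -- the sum over `λ` is the Pieri rule in all the `x`.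
    have hrow : ∀ x y : Fin (n + 1) → ℂ, (∀ i, x i ≠ 0) → (∀ i, y i ≠ 0) →
        (∀ i j, ‖x i * y j‖ < 1) → ∀ nu : Fin n → ℤ,
        HasSum (fun lam : Fin (n + 1) → ℤ => (cauchyCoeff q lam : ℂ) *
          whittakerP q (n + 1) lam x * ((psi q lam nu : ℂ) *
            y (Fin.last n) ^ (∑ i, lam i - ∑ i, nu i) * whittakerP q n nu (fun i => y i.castSucc)))
          ((∏ i, (qPochInf (x i * y (Fin.last n)) q)⁻¹) * ((cauchyCoeff q nu : ℂ) *
          whittakerP q (n + 1) (padZero nu) x * whittakerP q n nu (fun i => y i.castSucc))) := by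
      intro x y hx hy hxy nu
      refine hasSum_of_eq ((hasSum_phi_mul_whittakerP hq0 hq1 (hy (Fin.last n)) x hx
        (fun i => hxy _ _) (padZero nu)).mul_left ((cauchyCoeff q nu : ℂ) *
          whittakerP q n nu (fun i => y i.castSucc))) (fun lam => ?_) ?_
      · have h1 : (cauchyCoeff q nu : ℂ) * phi q lam (padZero nu) =
            cauchyCoeff q lam * psi q lam nu := by
          exact_mod_cast cauchyCoeff_mul_phi_padZero hq0 hq1 lam nu
        rw [sum_padZero]
        linear_combination -(y (Fin.last n) ^ (∑ i, lam i - ∑ i, nu i)) *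
          whittakerP q (n + 1) lam x * whittakerP q n nu (fun i => y i.castSucc) * h1
      · ring
    refine hasSum_of_eq (hasSum_of_hasSum_swap
        (F := fun lam nu => (cauchyCoeff q lam : ℂ) *
          whittakerP q (n + 1) lam x * ((psi q lam nu : ℂ) *
            y (Fin.last n) ^ (∑ i, lam i - ∑ i, nu i) * whittakerP q n nu (fun i => y i.castSucc)))
        (F' := fun lam nu => ‖(cauchyCoeff q lam : ℂ) *
          whittakerP q (n + 1) lam (fun i => (‖x i‖ : ℂ)) * ((psi q lam nu : ℂ) *
            (‖y (Fin.last n)‖ : ℂ) ^ (∑ i, lam i - ∑ i, nu i) *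
            whittakerP q n nu (fun i => (‖y i.castSucc‖ : ℂ)))‖)
        (fun lam nu => ?_)
        (fun nu => HasSum.norm_of_isNN (hrow _ _ (habs x hx) (habs y hy) (habs2 x y hxy) nu)
          fun lam => ?_) ?_ (fun nu => hrow x y hx hy hxy nu)
        (fun lam => (hasSum_whittakerP_succ lam y).mul_left _)
        ((hmid x y hx hy hxy).mul_left _)) (fun _ => rfl) ?_
    · simp only [norm_mul, norm_zpow, Complex.norm_real, norm_norm]
      gcongr
      · exact (hP _ _).2
      · exact (hP _ _).2
    · exact ((IsNN.ofReal (cauchyCoeff_nonneg hq0 hq1 _)).mul (hP _ _).1).mul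
          (((IsNN.ofReal (psi_nonneg hq0 hq1 _ _)).mul
            ((IsNN.ofReal (norm_nonneg _)).zpow _)).mul (hP _ _).1)
    · exact ((hmid _ _ (habs x hx) (habs y hy) (habs2 x y hxy)).mul_left _).summable.norm
    · simp only [Fin.prod_univ_castSucc, Finset.prod_mul_distrib]
      simp only [mul_comm (y _)]
      ring

/-- Translating an entire interlacing array by `l` preserves every coefficient and adds `l` to the
exponent of each variable. -/
lemma whittakerP_add_const : ∀ {n : ℕ} (lam : Fin n → ℤ) (l : ℤ) (x : Fin n → ℂ)
    (_ : ∀ i, x i ≠ 0),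
    whittakerP q n (fun i => lam i + l) x = (∏ i, x i) ^ l * whittakerP q n lam x
  | 0, _, _, _, _ => by simp [whittakerP]
  | n + 1, lam, l, x, hx => by
    have h1 := hasSum_whittakerP_succ (q := q) (fun i => lam i + l) x
    rw [← (Equiv.addRight (fun _ : Fin n => l)).hasSum_iff] at h1
    refine h1.unique (hasSum_of_eq ((hasSum_whittakerP_succ lam x).mul_left _) (fun mu => ?_) rfl)
    have h2 : (Equiv.addRight (fun _ : Fin n => l)) mu = fun i => mu i + l := rfl
    have h3 : psi q (fun i => lam i + l) (fun i => mu i + l) = psi q lam mu := by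
      simp only [psi, add_sub_add_right_eq_sub]
    simp only [Function.comp_apply, h2, h3]
    rw [whittakerP_add_const mu l _ (fun i => hx _), Fin.prod_univ_castSucc, mul_zpow]
    have h4 : ∑ i, (lam i + l) - ∑ i, (mu i + l) = l + (∑ i, lam i - ∑ i, mu i) := by
      simp only [Finset.sum_add_distrib, Finset.sum_const, Finset.card_univ, Fintype.card_fin,
        nsmul_eq_mul]
      push_cast
      ring
    rw [h4, zpow_add₀ (hx _)]
    ring

/-- A signature is its last row together with the differences to it. -/
def shiftEquiv (n : ℕ) : ℤ × (Fin n → ℤ) ≃ (Fin (n + 1) → ℤ) where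
  toFun p i := padZero p.2 i + p.1
  invFun lam := (lam (Fin.last n), fun i => lam i.castSucc - lam (Fin.last n))
  left_inv p := by
    ext <;> simp [padZero_castSucc, padZero_last]
  right_inv lam := by
    funext i
    refine Fin.lastCases ?_ (fun j => ?_) i
    · simp [padZero_last]
    · simp [padZero_castSucc]

/-- The sum over all signatures of a function of the last row, against two `q`-Whittaker
functions. -/
theorem hasSum_signature (hq0 : 0 < q) (hq1 : q < 1) (x y : Fin (n + 1) → ℂ)
    (hx : ∀ i, x i ≠ 0) (hy : ∀ i, y i ≠ 0) (hxy : ∀ i j, ‖x i * y j‖ < 1) {f : ℤ → ℂ} {S : ℂ}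
    (hf : HasSum (fun l => f l * ((∏ i, x i) * ∏ i, y i) ^ l) S) :
    HasSum (fun lam : Signature (n + 1) => f (lam.1 (Fin.last n)) *
      ((∏ j : Fin n, qg q (lam.1 j.castSucc - lam.1 j.succ) : ℝ) : ℂ) *
        whittakerP q (n + 1) lam.1 x * whittakerP q (n + 1) lam.1 y)
      (S * (qPochInf ((∏ i, x i) * ∏ i, y i) q * ∏ i, ∏ j, (qPochInf (x i * y j) q)⁻¹)) := by
  set w := (∏ i, x i) * ∏ i, y i with hw
  have hw0 : w ≠ 0 :=
    mul_ne_zero (Finset.prod_ne_zero_iff.2 fun i _ => hx i) (Finset.prod_ne_zero_iff.2 fun i _ => hy i)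
  have hw1 : ‖w‖ < 1 := by
    rw [hw, ← Finset.prod_mul_distrib, norm_prod]
    calc ∏ i, ‖x i * y i‖ < ∏ _i : Fin (n + 1), (1 : ℝ) :=
          Finset.prod_lt_prod_of_nonempty
            (fun i _ => norm_pos_iff.2 (mul_ne_zero (hx i) (hy i))) (fun i _ => hxy i i)
            Finset.univ_nonempty
      _ = 1 := by simp
  set c : (Fin (n + 1) → ℤ) → ℝ := fun lam => ∏ j : Fin n, qg q (lam j.castSucc - lam j.succ) with hc
  set t : (Fin n → ℤ) → ℂ := fun m => (c (padZero m) : ℂ) * whittakerP q (n + 1) (padZero m) x *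
    whittakerP q (n + 1) (padZero m) y with ht
  set C := ∏ i, ∏ j, (qPochInf (x i * y j) q)⁻¹ with hC
  have hterm : ∀ p : ℤ × (Fin n → ℤ), (c (shiftEquiv n p) : ℂ) *
      whittakerP q (n + 1) (shiftEquiv n p) x * whittakerP q (n + 1) (shiftEquiv n p) y =
      w ^ p.1 * t p.2 := by
    rintro ⟨l, m⟩
    have h1 : shiftEquiv n (l, m) = fun i => padZero m i + l := rfl
    have h2 : c (fun i => padZero m i + l) = c (padZero m) := by
      simp only [hc, add_sub_add_right_eq_sub]
    rw [h1, whittakerP_add_const _ _ _ hx, whittakerP_add_const _ _ _ hy, h2]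
    simp only [ht, hw, mul_zpow]
    ring
  have hlast : ∀ p : ℤ × (Fin n → ℤ), shiftEquiv n p (Fin.last n) = p.1 := by
    rintro ⟨l, m⟩
    simp [shiftEquiv, padZero_last]
  -- In the coordinates `shiftEquiv` the Cauchy series is a product series. Its slice at `l = 0`,
  -- where `qg` is `1`, shows that `t` is summable. Its factor in `l` is Euler's series, so division
  -- evaluates `∑ t`, and `qg` may then be replaced by `f`.
  have h1 : HasSum (fun p : ℤ × (Fin n → ℤ) => (qg q p.1 : ℂ) * w ^ p.1 * t p.2) C := by
    have h2 := hasSum_cauchy hq0 hq1 x y hx hy hxy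
    rw [← (shiftEquiv n).hasSum_iff] at h2
    refine hasSum_of_eq h2 (fun p => ?_) rfl
    simp only [Function.comp_apply]
    rw [cauchyCoeff_succ, hlast]
    have := hterm p
    simp only [hc] at this
    rw [Complex.ofReal_mul]
    linear_combination -(qg q p.1 : ℂ) * this
  have ht1 : Summable t := by
    have h2 := h1.summable.comp_injective (i := fun m : Fin n → ℤ => ((0 : ℤ), m))
      (fun a b h => by simpa using h)
    refine h2.congr fun m => ?_
    simp [qg_zero]
  have hT : ∑' m, t m = qPochInf w q * C := by
    have h2 : HasSum (fun l : ℤ => (qg q l : ℂ) * w ^ l) (qPochInf w q)⁻¹ := by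
      simpa using hasSum_qg_mul_zpow hq0 hq1 hw0 hw1 0
    have h3 := (h2.mul ht1.hasSum h1.summable).unique h1
    rw [← h3, mul_inv_cancel_left₀ (qPochInf_ne_zero_of_norm_lt hq0 hq1 hw1)]
  have hsm : Summable fun p : ℤ × (Fin n → ℤ) => (f p.1 * w ^ p.1) * t p.2 :=
    summable_mul_of_summable_norm (f := fun l => f l * w ^ l) (g := t) hf.summable.norm ht1.norm
  have h4 : HasSum (fun p : ℤ × (Fin n → ℤ) => (f p.1 * w ^ p.1) * t p.2)
      (S * (qPochInf w q * C)) := by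
    rw [← hT]
    have h5 := HasSum.mul (f := fun l => f l * w ^ l) (g := t) hf ht1.hasSum hsm
    exact h5
  have h5 : HasSum (fun lam : Fin (n + 1) → ℤ => f (lam (Fin.last n)) * (c lam : ℂ) *
        whittakerP q (n + 1) lam x * whittakerP q (n + 1) lam y) (S * (qPochInf w q * C)) := by
    rw [← (shiftEquiv n).hasSum_iff]
    refine hasSum_of_eq h4 (fun p => ?_) rfl
    simp only [Function.comp_apply]
    rw [hlast]
    linear_combination f p.1 * hterm p
  have hinj : Function.Injective (fun lam : Signature (n + 1) => lam.1) := Subtype.val_injective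
  rw [← hinj.hasSum_iff] at h5
  · exact h5
  · intro lam hlam
    by_contra hne
    refine hlam ⟨⟨lam, antitone_of_whittakerP_ne_zero (q := q) (x := x) ?_⟩, rfl⟩
    intro h0
    apply hne
    simp only [h0, mul_zero, zero_mul]

end Cauchy

end QWhittaker
end

/-! ### Torus integrals: deformation and change of variables. -/

noncomputable section

namespace QWhittaker

open MeasureTheory Set

section Torus

variable {n : ℕ}

lemma torusIntegral_congr_on {f g : (Fin n → ℂ) → ℂ} {c : Fin n → ℂ} {R : Fin n → ℝ}
    (h : ∀ θ, f (torusMap c R θ) = g (torusMap c R θ)) :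
    torusIntegral f c R = torusIntegral g c R := by
  simp only [torusIntegral, h]

lemma torusIntegrable_of_continuous {f : (Fin n → ℂ) → ℂ} {c : Fin n → ℂ} {R : Fin n → ℝ}
    (h : Continuous fun θ => f (torusMap c R θ)) : TorusIntegrable f c R :=
  h.continuousOn.integrableOn_compact isCompact_Icc

lemma continuous_torusMap (c : Fin n → ℂ) (R : Fin n → ℝ) : Continuous (torusMap c R) := by
  unfold torusMap
  fun_prop

lemma norm_torusMap_zero (R : Fin n → ℝ) (θ : Fin n → ℝ) (i : Fin n) :
    ‖torusMap 0 R θ i‖ = |R i| := by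
  simp [torusMap, Complex.norm_exp_ofReal_mul_I]

/-- Recurrent formula for `torusIntegral`, with the first coordinate innermost. -/
theorem torusIntegral_succ_inner {f : (Fin (n + 1) → ℂ) → ℂ} {c : Fin (n + 1) → ℂ}
    {R : Fin (n + 1) → ℝ} (hf : TorusIntegrable f c R) :
    torusIntegral f c R = torusIntegral (fun y => ∮ x in C(c 0, R 0), f (Fin.cons x y))
      (c ∘ Fin.succ) (R ∘ Fin.succ) := by
  set e : ℝ × (Fin n → ℝ) ≃ᵐ (Fin (n + 1) → ℝ) :=
    (MeasurableEquiv.piFinSuccAbove (fun _ => ℝ) 0).symm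
  have hem : MeasurePreserving e :=
    (volume_preserving_piFinSuccAbove (fun _ : Fin (n + 1) => ℝ) 0).symm _
  have heπ : (e ⁻¹' Icc 0 fun _ => 2 * Real.pi) =
      Icc 0 (2 * Real.pi) ×ˢ Icc (0 : Fin n → ℝ) fun _ => 2 * Real.pi :=
    ((Fin.insertNthOrderIso (fun _ => ℝ) 0).preimage_Icc _ _).trans (Icc_prod_eq _ _)
  have hint := hf.function_integrable
  rw [← hem.integrableOn_comp_preimage e.measurableEmbedding, heπ] at hint
  rw [torusIntegral, ← hem.map_eq, setIntegral_map_equiv, heπ, Measure.volume_eq_prod,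
    ← setIntegral_prod_swap, setIntegral_prod]
  · rw [torusIntegral]
    refine setIntegral_congr_fun measurableSet_Icc fun Θ _ => ?_
    simp only [circleIntegral_def_Icc]
    rw [← integral_smul]
    refine setIntegral_congr_fun measurableSet_Icc fun θ _ => ?_
    simp only [e, deriv_circleMap, Fin.prod_univ_succ, smul_eq_mul, circleMap_zero,
      MeasurableEquiv.piFinSuccAbove_symm_apply, Prod.swap_prod_mk, Fin.insertNthEquiv,
      Equiv.coe_fn_mk, Fin.insertNth_zero', Fin.cons_zero, Fin.cons_succ, Function.comp_apply]
    have h1 : torusMap c R (Fin.cons θ Θ) = Fin.cons (circleMap (c 0) (R 0) θ)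
        (torusMap (c ∘ Fin.succ) (R ∘ Fin.succ) Θ) := by
      funext i
      refine Fin.cases ?_ (fun j => ?_) i
      · simp [circleMap, torusMap]
      · simp [torusMap]
    rw [h1]
    ring
  · exact hint.swap

/-- The exterior domain `{z | ∀ i, ρ < |z_i|}`. -/
def extDomain (n : ℕ) (ρ : ℝ) : Set (Fin n → ℂ) := {z | ∀ i, ρ < ‖z i‖}

lemma torusMap_mem_extDomain {ρ : ℝ} {R : Fin n → ℝ} (hR : ∀ i, ρ < R i) (θ : Fin n → ℝ) :
    torusMap 0 R θ ∈ extDomain n ρ := fun i => by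
  rw [norm_torusMap_zero]
  exact (hR i).trans_le (le_abs_self _)

lemma continuous_comp_torusMap {f : (Fin n → ℂ) → ℂ} {ρ : ℝ}
    (hf : ContinuousOn f (extDomain n ρ)) {R : Fin n → ℝ} (hR : ∀ i, ρ < R i) :
    Continuous fun θ => f (torusMap 0 R θ) :=
  hf.comp_continuous (continuous_torusMap 0 R) (torusMap_mem_extDomain hR)

lemma circleIntegral_eq_of_differentiableOn_ext {f : ℂ → ℂ} {ρ : ℝ} (hρ : 0 ≤ ρ)
    (hf : DifferentiableOn ℂ f {z | ρ < ‖z‖}) {r R : ℝ} (hr : ρ < r) (hR : ρ < R) :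
    (∮ z in C(0, r), f z) = ∮ z in C(0, R), f z := by
  wlog h : r ≤ R generalizing r R
  · exact (this hR hr (le_of_not_ge h)).symm
  have hop : IsOpen {z : ℂ | ρ < ‖z‖} := isOpen_lt continuous_const continuous_norm
  refine (Complex.circleIntegral_eq_of_differentiable_on_annulus_off_countable (hρ.trans_lt hr) h
    countable_empty ?_ ?_).symm
  · refine hf.continuousOn.mono fun z hz => ?_
    have : r ≤ ‖z‖ := by simpa [Metric.mem_ball] using hz.2
    exact hr.trans_le this
  · intro z hz
    refine hf.differentiableAt (hop.mem_nhds ?_)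
    have : r < ‖z‖ := by
      have := hz.1.2
      simpa [Metric.mem_closedBall] using this
    exact hr.trans this

lemma cons_mem_extDomain {ρ : ℝ} {x : ℂ} {y : Fin n → ℂ} :
    (Fin.cons x y : Fin (n + 1) → ℂ) ∈ extDomain (n + 1) ρ ↔ ρ < ‖x‖ ∧ y ∈ extDomain n ρ := by
  simp only [extDomain, mem_ofPred_eq, Fin.forall_fin_succ, Fin.cons_zero, Fin.cons_succ]

lemma differentiable_cons_left (y : Fin n → ℂ) :
    Differentiable ℂ fun x : ℂ => (Fin.cons x y : Fin (n + 1) → ℂ) := by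
  rw [differentiable_pi]
  refine Fin.cases ?_ fun i => ?_
  · simp
  · simp

lemma differentiable_cons_right (x : ℂ) :
    Differentiable ℂ fun y : Fin n → ℂ => (Fin.cons x y : Fin (n + 1) → ℂ) := by
  rw [differentiable_pi]
  refine Fin.cases ?_ fun i => ?_
  · simp
  · simp only [Fin.cons_succ]
    fun_prop

/-- A function holomorphic on an exterior domain has the same integral over all tori in it. -/
theorem torusIntegral_eq_of_differentiableOn_ext {ρ : ℝ} (hρ : 0 ≤ ρ) : ∀ {n : ℕ}
    {f : (Fin n → ℂ) → ℂ} (_ : DifferentiableOn ℂ f (extDomain n ρ)) {R S : Fin n → ℝ}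
    (_ : ∀ i, ρ < R i) (_ : ∀ i, ρ < S i), torusIntegral f 0 R = torusIntegral f 0 S
  | 0, f, _, R, S, _, _ => by simp
  | n + 1, f, hf, R, S, hR, hS => by
    -- An intermediate torus. The first radius is changed with its circle innermost, by Cauchy's
    -- theorem on an annulus; the others are changed with that circle outermost, by induction.
    set M : Fin (n + 1) → ℝ := Fin.cons (S 0) (R ∘ Fin.succ) with hM
    have hM' : ∀ i, ρ < M i := Fin.cases (by simpa [hM] using hS 0)
      (fun i => by simpa [hM] using hR i.succ)
    have h0 : (0 : Fin (n + 1) → ℂ) ∘ Fin.succ = 0 := rfl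
    have hMs : M ∘ Fin.succ = R ∘ Fin.succ := by ext i; simp [hM]
    have hM0 : M 0 = S 0 := by simp [hM]
    have hint : ∀ {R : Fin (n + 1) → ℝ}, (∀ i, ρ < R i) → TorusIntegrable f 0 R := fun hR =>
      torusIntegrable_of_continuous (continuous_comp_torusMap hf.continuousOn hR)
    calc torusIntegral f 0 R = torusIntegral f 0 M := by
          rw [torusIntegral_succ_inner (hint hR), torusIntegral_succ_inner (hint hM'), hMs, hM0, h0]
          refine torusIntegral_congr_on fun θ => ?_
          refine circleIntegral_eq_of_differentiableOn_ext hρ ?_ (hR 0) (hS 0)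
          refine hf.comp (differentiable_cons_left _).differentiableOn fun x hx => ?_
          exact cons_mem_extDomain.2 ⟨hx, torusMap_mem_extDomain (fun i => hR i.succ) θ⟩
      _ = torusIntegral f 0 S := by
          rw [torusIntegral_succ (hint hM'), torusIntegral_succ (hint hS), hMs, hM0, h0]
          refine circleIntegral.integral_congr ((hρ.trans_lt (hS 0)).le) fun x hx => ?_
          refine torusIntegral_eq_of_differentiableOn_ext hρ ?_ (fun i => hR i.succ)
            (fun i => hS i.succ)
          refine hf.comp (differentiable_cons_right x).differentiableOn fun y hy => ?_
          refine cons_mem_extDomain.2 ⟨?_, hy⟩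
          have : ‖x‖ = S 0 := by simpa using hx
          rw [this]
          exact hS 0

/-- Rotating and scaling a circle integral. -/
lemma circleIntegral_div {g : ℂ → ℂ} {p : ℂ} (hp : p ≠ 0) (R : ℝ) :
    (∮ z in C(0, R / ‖p‖), g z) = ∮ w in C(0, R), g (w / p) / p := by
  set h : ℝ → ℂ := fun θ => deriv (circleMap 0 (R / ‖p‖)) θ • g (circleMap 0 (R / ‖p‖) θ) with hh
  have hper : Function.Periodic h (2 * Real.pi) := by
    intro θ
    simp only [hh, deriv_circleMap, (periodic_circleMap 0 (R / ‖p‖)) θ]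
  have hpp : ((‖p‖ : ℝ) : ℂ) ≠ 0 := by exact_mod_cast norm_ne_zero_iff.2 hp
  -- Division by `p` rescales the radius by `‖p‖` and rotates by `-arg p`; the rotation disappears
  -- because the integrand is periodic in the angle.
  have h1 : ∀ θ : ℝ, circleMap 0 (R / ‖p‖) (θ + -Complex.arg p) = circleMap 0 R θ / p := by
    intro θ
    conv_rhs => rw [← Complex.norm_mul_exp_arg_mul_I p]
    simp only [circleMap_zero]
    push_cast
    rw [add_mul, Complex.exp_add, neg_mul, Complex.exp_neg]
    have := Complex.exp_ne_zero (Complex.arg p * Complex.I)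
    field_simp
  have h2 : (∮ w in C(0, R), g (w / p) / p) = ∫ θ in (0 : ℝ)..2 * Real.pi, h (θ + -Complex.arg p) := by
    rw [circleIntegral]
    refine intervalIntegral.integral_congr fun θ _ => ?_
    simp only [hh, deriv_circleMap, h1, smul_eq_mul]
    ring
  rw [h2, intervalIntegral.integral_comp_add_right]
  have h3 := hper.intervalIntegral_add_eq 0 (0 + -Complex.arg p)
  rw [zero_add] at h3
  rw [circleIntegral, h3]
  congr 1
  ring

/-- The change of variables `z_1 = W / (v_1 ⋯ v_n)` in a torus integral. -/
theorem torusIntegral_eq_circleIntegral_div {f : (Fin (n + 1) → ℂ) → ℂ} {ρ : ℝ} (hρ : 0 ≤ ρ)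
    (hf : ContinuousOn f (extDomain (n + 1) ρ)) {R : ℝ} {r : Fin n → ℝ} (hr : ∀ i, ρ < r i)
    (hR : ρ < R / ∏ i, r i) :
    torusIntegral f 0 (Fin.cons (R / ∏ i, r i) r) =
      ∮ W in C(0, R), torusIntegral (fun v => f (Fin.cons (W / ∏ j, v j) v) / ∏ j, v j) 0 r := by
  have hr0 : ∀ i, 0 < r i := fun i => hρ.trans_lt (hr i)
  have hprod : 0 < ∏ i, r i := Finset.prod_pos fun i _ => hr0 i
  have h0 : (0 : Fin (n + 1) → ℂ) ∘ Fin.succ = 0 := rfl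
  have hcs : ∀ c : ℝ, (Fin.cons c r : Fin (n + 1) → ℝ) ∘ Fin.succ = r := fun c => by ext i; simp
  have hrad : ∀ i, ρ < (Fin.cons (R / ∏ i, r i) r : Fin (n + 1) → ℝ) i :=
    Fin.cases (by simpa using hR) (fun i => by simpa using hr i)
  have hv : ∀ θ : Fin n → ℝ, ‖∏ j, torusMap 0 r θ j‖ = ∏ i, r i := fun θ => by
    rw [norm_prod]
    exact Finset.prod_congr rfl fun i _ => by rw [norm_torusMap_zero, abs_of_pos (hr0 i)]
  have hv0 : ∀ θ : Fin n → ℝ, (∏ j, torusMap 0 r θ j) ≠ 0 := fun θ => by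
    rw [← norm_pos_iff, hv]; exact hprod
  -- The integrand in the coordinates `(W, v)`, including the Jacobian `1/∏ v_j`. The substitution
  -- is made for fixed `v`, with the first coordinate innermost; splitting the torus integral of `F`
  -- the other way puts `W` outermost.
  set F : (Fin (n + 1) → ℂ) → ℂ := fun z =>
    f (Fin.cons (z 0 / ∏ j : Fin n, z j.succ) (fun j => z j.succ)) / ∏ j : Fin n, z j.succ with hF
  have hRpos : 0 < R := by
    have := hρ.trans_lt hR
    rw [lt_div_iff₀ hprod, zero_mul] at this
    exact this
  have hFint : TorusIntegrable F 0 (Fin.cons R r) := by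
    apply torusIntegrable_of_continuous
    have hT : ∀ θ : Fin (n + 1) → ℝ, (fun j : Fin n => torusMap 0 (Fin.cons R r) θ j.succ) =
        torusMap 0 r (fun j => θ j.succ) := fun θ => by
      ext j; simp [torusMap]
    have hct : Continuous fun θ : Fin (n + 1) → ℝ => torusMap 0 r (fun j => θ j.succ) :=
      (continuous_torusMap 0 r).comp (continuous_pi fun j => continuous_apply j.succ)
    have hc1 : Continuous fun θ : Fin (n + 1) → ℝ => ∏ j : Fin n, torusMap 0 r (fun j => θ j.succ) j := by
      refine continuous_finsetProd _ fun j _ => ?_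
      exact (continuous_apply j).comp hct
    have hc2 : Continuous fun θ : Fin (n + 1) → ℝ => torusMap 0 (Fin.cons R r : Fin (n + 1) → ℝ) θ 0 :=
      (continuous_apply 0).comp (continuous_torusMap _ _)
    have hc3 : Continuous fun θ : Fin (n + 1) → ℝ => f (Fin.cons
        (torusMap 0 (Fin.cons R r : Fin (n + 1) → ℝ) θ 0 / ∏ j : Fin n, torusMap 0 r (fun j => θ j.succ) j)
        (torusMap 0 r (fun j => θ j.succ))) := by
      refine hf.comp_continuous ?_ fun θ => ?_
      · refine continuous_pi (Fin.cases ?_ fun j => ?_)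
        · simp only [Fin.cons_zero]
          exact hc2.div hc1 fun θ => hv0 _
        · simp only [Fin.cons_succ]
          exact (continuous_apply j).comp hct
      · refine cons_mem_extDomain.2 ⟨?_, torusMap_mem_extDomain hr _⟩
        rw [norm_div, norm_torusMap_zero, hv, Fin.cons_zero, abs_of_pos hRpos]
        exact hR
    have hc4 := hc3.div hc1 fun θ => hv0 _
    refine hc4.congr fun θ => ?_
    simp only [hF, hT]
    rfl
  calc torusIntegral f 0 (Fin.cons (R / ∏ i, r i) r)
      = torusIntegral (fun v => ∮ z in C(0, R / ∏ i, r i), f (Fin.cons z v)) 0 r := by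
        rw [torusIntegral_succ_inner (torusIntegrable_of_continuous
          (continuous_comp_torusMap hf hrad)), h0, hcs]
        rfl
    _ = torusIntegral (fun v => ∮ W in C(0, R), F (Fin.cons W v)) 0 r := by
        refine torusIntegral_congr_on fun θ => ?_
        rw [← hv θ, circleIntegral_div (hv0 θ)]
        simp only [hF, Fin.cons_zero, Fin.cons_succ]
    _ = torusIntegral F 0 (Fin.cons R r) := by
        rw [torusIntegral_succ_inner hFint, h0, hcs]
        rfl
    _ = _ := by
        rw [torusIntegral_succ hFint, h0, hcs]
        simp only [hF, Fin.cons_zero, Fin.cons_succ, Pi.zero_apply]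

end Torus

end QWhittaker
end

/-! ### Quasi-periodic holomorphic functions on a half-plane. -/

noncomputable section

namespace QWhittaker

open MeasureTheory Set Filter Topology

section QuasiPeriodic

variable {q : ℝ}

/-- The period `2πi / log q` of `s ↦ q^s`. -/
def qPeriod (q : ℝ) : ℂ := 2 * Real.pi * Complex.I / Real.log q

lemma log_ne_zero (hq0 : 0 < q) (hq1 : q < 1) : (Real.log q : ℂ) ≠ 0 := by
  exact_mod_cast (Real.log_neg hq0 hq1).ne

lemma cpow_eq_exp (hq0 : 0 < q) (u : ℂ) : (q : ℂ) ^ u = Complex.exp (Real.log q * u) := by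
  rw [Complex.cpow_def_of_ne_zero (by exact_mod_cast hq0.ne'), Complex.ofReal_log hq0.le]

lemma norm_cpow_eq (hq0 : 0 < q) (u : ℂ) : ‖(q : ℂ) ^ u‖ = q ^ u.re :=
  Complex.norm_cpow_eq_rpow_re_of_pos hq0 u

lemma cpow_ne_zero (hq0 : 0 < q) (u : ℂ) : (q : ℂ) ^ u ≠ 0 := by
  rw [cpow_eq_exp hq0]
  exact Complex.exp_ne_zero _

lemma cpow_add' (hq0 : 0 < q) (u v : ℂ) : (q : ℂ) ^ (u + v) = (q : ℂ) ^ u * (q : ℂ) ^ v :=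
  Complex.cpow_add _ _ (by exact_mod_cast hq0.ne')

lemma cpow_mul_qPeriod (hq0 : 0 < q) (hq1 : q < 1) (v : ℂ) :
    (q : ℂ) ^ (qPeriod q * v) = Complex.exp (2 * Real.pi * Complex.I * v) := by
  have := log_ne_zero hq0 hq1
  rw [cpow_eq_exp hq0, qPeriod]
  congr 1
  field_simp

lemma cpow_int_mul_qPeriod (hq0 : 0 < q) (hq1 : q < 1) (k : ℤ) :
    (q : ℂ) ^ (k * qPeriod q) = 1 := by
  rw [mul_comm, cpow_mul_qPeriod hq0 hq1, Complex.exp_eq_one_iff]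
  exact ⟨k, by ring⟩

lemma cpow_add_int_mul_qPeriod (hq0 : 0 < q) (hq1 : q < 1) (u : ℂ) (k : ℤ) :
    (q : ℂ) ^ (u + k * qPeriod q) = (q : ℂ) ^ u := by
  rw [cpow_add' hq0, cpow_int_mul_qPeriod hq0 hq1, mul_one]

lemma qPeriod_re (q : ℝ) : (qPeriod q).re = 0 := by
  rw [qPeriod, Complex.div_ofReal_re]
  simp

lemma qPeriod_im (q : ℝ) : (qPeriod q).im = 2 * Real.pi / Real.log q := by
  rw [qPeriod, Complex.div_ofReal_im]
  simp

lemma qPeriod_eq (q : ℝ) : qPeriod q = ((2 * Real.pi / Real.log q : ℝ) : ℂ) * Complex.I := by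
  rw [qPeriod]; push_cast; ring

lemma differentiable_cpow (hq0 : 0 < q) : Differentiable ℂ fun u : ℂ => (q : ℂ) ^ u := by
  have : (fun u : ℂ => (q : ℂ) ^ u) = fun u => Complex.exp (Real.log q * u) :=
    funext fun u => cpow_eq_exp hq0 u
  rw [this]
  fun_prop

/-- The integral of a periodic holomorphic function over a vertical period does not depend on the
line. -/
lemma integral_period_eq (hq0 : 0 < q) (hq1 : q < 1) {f : ℂ → ℂ}
    (hf : DifferentiableOn ℂ f {u | u.re < 0})
    (hper : ∀ u : ℂ, u.re < 0 → f (u + qPeriod q) = f u) {σ σ' : ℝ} (hσ : σ < 0) (hσ' : σ' < 0) :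
    (∫ x in (0 : ℝ)..1, f (σ + qPeriod q * x)) = ∫ x in (0 : ℝ)..1, f (σ' + qPeriod q * x) := by
  set T : ℝ := 2 * Real.pi / Real.log q with hT
  have hT0 : T ≠ 0 := div_ne_zero (by positivity) (Real.log_neg hq0 hq1).ne
  have hτ : qPeriod q = (T : ℂ) * Complex.I := qPeriod_eq q
  have hline : ∀ s : ℝ, (∫ x in (0 : ℝ)..1, f (s + qPeriod q * x)) =
      T⁻¹ • ∫ y in (0 : ℝ)..T, f (s + y * Complex.I) := by
    intro s
    have := intervalIntegral.integral_comp_mul_left (a := 0) (b := 1)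
      (fun y : ℝ => f (s + y * Complex.I)) hT0
    rw [mul_zero, mul_one] at this
    rw [← this]
    refine intervalIntegral.integral_congr fun x _ => ?_
    simp only [hτ]
    push_cast
    ring_nf
  rw [hline, hline]
  congr 1
  -- Cauchy's theorem on the rectangle with opposite corners `σ` and `σ' + τ`; the two horizontal
  -- sides cancel by periodicity.
  have hrect := Complex.integral_boundary_rect_eq_zero_of_differentiableOn f (σ : ℂ)
    ((σ' : ℂ) + qPeriod q) (hf.mono ?_)
  · simp only [Complex.ofReal_re, Complex.ofReal_im, Complex.add_re, Complex.add_im, qPeriod_re,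
      qPeriod_im, add_zero, zero_add, Complex.ofReal_zero, zero_mul, ← hT] at hrect
    have hh : (∫ x in σ..σ', f (x + T * Complex.I)) = ∫ x in σ..σ', f x := by
      refine intervalIntegral.integral_congr fun x hx => ?_
      rw [mem_uIcc] at hx
      have := hper x (by rw [Complex.ofReal_re]; rcases hx with h | h <;> linarith)
      rw [hτ] at this
      exact this
    rw [hh, sub_self, zero_add, sub_eq_zero] at hrect
    exact (smul_right_injective ℂ Complex.I_ne_zero hrect).symm
  · intro u hu
    have h1 := hu.1
    simp only [mem_preimage, Complex.ofReal_re, Complex.add_re, qPeriod_re, add_zero,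
      mem_uIcc] at h1
    change u.re < 0
    rcases h1 with h | h <;> linarith

/-- A continuous one-periodic function with vanishing Fourier coefficients is zero. -/
lemma eq_zero_of_fourier_eq_zero {f : ℝ → ℂ} (hf : Continuous f) (hper : Function.Periodic f 1)
    (h : ∀ n : ℤ, (∫ x in (0 : ℝ)..1, f x * Complex.exp (2 * Real.pi * Complex.I * (n * x))) = 0) :
    ∀ x, f x = 0 := by
  have : Fact ((0 : ℝ) < 1) := ⟨one_pos⟩
  set g : C(AddCircle (1 : ℝ), ℂ) := ⟨hper.lift, continuous_quot_lift _ hf⟩ with hg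
  have hgx : ∀ x : ℝ, g (x : AddCircle (1 : ℝ)) = f x := fun x => rfl
  have hc : ∀ n, fourierCoeff g n = 0 := by
    intro n
    rw [fourierCoeff_eq_intervalIntegral _ n 0, zero_add]
    have h2 : (∫ x in (0 : ℝ)..1, fourier (T := (1 : ℝ)) (-n) (x : AddCircle (1 : ℝ)) •
        g (x : AddCircle (1 : ℝ))) = ∫ x in (0 : ℝ)..1, f x *
          Complex.exp (2 * Real.pi * Complex.I * (((-n : ℤ) : ℂ) * x)) := by
      refine intervalIntegral.integral_congr fun x _ => ?_
      simp only [hgx, fourier_coe_apply, smul_eq_mul]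
      rw [mul_comm]
      congr 2
      push_cast
      ring
    rw [h2, h, smul_zero]
  have hs := hasSum_fourier_series_of_summable (f := g) (by
    have : fourierCoeff g = fun _ => 0 := funext hc
    rw [this]
    exact summable_zero)
  simp only [hc, zero_smul] at hs
  have hg0 : g = 0 := hs.unique hasSum_zero
  intro x
  rw [← hgx, hg0]
  rfl

lemma line_re (q σ x : ℝ) : ((σ : ℂ) + qPeriod q * x).re = σ := by
  rw [qPeriod_eq]
  simp

/-- A quasi-periodic holomorphic function with one vanishing Laurent coefficient is zero. -/
theorem eq_zero_of_quasiPeriodic (hq0 : 0 < q) (hq1 : q < 1) {ζ : ℂ} (hζ : ζ ≠ 0) {D : ℂ → ℂ}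
    (hD : DifferentiableOn ℂ D {u | u.re < 0})
    (hper : ∀ u : ℂ, u.re < 0 → D (u + qPeriod q) = D u)
    (hfe : ∀ u : ℂ, u.re < 0 → D (u - 1) = -ζ⁻¹ * (q : ℂ) ^ u * D u) {σ : ℝ} (hσ : σ < 0)
    (h0 : (∫ x in (0 : ℝ)..1, D (σ + qPeriod q * x)) = 0) (x : ℝ) : D (σ + qPeriod q * x) = 0 := by
  have hqc : (q : ℂ) ≠ 0 := by exact_mod_cast hq0.ne'
  -- The Laurent coefficients in `q^u`, computed on a vertical line. They do not depend on the line,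
  -- while the functional equation between the lines `σ - 1` and `σ` relates index `n` to `n + 1` by
  -- a nonzero factor. One vanishing coefficient therefore kills all of them.
  set c : ℤ → ℝ → ℂ := fun n s =>
    ∫ x in (0 : ℝ)..1, D (s + qPeriod q * x) * (q : ℂ) ^ (n * (s + qPeriod q * x)) with hc
  have hshift : ∀ n : ℤ, ∀ u : ℂ, (q : ℂ) ^ (n * (u + qPeriod q)) = (q : ℂ) ^ (n * u) := by
    intro n u
    rw [mul_add, cpow_add_int_mul_qPeriod hq0 hq1]
  have hind : ∀ n s s', s < 0 → s' < 0 → c n s = c n s' := by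
    intro n s s' hs hs'
    refine integral_period_eq hq0 hq1 (f := fun u => D u * (q : ℂ) ^ (n * u)) ?_ ?_ hs hs'
    · exact hD.mul (((differentiable_cpow hq0).comp
        (differentiable_id.const_mul (n : ℂ))).differentiableOn)
    · intro u hu
      simp only [hper u hu, hshift]
  have hstep : ∀ n, c n (σ - 1) = -ζ⁻¹ * (q : ℂ) ^ (-(n : ℂ)) * c (n + 1) σ := by
    intro n
    simp only [hc]
    rw [← intervalIntegral.integral_const_mul]
    refine intervalIntegral.integral_congr fun x _ => ?_
    set u : ℂ := σ + qPeriod q * x with hu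
    have h1 : (((σ - 1 : ℝ) : ℂ) + qPeriod q * x) = u - 1 := by rw [hu]; push_cast; ring
    simp only [h1]
    rw [hfe u (by rw [hu, line_re]; exact hσ)]
    have h2 : (q : ℂ) ^ ((n : ℂ) * (u - 1)) = (q : ℂ) ^ (-(n : ℂ)) * (q : ℂ) ^ ((n : ℂ) * u) := by
      rw [← cpow_add' hq0]; congr 1; ring
    have h3 : (q : ℂ) ^ (((n + 1 : ℤ) : ℂ) * u) = (q : ℂ) ^ ((n : ℂ) * u) * (q : ℂ) ^ u := by
      rw [← cpow_add' hq0]; congr 1; push_cast; ring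
    rw [h2, h3]
    ring
  have hrec : ∀ n, c n σ = 0 ↔ c (n + 1) σ = 0 := by
    intro n
    rw [hind n σ (σ - 1) hσ (by linarith), hstep]
    have h1 : -ζ⁻¹ * (q : ℂ) ^ (-(n : ℂ)) ≠ 0 :=
      mul_ne_zero (neg_ne_zero.2 (inv_ne_zero hζ)) (cpow_ne_zero hq0 _)
    rw [mul_eq_zero, or_iff_right h1]
  have hc0 : c 0 σ = 0 := by
    simp only [hc, Int.cast_zero, zero_mul, Complex.cpow_zero, mul_one]
    exact h0
  have hall : ∀ n : ℤ, c n σ = 0 := by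
    intro n
    induction n using Int.induction_on with
    | zero => exact hc0
    | succ k ih => exact (hrec _).1 ih
    | pred k ih => exact (hrec _).2 (by simpa using ih)
  have hline : Continuous fun x : ℝ => ((σ : ℂ) + qPeriod q * x) := by fun_prop
  refine eq_zero_of_fourier_eq_zero (f := fun x : ℝ => D (σ + qPeriod q * x)) ?_ ?_ ?_ x
  · refine hD.continuousOn.comp_continuous hline fun x => ?_
    change Complex.re _ < 0
    rw [line_re]
    exact hσ
  · intro x
    have := hper (σ + qPeriod q * x) (by rw [line_re]; exact hσ)
    simp only
    rw [← this]
    congr 1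
    push_cast
    ring
  · intro n
    have h1 : c n σ = (q : ℂ) ^ ((n : ℂ) * σ) * ∫ x in (0 : ℝ)..1, D (σ + qPeriod q * x) *
        Complex.exp (2 * Real.pi * Complex.I * (n * x)) := by
      rw [← intervalIntegral.integral_const_mul]
      refine intervalIntegral.integral_congr fun x _ => ?_
      have : (q : ℂ) ^ ((n : ℂ) * (σ + qPeriod q * x)) = (q : ℂ) ^ ((n : ℂ) * σ) *
          Complex.exp (2 * Real.pi * Complex.I * (n * x)) := by
        rw [← cpow_mul_qPeriod hq0 hq1, ← cpow_add' hq0]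
        congr 1
        ring
      rw [this]
      ring
    have h2 := hall n
    rw [h1] at h2
    exact (mul_eq_zero.1 h2).resolve_left (cpow_ne_zero hq0 _)

end QuasiPeriodic

/-! ### The Mellin kernel and its periodization. -/

section ThetaKernel

variable {q : ℝ}

/-- The function `(q^{u+1}; q)_∞ (q^{-u}; q)_∞`, vanishing at the integers. -/
def thetaB (q : ℝ) (u : ℂ) : ℂ := qPochInf ((q : ℂ) ^ (u + 1)) q * qPochInf ((q : ℂ) ^ (-u)) q

/-- The entire function `π (q^{u+1}; q)_∞ (q^{-u}; q)_∞ / sin π u`. -/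
def thetaE (q : ℝ) (u : ℂ) : ℂ :=
  if Complex.sin (Real.pi * u) = 0 then deriv (thetaB q) u / Complex.cos (Real.pi * u)
  else Real.pi * thetaB q u / Complex.sin (Real.pi * u)

lemma differentiable_thetaB (hq0 : 0 < q) (hq1 : q < 1) : Differentiable ℂ (thetaB q) := by
  have h1 := differentiable_qPochInf hq0 hq1
  have h2 := differentiable_cpow hq0
  exact (h1.comp (h2.comp (differentiable_id.add_const 1))).mul (h1.comp (h2.comp differentiable_neg))

lemma thetaB_add_int_mul_qPeriod (hq0 : 0 < q) (hq1 : q < 1) (u : ℂ) (k : ℤ) :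
    thetaB q (u + k * qPeriod q) = thetaB q u := by
  have h1 : (q : ℂ) ^ (u + k * qPeriod q + 1) = (q : ℂ) ^ (u + 1) := by
    rw [add_right_comm, cpow_add_int_mul_qPeriod hq0 hq1]
  have h2 : (q : ℂ) ^ (-(u + k * qPeriod q)) = (q : ℂ) ^ (-u) := by
    rw [← cpow_add_int_mul_qPeriod hq0 hq1 (-u) (-k)]
    congr 1
    push_cast
    ring
  rw [thetaB, thetaB, h1, h2]

/-- The shift moves one factor between the two products, and `(1 - q^u)/(1 - q^{-u}) = -q^u`. -/
lemma thetaB_sub_one (hq0 : 0 < q) (hq1 : q < 1) (u : ℂ) :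
    thetaB q (u - 1) = -(q : ℂ) ^ u * thetaB q u := by
  have h1 : qPochInf ((q : ℂ) ^ u) q = (1 - (q : ℂ) ^ u) * qPochInf ((q : ℂ) ^ (u + 1)) q := by
    rw [qPochInf_eq hq0 hq1, cpow_add' hq0 u 1, Complex.cpow_one]
  have h2 : qPochInf ((q : ℂ) ^ (-u)) q = (1 - (q : ℂ) ^ (-u)) * qPochInf ((q : ℂ) ^ (-(u - 1))) q := by
    rw [qPochInf_eq hq0 hq1, show -(u - 1) = -u + 1 by ring, cpow_add' hq0 (-u) 1, Complex.cpow_one]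
  have h3 : (q : ℂ) ^ u * (q : ℂ) ^ (-u) = 1 := by
    rw [← cpow_add' hq0, add_neg_cancel, Complex.cpow_zero]
  rw [thetaB, thetaB, sub_add_cancel, h1, h2]
  linear_combination (-qPochInf ((q : ℂ) ^ (u + 1)) q * qPochInf ((q : ℂ) ^ (-(u - 1))) q) * h3

lemma thetaB_zero (hq0 : 0 < q) (hq1 : q < 1) : thetaB q 0 = 0 := by
  rw [thetaB, neg_zero, Complex.cpow_zero, qPochInf_eq hq0 hq1 1]
  simp

/-- The factor `1 - q^{-u}` gives the zero at `0`, and the quasi-periodicity carries it to every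
integer. These zeros cancel the poles of `π / sin πu`. -/
lemma thetaB_int (hq0 : 0 < q) (hq1 : q < 1) (m : ℤ) : thetaB q m = 0 := by
  have hstep : ∀ m : ℤ, thetaB q m = 0 ↔ thetaB q ((m - 1 : ℤ) : ℂ) = 0 := by
    intro m
    rw [Int.cast_sub, Int.cast_one, thetaB_sub_one hq0 hq1, mul_eq_zero,
      or_iff_right (neg_ne_zero.2 (cpow_ne_zero hq0 _))]
  induction m using Int.induction_on with
  | zero => simpa using thetaB_zero hq0 hq1
  | succ k ih => exact (hstep _).2 (by simpa using ih)
  | pred k ih => exact (hstep _).1 ih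

lemma hasDerivAt_thetaB_zero (hq0 : 0 < q) (hq1 : q < 1) :
    HasDerivAt (thetaB q) (qPochInf q q ^ 2 * Real.log q) 0 := by
  have h1 := differentiable_qPochInf hq0 hq1
  have h2 := differentiable_cpow hq0
  have hg : Differentiable ℂ fun u : ℂ => qPochInf ((q : ℂ) ^ (u + 1)) q *
      qPochInf ((q : ℂ) ^ (-u + 1)) q :=
    (h1.comp (h2.comp (differentiable_id.add_const 1))).mul
      (h1.comp (h2.comp (differentiable_neg.add_const 1)))
  have he : HasDerivAt (fun u : ℂ => 1 - (q : ℂ) ^ (-u)) (Real.log q : ℂ) 0 := by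
    have h3 : HasDerivAt (fun u : ℂ => Complex.exp (Real.log q * -u))
        (Complex.exp (Real.log q * -0) * (Real.log q * -1)) 0 :=
      (((hasDerivAt_id (0 : ℂ)).neg).const_mul _).cexp
    have h4 := h3.const_sub 1
    simp only [neg_zero, mul_zero, Complex.exp_zero, one_mul, mul_neg, mul_one, neg_neg] at h4
    refine h4.congr_of_eventuallyEq (.of_forall fun u => ?_)
    simp only [cpow_eq_exp hq0]
    ring_nf
  have h5 := he.mul (hg 0).hasDerivAt
  simp only [neg_zero, zero_add, Complex.cpow_zero, sub_self, zero_mul, add_zero,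
    Complex.cpow_one] at h5
  have h6 : thetaB q = fun u : ℂ => (1 - (q : ℂ) ^ (-u)) * (qPochInf ((q : ℂ) ^ (u + 1)) q *
      qPochInf ((q : ℂ) ^ (-u + 1)) q) := by
    funext u
    rw [thetaB, qPochInf_eq hq0 hq1 ((q : ℂ) ^ (-u)), cpow_add' hq0 (-u) 1, Complex.cpow_one]
    ring
  rw [h6]
  refine h5.congr_deriv ?_
  ring

lemma sin_pi_mul_eq_zero_iff (u : ℂ) : Complex.sin (Real.pi * u) = 0 ↔ ∃ m : ℤ, u = m := by
  have hpi : (Real.pi : ℂ) ≠ 0 := by exact_mod_cast Real.pi_ne_zero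
  rw [Complex.sin_eq_zero_iff]
  refine exists_congr fun m => ?_
  rw [mul_comm]
  exact mul_left_inj' hpi

lemma thetaE_mul_sin (hq0 : 0 < q) (hq1 : q < 1) (u : ℂ) :
    thetaE q u * Complex.sin (Real.pi * u) = Real.pi * thetaB q u := by
  unfold thetaE
  split_ifs with h
  · obtain ⟨m, rfl⟩ := (sin_pi_mul_eq_zero_iff u).1 h
    rw [h, thetaB_int hq0 hq1, mul_zero, mul_zero]
  · rw [div_mul_cancel₀ _ h]

lemma cos_ne_zero_of_sin {z : ℂ} (h : Complex.sin z = 0) : Complex.cos z ≠ 0 := by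
  intro h'
  have := Complex.sin_sq_add_cos_sq z
  rw [h, h'] at this
  norm_num at this

/-- At an integer both numerator and denominator vanish, and the zero of the sine is simple. Near it
the function is a quotient of two `dslope`s with nonvanishing denominator; the value chosen in
`thetaE` is the limit there. -/
lemma differentiable_thetaE (hq0 : 0 < q) (hq1 : q < 1) : Differentiable ℂ (thetaE q) := by
  intro u₀
  have hpi : (Real.pi : ℂ) ≠ 0 := by exact_mod_cast Real.pi_ne_zero
  have hS : Differentiable ℂ fun u : ℂ => Complex.sin (Real.pi * u) := by fun_prop
  have hB := differentiable_thetaB hq0 hq1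
  by_cases h : Complex.sin (Real.pi * u₀) = 0
  · set S : ℂ → ℂ := fun u => Complex.sin (Real.pi * u) with hSdef
    have hSd : HasDerivAt S (Complex.cos (Real.pi * u₀) * Real.pi) u₀ := by
      have := ((hasDerivAt_id u₀).const_mul (Real.pi : ℂ)).csin
      simpa using this
    have hcos := cos_ne_zero_of_sin h
    have hB0 : thetaB q u₀ = 0 := by
      obtain ⟨m, rfl⟩ := (sin_pi_mul_eq_zero_iff u₀).1 h
      exact thetaB_int hq0 hq1 m
    have hdB : DifferentiableAt ℂ (dslope (thetaB q) u₀) u₀ :=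
      ((Complex.differentiableOn_dslope univ_mem).2 hB.differentiableOn).differentiableAt univ_mem
    have hdS : DifferentiableAt ℂ (dslope S u₀) u₀ :=
      ((Complex.differentiableOn_dslope univ_mem).2 hS.differentiableOn).differentiableAt univ_mem
    have hdS0 : dslope S u₀ u₀ ≠ 0 := by
      rw [dslope_same, hSd.deriv]
      exact mul_ne_zero hcos hpi
    have hev : ∀ᶠ u in 𝓝 u₀, dslope S u₀ u ≠ 0 := hdS.continuousAt.eventually_ne hdS0
    have hmain : DifferentiableAt ℂ (fun u => Real.pi * dslope (thetaB q) u₀ u / dslope S u₀ u) u₀ :=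
      (hdB.const_mul _).div hdS hdS0
    refine hmain.congr_of_eventuallyEq ?_
    filter_upwards [hev] with u hu
    rcases eq_or_ne u u₀ with rfl | hne
    · rw [thetaE, if_pos h, dslope_same, dslope_same, hSd.deriv]
      field_simp
    · have h1 := sub_smul_dslope S u₀ u
      have h2 := sub_smul_dslope (thetaB q) u₀ u
      rw [hB0, sub_zero, smul_eq_mul] at h2
      rw [show S u₀ = 0 from h, sub_zero, smul_eq_mul] at h1
      have hsub : u - u₀ ≠ 0 := sub_ne_zero.2 hne
      have h3 : Complex.sin (Real.pi * u) = (u - u₀) * dslope S u₀ u := h1.symm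
      have h4 : Complex.sin (Real.pi * u) ≠ 0 := by
        rw [h3]; exact mul_ne_zero hsub hu
      rw [thetaE, if_neg h4, h3, ← h2]
      field_simp
  · have hev : ∀ᶠ u in 𝓝 u₀, Complex.sin (Real.pi * u) ≠ 0 :=
      (hS u₀).continuousAt.eventually_ne h
    have hmain : DifferentiableAt ℂ
        (fun u => Real.pi * thetaB q u / Complex.sin (Real.pi * u)) u₀ :=
      ((hB u₀).const_mul _).div (hS u₀) h
    refine hmain.congr_of_eventuallyEq ?_
    filter_upwards [hev] with u hu
    rw [thetaE, if_neg hu]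

/-- The sign change of the sine cancels the sign in `thetaB_sub_one`. This proves the identity off
the integers, and density with continuity extends it. -/
lemma thetaE_sub_one (hq0 : 0 < q) (hq1 : q < 1) (u : ℂ) :
    thetaE q (u - 1) = (q : ℂ) ^ u * thetaE q u := by
  have hE := (differentiable_thetaE hq0 hq1).continuous
  have hdense : Dense (range (fun m : ℤ => (m : ℂ)))ᶜ := (countable_range _).dense_compl ℝ
  have h : (fun u => thetaE q (u - 1)) = fun u => (q : ℂ) ^ u * thetaE q u := by
    refine Continuous.ext_on hdense (by fun_prop) ((differentiable_cpow hq0).continuous.mul hE) ?_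
    intro u hu
    have hs : Complex.sin (Real.pi * u) ≠ 0 := fun h => by
      obtain ⟨m, rfl⟩ := (sin_pi_mul_eq_zero_iff u).1 h
      exact hu ⟨m, rfl⟩
    have hs' : Complex.sin (Real.pi * (u - 1)) = -Complex.sin (Real.pi * u) := by
      rw [mul_sub, mul_one, Complex.sin_sub_pi]
    have h1 := thetaE_mul_sin hq0 hq1 (u - 1)
    have h2 := thetaE_mul_sin hq0 hq1 u
    rw [hs', thetaB_sub_one hq0 hq1] at h1
    apply mul_right_cancel₀ hs
    linear_combination -h1 - (q : ℂ) ^ u * h2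
  exact congrFun h u

lemma thetaE_zero (hq0 : 0 < q) (hq1 : q < 1) :
    thetaE q 0 = qPochInf q q ^ 2 * Real.log q := by
  rw [thetaE, if_pos (by simp), (hasDerivAt_thetaB_zero hq0 hq1).deriv]
  simp

lemma sinh_abs_le_norm_sin (z : ℂ) : Real.sinh |z.im| ≤ ‖Complex.sin z‖ := by
  have h1 : ‖Complex.exp (-z * Complex.I)‖ = Real.exp z.im := by
    rw [Complex.norm_exp]; simp
  have h2 : ‖Complex.exp (z * Complex.I)‖ = Real.exp (-z.im) := by
    rw [Complex.norm_exp]; simp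
  have h3 : ‖Complex.sin z‖ = ‖Complex.exp (-z * Complex.I) - Complex.exp (z * Complex.I)‖ / 2 := by
    rw [Complex.sin, norm_div, norm_mul, Complex.norm_I, mul_one]
    norm_num
  rw [h3]
  have h4 := abs_norm_sub_norm_le (Complex.exp (-z * Complex.I)) (Complex.exp (z * Complex.I))
  rw [h1, h2] at h4
  rw [Real.sinh_eq]
  rcases abs_cases z.im with ⟨h, _⟩ | ⟨h, _⟩
  · rw [h]
    have := le_abs_self (Real.exp z.im - Real.exp (-z.im))
    linarith
  · rw [h, neg_neg]
    have := neg_abs_le (Real.exp z.im - Real.exp (-z.im))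
    linarith

/-- In a vertical strip `|q^u|` is bounded above and below, so `thetaB` is bounded, and `|sin πu| ≥
e^{π|Im u|}/4` once `|Im u| > 1`. The remaining part of the strip is compact and `thetaE` is
continuous on it. -/
lemma exists_norm_thetaE_le (hq0 : 0 < q) (hq1 : q < 1) (c d : ℝ) :
    ∃ C : ℝ, 0 ≤ C ∧ ∀ u : ℂ, c ≤ u.re → u.re ≤ d →
      ‖thetaE q u‖ ≤ C * Real.exp (-(Real.pi * |u.im|)) := by
  have hball : ∀ R : ℝ, ∃ M : ℝ, ∀ z : ℂ, ‖z‖ ≤ R → ‖qPochInf z q‖ ≤ M := by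
    intro R
    obtain ⟨M, hM⟩ := (isCompact_closedBall (0 : ℂ) R).exists_bound_of_continuousOn
      (continuous_qPochInf hq0 hq1).continuousOn
    exact ⟨M, fun z hz => hM z (by simpa using hz)⟩
  obtain ⟨M₁, hM₁⟩ := hball (q ^ (c + 1))
  obtain ⟨M₂, hM₂⟩ := hball (q ^ (-d))
  have hB : ∀ u : ℂ, c ≤ u.re → u.re ≤ d → ‖thetaB q u‖ ≤ |M₁| * |M₂| := by
    intro u h1 h2
    rw [thetaB, norm_mul]
    refine mul_le_mul ((hM₁ _ ?_).trans (le_abs_self _)) ((hM₂ _ ?_).trans (le_abs_self _))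
      (norm_nonneg _) (abs_nonneg _)
    · rw [norm_cpow_eq hq0]
      exact Real.rpow_le_rpow_of_exponent_ge hq0 hq1.le (by simpa using h1)
    · rw [norm_cpow_eq hq0]
      exact Real.rpow_le_rpow_of_exponent_ge hq0 hq1.le (by simpa using h2)
  obtain ⟨K, hK⟩ := (IsCompact.reProdIm (isCompact_Icc (a := c) (b := d))
    (isCompact_Icc (a := (-1 : ℝ)) (b := 1))).exists_bound_of_continuousOn
      (differentiable_thetaE hq0 hq1).continuous.continuousOn
  refine ⟨|K| * Real.exp Real.pi + 4 * Real.pi * (|M₁| * |M₂|), by positivity, fun u h1 h2 => ?_⟩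
  rcases le_or_gt |u.im| 1 with h | h
  · have h3 : ‖thetaE q u‖ ≤ |K| :=
      (hK u ⟨⟨h1, h2⟩, abs_le.1 h⟩).trans (le_abs_self _)
    have h4 : Real.exp (-(Real.pi * |u.im|)) * Real.exp Real.pi ≥ 1 := by
      rw [← Real.exp_add]
      apply Real.one_le_exp
      nlinarith [Real.pi_pos]
    have h5 : 0 ≤ 4 * Real.pi * (|M₁| * |M₂|) * Real.exp (-(Real.pi * |u.im|)) := by positivity
    nlinarith [abs_nonneg K]
  · have h3 : Real.exp (Real.pi * |u.im|) / 4 ≤ ‖Complex.sin (Real.pi * u)‖ := by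
      refine le_trans ?_ (sinh_abs_le_norm_sin _)
      have h4 : |((Real.pi : ℂ) * u).im| = Real.pi * |u.im| := by
        simp [abs_mul, abs_of_pos Real.pi_pos]
      rw [h4, Real.sinh_eq]
      set y := Real.pi * |u.im| with hy
      have hy1 : 1 ≤ y := by nlinarith [Real.pi_gt_three]
      have h5 : Real.exp (-y) ≤ 1 := Real.exp_le_one_iff.2 (by linarith)
      have h6 := Real.add_one_le_exp y
      linarith
    have h4 : 0 < Real.exp (Real.pi * |u.im|) := Real.exp_pos _
    have hs : Complex.sin (Real.pi * u) ≠ 0 := by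
      rw [← norm_pos_iff]; linarith
    have h5 : ‖thetaE q u‖ * ‖Complex.sin (Real.pi * u)‖ = Real.pi * ‖thetaB q u‖ := by
      rw [← norm_mul, thetaE_mul_sin hq0 hq1, norm_mul, Complex.norm_real,
        Real.norm_of_nonneg Real.pi_pos.le]
    have h6 := hB u h1 h2
    have h7 : ‖thetaE q u‖ * (Real.exp (Real.pi * |u.im|) / 4) ≤ Real.pi * (|M₁| * |M₂|) :=
      calc _ ≤ ‖thetaE q u‖ * ‖Complex.sin (Real.pi * u)‖ :=
            mul_le_mul_of_nonneg_left h3 (norm_nonneg _)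
        _ = Real.pi * ‖thetaB q u‖ := h5
        _ ≤ _ := mul_le_mul_of_nonneg_left h6 Real.pi_pos.le
    have h8 : ‖thetaE q u‖ ≤ 4 * Real.pi * (|M₁| * |M₂|) * Real.exp (-(Real.pi * |u.im|)) := by
      rw [Real.exp_neg, ← div_eq_mul_inv, le_div_iff₀ h4]
      linarith
    have h9 : 0 ≤ |K| * Real.exp Real.pi * Real.exp (-(Real.pi * |u.im|)) := by positivity
    nlinarith

/-- The Mellin kernel `π (q^{u+1}; q)_∞ (q^{-u}; q)_∞ (-ζ)^u / sin π u`. -/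
def mellinKernel (q : ℝ) (ζ u : ℂ) : ℂ := thetaE q u * (-ζ) ^ u

lemma neg_mem_slitPlane {ζ : ℂ} (hζ : ∀ x : ℝ, 0 ≤ x → ζ ≠ x) : -ζ ∈ Complex.slitPlane := by
  rw [Complex.mem_slitPlane_iff]
  by_contra h
  push Not at h
  simp only [Complex.neg_re, Complex.neg_im, neg_eq_zero] at h
  exact hζ ζ.re (by linarith [h.1]) (Complex.ext (by simp) (by simp [h.2]))

lemma ne_zero_of_slit {ζ : ℂ} (hζ : ∀ x : ℝ, 0 ≤ x → ζ ≠ x) : ζ ≠ 0 := by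
  simpa using hζ 0 le_rfl

/-- The power `(-ζ)^u` grows at most like `e^{|arg(-ζ)| |Im u|}` in the strip. As `ζ` avoids `[0,
∞)`, `|arg(-ζ)| < π`, which leaves the decay rate `δ = π - |arg(-ζ)|`. -/
lemma exists_norm_mellinKernel_le (hq0 : 0 < q) (hq1 : q < 1) {ζ : ℂ}
    (hζ : ∀ x : ℝ, 0 ≤ x → ζ ≠ x) (c d : ℝ) :
    ∃ C δ : ℝ, 0 ≤ C ∧ 0 < δ ∧ ∀ u : ℂ, c ≤ u.re → u.re ≤ d →
      ‖mellinKernel q ζ u‖ ≤ C * Real.exp (-(δ * |u.im|)) := by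
  obtain ⟨C, hC, h⟩ := exists_norm_thetaE_le hq0 hq1 c d
  have harg : |Complex.arg (-ζ)| < Real.pi := by
    rw [abs_lt]
    exact ⟨Complex.neg_pi_lt_arg _, (Complex.arg_le_pi _).lt_of_ne
      (Complex.slitPlane_arg_ne_pi (neg_mem_slitPlane hζ))⟩
  set l : ℝ := |Real.log ‖-ζ‖| * (|c| + |d|) with hl
  refine ⟨C * Real.exp l, Real.pi - |Complex.arg (-ζ)|, by positivity, sub_pos.2 harg,
    fun u h1 h2 => ?_⟩
  have h3 : ‖(-ζ) ^ u‖ ≤ Real.exp l * Real.exp (|Complex.arg (-ζ)| * |u.im|) := by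
    rw [Complex.cpow_def_of_ne_zero (neg_ne_zero.2 (ne_zero_of_slit hζ)), Complex.norm_exp,
      ← Real.exp_add, Real.exp_le_exp, Complex.mul_re, Complex.log_re, Complex.log_im]
    have h4 : Real.log ‖-ζ‖ * u.re ≤ l := by
      refine (le_abs_self _).trans ?_
      rw [abs_mul]
      refine mul_le_mul_of_nonneg_left ?_ (abs_nonneg _)
      rw [abs_le]
      constructor
      · linarith [neg_abs_le c, abs_nonneg d]
      · linarith [le_abs_self d, abs_nonneg c]
    have h5 : -(Complex.arg (-ζ) * u.im) ≤ |Complex.arg (-ζ)| * |u.im| := by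
      rw [← abs_mul]; exact neg_le_abs _
    linarith
  rw [mellinKernel, norm_mul]
  calc _ ≤ (C * Real.exp (-(Real.pi * |u.im|))) *
        (Real.exp l * Real.exp (|Complex.arg (-ζ)| * |u.im|)) :=
        mul_le_mul (h u h1 h2) h3 (norm_nonneg _) (by positivity)
    _ = C * Real.exp l * (Real.exp (-(Real.pi * |u.im|)) *
        Real.exp (|Complex.arg (-ζ)| * |u.im|)) := by ring
    _ = _ := by
        rw [← Real.exp_add]
        congr 2
        ring

lemma differentiable_mellinKernel (hq0 : 0 < q) (hq1 : q < 1) {ζ : ℂ}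
    (hζ : ∀ x : ℝ, 0 ≤ x → ζ ≠ x) : Differentiable ℂ (mellinKernel q ζ) := by
  intro u
  refine (differentiable_thetaE hq0 hq1 u).mul ?_
  exact (differentiableAt_id).const_cpow (Or.inl (neg_ne_zero.2 (ne_zero_of_slit hζ)))

lemma mellinKernel_sub_one (hq0 : 0 < q) (hq1 : q < 1) {ζ : ℂ}
    (hζ : ζ ≠ 0) (u : ℂ) : mellinKernel q ζ (u - 1) = -ζ⁻¹ * (q : ℂ) ^ u * mellinKernel q ζ u := by
  rw [mellinKernel, mellinKernel, thetaE_sub_one hq0 hq1, Complex.cpow_sub _ _ (neg_ne_zero.2 hζ),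
    Complex.cpow_one]
  field_simp

lemma summable_exp_neg_abs_int {δ : ℝ} (hδ : 0 < δ) :
    Summable fun k : ℤ => Real.exp (-(δ * |(k : ℝ)|)) := by
  have h : Summable fun k : ℕ => Real.exp (-(δ * (k : ℝ))) := by
    have := Real.summable_exp_nat_mul_iff.2 (neg_neg_of_pos hδ)
    refine this.congr fun k => ?_
    congr 1
    ring
  refine Summable.of_nat_of_neg ?_ ?_
  · refine h.congr fun k => ?_
    simp
  · refine h.congr fun k => ?_
    simp

/-- A summable bound for the translates of the Mellin kernel, uniform on bounded sets. -/
lemma exists_summable_bound_mellinKernel (hq0 : 0 < q) (hq1 : q < 1) {ζ : ℂ}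
    (hζ : ∀ x : ℝ, 0 ≤ x → ζ ≠ x) (c d M : ℝ) :
    ∃ b : ℤ → ℝ, Summable b ∧ ∀ (k : ℤ) (u : ℂ), c ≤ u.re → u.re ≤ d → |u.im| ≤ M →
      ‖mellinKernel q ζ (u + k * qPeriod q)‖ ≤ b k := by
  obtain ⟨C, δ, hC, hδ, h⟩ := exists_norm_mellinKernel_le hq0 hq1 hζ c d
  set T := |2 * Real.pi / Real.log q| with hT
  have hT0 : 0 < T := abs_pos.2 (div_ne_zero (by positivity) (Real.log_neg hq0 hq1).ne)
  refine ⟨fun k => C * (Real.exp (δ * M) * Real.exp (-(δ * T * |(k : ℝ)|))),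
    ((summable_exp_neg_abs_int (mul_pos hδ hT0)).mul_left _).mul_left _, fun k u h1 h2 h3 => ?_⟩
  have hre : (u + k * qPeriod q).re = u.re := by
    simp [qPeriod_re]
  have him : (u + k * qPeriod q).im = u.im + k * (2 * Real.pi / Real.log q) := by
    simp [qPeriod_im]
  refine (h _ (by rwa [hre]) (by rwa [hre])).trans ?_
  dsimp only
  rw [him, ← Real.exp_add]
  refine mul_le_mul_of_nonneg_left (Real.exp_le_exp.2 ?_) hC
  have h4 : |(k : ℝ)| * T - M ≤ |u.im + k * (2 * Real.pi / Real.log q)| := by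
    have := abs_sub_abs_le_abs_sub ((k : ℝ) * (2 * Real.pi / Real.log q)) (-u.im)
    rw [abs_mul, ← hT, abs_neg, sub_neg_eq_add, add_comm _ u.im] at this
    linarith
  nlinarith

/-- The sum of the Mellin kernel over the period lattice. -/
def mellinPeriodization (q : ℝ) (ζ u : ℂ) : ℂ := ∑' k : ℤ, mellinKernel q ζ (u + k * qPeriod q)

lemma differentiable_mellinPeriodization (hq0 : 0 < q) (hq1 : q < 1) {ζ : ℂ}
    (hζ : ∀ x : ℝ, 0 ≤ x → ζ ≠ x) : Differentiable ℂ (mellinPeriodization q ζ) := by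
  intro u₀
  obtain ⟨b, hb, h⟩ := exists_summable_bound_mellinKernel hq0 hq1 hζ (u₀.re - 1) (u₀.re + 1)
    (|u₀.im| + 1)
  have hd := Complex.differentiableOn_tsum_of_summable_norm (U := Metric.ball u₀ 1)
    (F := fun (k : ℤ) u => mellinKernel q ζ (u + k * qPeriod q)) hb
    (fun k => ((differentiable_mellinKernel hq0 hq1 hζ).comp
      (differentiable_id.add_const _)).differentiableOn) Metric.isOpen_ball ?_
  · exact hd.differentiableAt (Metric.ball_mem_nhds _ one_pos)
  · intro k u hu
    rw [Metric.mem_ball, dist_eq_norm] at hu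
    have h1 := (Complex.abs_re_le_norm (u - u₀)).trans hu.le
    have h2 := (Complex.abs_im_le_norm (u - u₀)).trans hu.le
    rw [Complex.sub_re, abs_le] at h1
    rw [Complex.sub_im] at h2
    have h3 := abs_sub_abs_le_abs_sub u.im u₀.im
    exact h k u (by linarith [h1.1]) (by linarith [h1.2]) (by linarith)

lemma mellinPeriodization_add_qPeriod (q : ℝ) (ζ u : ℂ) :
    mellinPeriodization q ζ (u + qPeriod q) = mellinPeriodization q ζ u := by
  rw [mellinPeriodization, mellinPeriodization, ← (Equiv.addRight (1 : ℤ)).tsum_eq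
    (fun k : ℤ => mellinKernel q ζ (u + k * qPeriod q))]
  refine tsum_congr fun k => ?_
  congr 1
  simp only [Equiv.coe_addRight]
  push_cast
  ring

lemma mellinPeriodization_sub_one (hq0 : 0 < q) (hq1 : q < 1) {ζ : ℂ} (hζ : ζ ≠ 0) (u : ℂ) :
    mellinPeriodization q ζ (u - 1) = -ζ⁻¹ * (q : ℂ) ^ u * mellinPeriodization q ζ u := by
  rw [mellinPeriodization, mellinPeriodization, ← tsum_mul_left]
  refine tsum_congr fun k => ?_
  rw [show u - 1 + k * qPeriod q = u + k * qPeriod q - 1 by ring, mellinKernel_sub_one hq0 hq1 hζ,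
    cpow_add_int_mul_qPeriod hq0 hq1]

/-- Only the term `k = 0` survives: the other translates of `-1` are not real, so the sine is
nonzero there, whereas the periodic function `thetaB` still vanishes. -/
lemma mellinPeriodization_neg_one (hq0 : 0 < q) (hq1 : q < 1) (ζ : ℂ) :
    mellinPeriodization q ζ (-1) = -ζ⁻¹ * (qPochInf q q ^ 2 * Real.log q) := by
  rw [mellinPeriodization, tsum_eq_single 0]
  · have h := thetaE_sub_one hq0 hq1 0
    rw [Complex.cpow_zero, one_mul, zero_sub] at h
    rw [Int.cast_zero, zero_mul, add_zero, mellinKernel, h, thetaE_zero hq0 hq1,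
      Complex.cpow_neg_one, inv_neg]
    ring
  · intro k hk
    have hs : Complex.sin (Real.pi * (-1 + k * qPeriod q)) ≠ 0 := by
      intro h
      obtain ⟨m, hm⟩ := (sin_pi_mul_eq_zero_iff _).1 h
      have := congrArg Complex.im hm
      simp only [Complex.add_im, Complex.neg_im, Complex.one_im, neg_zero, zero_add,
        Complex.mul_im, Complex.intCast_re, Complex.intCast_im, qPeriod_im, zero_mul,
        add_zero, mul_eq_zero, Int.cast_eq_zero, hk, false_or] at this
      exact div_ne_zero (by positivity) (Real.log_neg hq0 hq1).ne this
    rw [mellinKernel, thetaE, if_neg hs, thetaB_add_int_mul_qPeriod hq0 hq1]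
    have : thetaB q (-1) = 0 := by simpa using thetaB_int hq0 hq1 (-1)
    rw [this]
    simp

end ThetaKernel

/-! ### The bilateral series of the observable and its Mellin–Barnes form. -/

section Observable

variable {q : ℝ}

/-- The reciprocal `1 / (ζ q^l; q)_∞` as a function of the integer `l`. -/
def obs (q : ℝ) (ζ : ℂ) (l : ℤ) : ℂ := (qPochInf (ζ * (q : ℂ) ^ l) q)⁻¹

lemma one_sub_mul_zpow_ne_zero (hq0 : 0 < q) {ζ : ℂ} (hζ : ∀ x : ℝ, 0 ≤ x → ζ ≠ x) (l : ℤ) :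
    1 - ζ * (q : ℂ) ^ l ≠ 0 := by
  intro h
  refine hζ ((q ^ l)⁻¹) (by positivity) ?_
  push_cast
  exact eq_inv_of_mul_eq_one_left (sub_eq_zero.1 h).symm

lemma qPochInf_mul_zpow_ne_zero (hq0 : 0 < q) (hq1 : q < 1) {ζ : ℂ}
    (hζ : ∀ x : ℝ, 0 ≤ x → ζ ≠ x) (l : ℤ) : qPochInf (ζ * (q : ℂ) ^ l) q ≠ 0 := by
  refine qPochInf_ne_zero hq0 hq1 fun k => ?_
  have := one_sub_mul_zpow_ne_zero hq0 hζ (l + k)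
  rwa [zpow_add₀ (by exact_mod_cast hq0.ne'), zpow_natCast, ← mul_assoc] at this

lemma obs_ne_zero (hq0 : 0 < q) (hq1 : q < 1) {ζ : ℂ}
    (hζ : ∀ x : ℝ, 0 ≤ x → ζ ≠ x) (l : ℤ) : obs q ζ l ≠ 0 :=
  inv_ne_zero (qPochInf_mul_zpow_ne_zero hq0 hq1 hζ l)

lemma obs_add_one (hq0 : 0 < q) (hq1 : q < 1) {ζ : ℂ}
    (hζ : ∀ x : ℝ, 0 ≤ x → ζ ≠ x) (l : ℤ) :
    obs q ζ (l + 1) = (1 - ζ * (q : ℂ) ^ l) * obs q ζ l := by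
  have h := qPochInf_eq hq0 hq1 (ζ * (q : ℂ) ^ l)
  rw [mul_assoc, ← zpow_add_one₀ (by exact_mod_cast hq0.ne')] at h
  have h1 := qPochInf_mul_zpow_ne_zero hq0 hq1 hζ (l + 1)
  rw [obs, obs, h, mul_inv, ← mul_assoc,
    mul_inv_cancel₀ (one_sub_mul_zpow_ne_zero hq0 hζ l), one_mul]

lemma tendsto_mul_pow_nhds_zero (hq0 : 0 < q) (hq1 : q < 1) (ζ : ℂ) :
    Tendsto (fun k : ℕ => ζ * (q : ℂ) ^ (k : ℤ)) atTop (𝓝 0) := by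
  have h := (tendsto_pow_atTop_nhds_zero_of_norm_lt_one (x := (q : ℂ))
    (by simpa [abs_of_pos hq0] using hq1)).const_mul ζ
  simpa using h

lemma tendsto_obs_atTop (hq0 : 0 < q) (hq1 : q < 1) (ζ : ℂ) :
    Tendsto (fun k : ℕ => obs q ζ k) atTop (𝓝 1) := by
  have h := ((continuous_qPochInf hq0 hq1).tendsto 0).comp (tendsto_mul_pow_nhds_zero hq0 hq1 ζ)
  rw [qPochInf_zero_left] at h
  simpa [obs] using h.inv₀ one_ne_zero

/-- Ratio test at both ends: the ratio `(1 - ζ q^l) x` of consecutive terms tends to `x` as `l →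
+∞`, and its inverse tends to `0` as `l → -∞`. Hence the whole punctured unit disc is allowed. -/
lemma summable_obs_mul_zpow (hq0 : 0 < q) (hq1 : q < 1) {ζ : ℂ}
    (hζ : ∀ x : ℝ, 0 ≤ x → ζ ≠ x) {x : ℂ} (hx0 : x ≠ 0) (hx1 : ‖x‖ < 1) :
    Summable fun l : ℤ => obs q ζ l * x ^ l := by
  have hne : ∀ l : ℤ, obs q ζ l * x ^ l ≠ 0 := fun l =>
    mul_ne_zero (obs_ne_zero hq0 hq1 hζ l) (zpow_ne_zero _ hx0)
  have hrec : ∀ l : ℤ, obs q ζ (l + 1) * x ^ (l + 1) =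
      ((1 - ζ * (q : ℂ) ^ l) * x) * (obs q ζ l * x ^ l) := by
    intro l
    rw [obs_add_one hq0 hq1 hζ, zpow_add_one₀ hx0]
    ring
  refine Summable.of_nat_of_neg ?_ ?_
  · refine summable_of_ratio_test_tendsto_lt_one hx1 (.of_forall fun k => hne k) ?_
    have h1 : Tendsto (fun k : ℕ => ‖(1 - ζ * (q : ℂ) ^ (k : ℤ)) * x‖) atTop
        (𝓝 ‖(1 - 0) * x‖) :=
      ((tendsto_const_nhds.sub (tendsto_mul_pow_nhds_zero hq0 hq1 ζ)).mul_const x).norm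
    rw [sub_zero, one_mul] at h1
    refine h1.congr fun k => ?_
    have h2 := hrec k
    push_cast at h2 ⊢
    rw [h2, norm_mul (_ * x), mul_div_cancel_right₀ _ (norm_ne_zero_iff.2 (hne k))]
  · refine summable_of_ratio_test_tendsto_lt_one zero_lt_one
      (.of_forall fun k => hne (-(k : ℤ))) ?_
    have hζ0 := ne_zero_of_slit hζ
    have hqx : (q : ℂ) ≠ 0 := by exact_mod_cast hq0.ne'
    have h1 : Tendsto (fun k : ℕ => ‖(q : ℂ) ^ ((k : ℤ) + 1) *
        (((q : ℂ) ^ ((k : ℤ) + 1) - ζ) * x)⁻¹‖) atTop (𝓝 ‖(0 : ℂ) * ((0 - ζ) * x)⁻¹‖) := by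
      have h3 : Tendsto (fun k : ℕ => (q : ℂ) ^ ((k : ℤ) + 1)) atTop (𝓝 0) := by
        have := (tendsto_mul_pow_nhds_zero hq0 hq1 1).comp (tendsto_add_atTop_nat 1)
        refine this.congr fun k => ?_
        simp only [Function.comp, one_mul]
        push_cast
        rfl
      refine (h3.mul (Tendsto.inv₀ ((h3.sub_const ζ).mul_const x) ?_)).norm
      simp [hζ0, hx0]
    rw [zero_mul, norm_zero] at h1
    refine h1.congr fun k => ?_
    have h2 := hrec (-((k : ℤ) + 1))
    have h5 : -((k : ℤ) + 1) + 1 = -(k : ℤ) := by ring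
    rw [h5] at h2
    have h4 := one_sub_mul_zpow_ne_zero hq0 hζ (-((k : ℤ) + 1))
    push_cast at h2 ⊢
    have hn := hne (-((k : ℤ) + 1))
    rw [h2, norm_mul (_ * x)]
    have e : (q : ℂ) ^ ((k : ℤ) + 1) * (((q : ℂ) ^ ((k : ℤ) + 1) - ζ) * x)⁻¹ =
        ((1 - ζ * (q : ℂ) ^ (-((k : ℤ) + 1))) * x)⁻¹ := by
      have h6 : (q : ℂ) ^ ((k : ℤ) + 1) ≠ 0 := zpow_ne_zero _ hqx
      have h7 : ((q : ℂ) ^ ((k : ℤ) + 1) - ζ) =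
          (q : ℂ) ^ ((k : ℤ) + 1) * (1 - ζ * (q : ℂ) ^ (-((k : ℤ) + 1))) := by
        rw [zpow_neg]; field_simp
      rw [h7, mul_assoc, mul_inv ((q : ℂ) ^ ((k : ℤ) + 1)), ← mul_assoc, mul_inv_cancel₀ h6,
        one_mul]
    rw [e, norm_inv]
    have := norm_ne_zero_iff.2 hn
    have := norm_ne_zero_iff.2 (mul_ne_zero h4 hx0)
    field_simp

/-- The bilateral series `∑_{l ∈ ℤ} x^l / (ζ q^l; q)_∞`. -/
def obsSeries (q : ℝ) (ζ x : ℂ) : ℂ := ∑' l : ℤ, obs q ζ l * x ^ l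

lemma differentiableOn_obsSeries (hq0 : 0 < q) (hq1 : q < 1) {ζ : ℂ}
    (hζ : ∀ x : ℝ, 0 ≤ x → ζ ≠ x) :
    DifferentiableOn ℂ (obsSeries q ζ) {x | x ≠ 0 ∧ ‖x‖ < 1} := by
  rintro x ⟨hx0, hx1⟩
  have hxp := norm_pos_iff.2 hx0
  -- On the annulus `r₁ < |y| < r₂` around `x`, `|y|^l ≤ r₁^l + r₂^l` for every integer `l`, and
  -- both geometric majorants are summable against `obs`.
  set r₁ := ‖x‖ / 2 with hr₁
  set r₂ := (‖x‖ + 1) / 2 with hr₂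
  have h1 : 0 < r₁ := by positivity
  have h2 : r₁ < ‖x‖ := by linarith
  have h3 : ‖x‖ < r₂ := by linarith
  have h4 : r₂ < 1 := by linarith
  have hs : ∀ s : ℝ, 0 < s → s < 1 → Summable fun l : ℤ => ‖obs q ζ l‖ * s ^ l := by
    intro s hs0 hs1
    have := (summable_obs_mul_zpow hq0 hq1 hζ (x := (s : ℂ)) (by exact_mod_cast hs0.ne')
      (by simpa [abs_of_pos hs0] using hs1)).norm
    refine this.congr fun l => ?_
    rw [norm_mul, norm_zpow, Complex.norm_real, Real.norm_of_nonneg hs0.le]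
  have hU : IsOpen {y : ℂ | r₁ < ‖y‖ ∧ ‖y‖ < r₂} :=
    (isOpen_lt continuous_const continuous_norm).inter (isOpen_lt continuous_norm continuous_const)
  have hd := Complex.differentiableOn_tsum_of_summable_norm
    (F := fun (l : ℤ) y => obs q ζ l * y ^ l)
    ((hs r₁ h1 (by linarith)).add (hs r₂ (by linarith) h4)) (fun l => ?_) hU ?_
  · exact (hd.differentiableAt (hU.mem_nhds ⟨h2, h3⟩)).differentiableWithinAt
  · intro y hy
    have hy0 : y ≠ 0 := norm_pos_iff.1 (h1.trans hy.1)
    exact ((differentiableAt_zpow.2 (Or.inl hy0)).const_mul _).differentiableWithinAt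
  · rintro l y ⟨hy1, hy2⟩
    rw [norm_mul, norm_zpow, ← mul_add]
    refine mul_le_mul_of_nonneg_left ?_ (norm_nonneg _)
    rcases le_total 0 l with hl | hl
    · exact (zpow_le_zpow_left₀ hl (norm_nonneg _) hy2.le).trans
        (le_add_of_nonneg_left (by positivity))
    · refine le_trans ?_ (le_add_of_nonneg_right (by positivity))
      obtain ⟨k, rfl⟩ := Int.exists_eq_neg_ofNat hl
      rw [zpow_neg, zpow_neg, zpow_natCast, zpow_natCast]
      exact inv_anti₀ (by positivity) (pow_le_pow_left₀ h1.le hy1.le k)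

/-- The recurrence of `obs` reads `ζ q^l obs(l) = obs(l) - obs(l+1)`; it is multiplied by `x^l` and
summed. -/
lemma obsSeries_mul (hq0 : 0 < q) (hq1 : q < 1) {ζ : ℂ}
    (hζ : ∀ x : ℝ, 0 ≤ x → ζ ≠ x) {x : ℂ} (hx0 : x ≠ 0) (hx1 : ‖x‖ < 1) :
    ζ * obsSeries q ζ (x * q) = (1 - x⁻¹) * obsSeries q ζ x := by
  have hs := summable_obs_mul_zpow hq0 hq1 hζ hx0 hx1
  have h1 : ∑' l : ℤ, obs q ζ (l + 1) * x ^ l = x⁻¹ * obsSeries q ζ x := by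
    rw [obsSeries, ← (Equiv.addRight (1 : ℤ)).tsum_eq (fun l : ℤ => obs q ζ l * x ^ l),
      ← tsum_mul_left]
    refine tsum_congr fun l => ?_
    simp only [Equiv.coe_addRight]
    rw [zpow_add_one₀ hx0]
    field_simp
  have hs1 : Summable fun l : ℤ => obs q ζ (l + 1) * x ^ l := by
    have := ((Equiv.addRight (1 : ℤ)).summable_iff.2 hs).mul_left x⁻¹
    refine this.congr fun l => ?_
    simp only [Function.comp, Equiv.coe_addRight]
    rw [zpow_add_one₀ hx0]
    field_simp
  rw [sub_mul, one_mul, ← h1, obsSeries, obsSeries, ← hs.tsum_sub hs1, ← tsum_mul_left]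
  refine tsum_congr fun l => ?_
  rw [obs_add_one hq0 hq1 hζ, mul_zpow]
  ring

/-- At `x = q` the same recurrence makes the series telescope, with `obs` tending to `0` at `-∞` and
to `1` at `+∞`. -/
lemma obsSeries_q (hq0 : 0 < q) (hq1 : q < 1) {ζ : ℂ}
    (hζ : ∀ x : ℝ, 0 ≤ x → ζ ≠ x) : ζ * obsSeries q ζ q = -1 := by
  have hqc : (q : ℂ) ≠ 0 := by exact_mod_cast hq0.ne'
  have hs := summable_obs_mul_zpow hq0 hq1 hζ hqc (by simpa [abs_of_pos hq0] using hq1)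
  have h1 : HasSum (fun l : ℤ => obs q ζ l - obs q ζ (l + 1)) (ζ * obsSeries q ζ q) := by
    refine hasSum_of_eq (hs.hasSum.mul_left ζ) (fun l => ?_) rfl
    rw [obs_add_one hq0 hq1 hζ]
    ring
  have h2 : Tendsto (fun N : ℕ => ∑ l ∈ Finset.Ico (-(N : ℤ)) N, (obs q ζ l - obs q ζ (l + 1)))
      atTop (𝓝 (ζ * obsSeries q ζ q)) := h1.comp Finset.tendsto_Ico_neg
  have h3 : ∀ N : ℕ, ∑ l ∈ Finset.Ico (-(N : ℤ)) N, (obs q ζ l - obs q ζ (l + 1)) =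
      obs q ζ (-(N : ℤ)) - obs q ζ N := by
    intro N
    induction N with
    | zero => simp
    | succ N ih =>
      have e1 : Finset.Ico (-((N + 1 : ℕ) : ℤ)) ((N + 1 : ℕ) : ℤ) =
          insert (-((N : ℤ) + 1)) (insert (N : ℤ) (Finset.Ico (-(N : ℤ)) N)) := by
        ext x
        simp only [Finset.mem_Ico, Finset.mem_insert]
        omega
      rw [e1, Finset.sum_insert, Finset.sum_insert, ih]
      · push_cast
        rw [show -((N : ℤ) + 1) + 1 = -(N : ℤ) by ring]
        ring_nf
      · simp
      · simp only [Finset.mem_insert, Finset.mem_Ico]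
        omega
  have h4 : Tendsto (fun N : ℕ => obs q ζ (-(N : ℤ))) atTop (𝓝 0) := by
    have hinj : Function.Injective fun N : ℕ => -(N : ℤ) := fun a b h => by simpa using h
    have h5 := (hs.comp_injective hinj).tendsto_atTop_zero
    refine squeeze_zero_norm (fun N => ?_) (tendsto_norm_zero.comp h5)
    simp only [Function.comp, norm_mul, norm_zpow, Complex.norm_real, Real.norm_of_nonneg hq0.le]
    refine le_mul_of_one_le_right (norm_nonneg _) ?_
    rw [zpow_neg, zpow_natCast]
    exact (one_le_inv₀ (by positivity)).2 (pow_le_one₀ hq0.le hq1.le)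
  have h6 := h4.sub (tendsto_obs_atTop hq0 hq1 ζ)
  simp only [h3] at h2
  rw [tendsto_nhds_unique h2 h6, zero_sub]

/-- The product `(q^{-u}; q)_∞ ∑_l q^{-ul} / (ζ q^l; q)_∞`. -/
def obsProd (q : ℝ) (ζ u : ℂ) : ℂ := qPochInf ((q : ℂ) ^ (-u)) q * obsSeries q ζ ((q : ℂ) ^ (-u))

lemma norm_cpow_neg_lt_one (hq0 : 0 < q) (hq1 : q < 1) {u : ℂ} (hu : u.re < 0) :
    ‖(q : ℂ) ^ (-u)‖ < 1 := by
  rw [norm_cpow_eq hq0, Complex.neg_re]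
  exact Real.rpow_lt_one hq0.le hq1 (neg_pos.2 hu)

lemma differentiableOn_obsProd (hq0 : 0 < q) (hq1 : q < 1) {ζ : ℂ}
    (hζ : ∀ x : ℝ, 0 ≤ x → ζ ≠ x) : DifferentiableOn ℂ (obsProd q ζ) {u | u.re < 0} := by
  have h := (differentiable_cpow hq0).comp differentiable_neg
  refine ((differentiable_qPochInf hq0 hq1).comp h).differentiableOn.mul ?_
  refine (differentiableOn_obsSeries hq0 hq1 hζ).comp h.differentiableOn fun u hu => ?_
  exact ⟨cpow_ne_zero hq0 _, norm_cpow_neg_lt_one hq0 hq1 hu⟩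

lemma obsProd_add_qPeriod (hq0 : 0 < q) (hq1 : q < 1) (ζ u : ℂ) :
    obsProd q ζ (u + qPeriod q) = obsProd q ζ u := by
  have h := cpow_add_int_mul_qPeriod hq0 hq1 (-u) (-1)
  have h2 : (q : ℂ) ^ (-(u + qPeriod q)) = (q : ℂ) ^ (-u) := by
    rw [← h]; congr 1; push_cast; ring
  rw [obsProd, obsProd, h2]

/-- With `x = q^{-u}`, the prefactor `(x;q)_∞ = (1 - x)(xq;q)_∞` absorbs the factor `1 - x⁻¹` of
`obsSeries_mul`, leaving the functional equation of `mellinPeriodization`. -/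
lemma obsProd_sub_one (hq0 : 0 < q) (hq1 : q < 1) {ζ : ℂ}
    (hζ : ∀ x : ℝ, 0 ≤ x → ζ ≠ x) {u : ℂ} (hu : u.re < 0) :
    obsProd q ζ (u - 1) = -ζ⁻¹ * (q : ℂ) ^ u * obsProd q ζ u := by
  have hζ0 := ne_zero_of_slit hζ
  have hx0 := cpow_ne_zero hq0 (-u)
  have h1 := obsSeries_mul hq0 hq1 hζ hx0 (norm_cpow_neg_lt_one hq0 hq1 hu)
  have h2 := qPochInf_eq hq0 hq1 ((q : ℂ) ^ (-u))
  have h3 : (q : ℂ) ^ (-(u - 1)) = (q : ℂ) ^ (-u) * q := by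
    rw [show -(u - 1) = -u + 1 by ring, cpow_add' hq0, Complex.cpow_one]
  have h4 : (q : ℂ) ^ u = ((q : ℂ) ^ (-u))⁻¹ := by rw [Complex.cpow_neg, inv_inv]
  rw [obsProd, obsProd, h3, h2, h4]
  set x := (q : ℂ) ^ (-u)
  apply mul_left_cancel₀ hζ0
  rw [mul_left_comm, h1]
  field_simp
  ring

lemma obsProd_neg_one (hq0 : 0 < q) (hq1 : q < 1) {ζ : ℂ}
    (hζ : ∀ x : ℝ, 0 ≤ x → ζ ≠ x) : obsProd q ζ (-1) = -ζ⁻¹ * qPochInf q q := by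
  have h := obsSeries_q hq0 hq1 hζ
  have hζ0 := ne_zero_of_slit hζ
  rw [obsProd, neg_neg, Complex.cpow_one]
  apply mul_left_cancel₀ hζ0
  rw [mul_left_comm, h]
  field_simp

/-- The Mellin–Barnes form of the bilateral series: the periodization of the Mellin kernel. -/
theorem mellinPeriodization_eq (hq0 : 0 < q) (hq1 : q < 1) {ζ : ℂ}
    (hζ : ∀ x : ℝ, 0 ≤ x → ζ ≠ x) {σ : ℝ} (hσ : σ < 0) (x : ℝ) :
    mellinPeriodization q ζ (σ + qPeriod q * x) =
      qPochInf q q * Real.log q * obsProd q ζ (σ + qPeriod q * x) := by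
  have hζ0 := ne_zero_of_slit hζ
  have hqq : qPochInf q q ≠ 0 :=
    qPochInf_ne_zero_of_norm_lt hq0 hq1 (by simpa [abs_of_pos hq0] using hq1)
  set G := mellinPeriodization q ζ with hG
  set Φ := obsProd q ζ with hΦ
  have hGd : DifferentiableOn ℂ G {u | u.re < 0} :=
    (differentiable_mellinPeriodization hq0 hq1 hζ).differentiableOn
  have hΦd : DifferentiableOn ℂ Φ {u | u.re < 0} := differentiableOn_obsProd hq0 hq1 hζ
  have hGp : ∀ u : ℂ, u.re < 0 → G (u + qPeriod q) = G u := fun u _ =>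
    mellinPeriodization_add_qPeriod q ζ u
  have hΦp : ∀ u : ℂ, u.re < 0 → Φ (u + qPeriod q) = Φ u := fun u _ =>
    obsProd_add_qPeriod hq0 hq1 ζ u
  have hline : ∀ s : ℝ, Continuous fun x : ℝ => ((s : ℂ) + qPeriod q * x) := fun s => by fun_prop
  have hint : ∀ (F : ℂ → ℂ), DifferentiableOn ℂ F {u | u.re < 0} → ∀ s : ℝ, s < 0 →
      IntervalIntegrable (fun x : ℝ => F (s + qPeriod q * x)) volume 0 1 := by
    intro F hF s hs
    refine (hF.continuousOn.comp_continuous (hline s) fun x => ?_).intervalIntegrable _ _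
    change Complex.re _ < 0
    rwa [line_re]
  set g₀ : ℂ := ∫ x in (0 : ℝ)..1, G (((-1 : ℝ) : ℂ) + qPeriod q * x) with hg₀
  set φ₀ : ℂ := ∫ x in (0 : ℝ)..1, Φ (((-1 : ℝ) : ℂ) + qPeriod q * x) with hφ₀
  -- The combination `g₀ Φ - φ₀ G` has zero mean over a period, so it vanishes and the two functions
  -- are proportional. The mean `φ₀` is nonzero because otherwise `Φ` would vanish at `-1`, where
  -- its value is known.
  have key : ∀ s : ℝ, s < 0 → ∀ x : ℝ,
      g₀ * Φ (s + qPeriod q * x) - φ₀ * G (s + qPeriod q * x) = 0 := by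
    intro s hs x
    refine eq_zero_of_quasiPeriodic hq0 hq1 hζ0 (D := fun u => g₀ * Φ u - φ₀ * G u)
      ((hΦd.const_mul _).sub (hGd.const_mul _)) ?_ ?_ hs ?_ x
    · intro u hu
      simp only [hGp u hu, hΦp u hu]
    · intro u hu
      simp only [hG, hΦ, obsProd_sub_one hq0 hq1 hζ hu, mellinPeriodization_sub_one hq0 hq1 hζ0]
      ring
    · rw [intervalIntegral.integral_sub ((hint Φ hΦd s hs).const_mul _)
        ((hint G hGd s hs).const_mul _), intervalIntegral.integral_const_mul,
        intervalIntegral.integral_const_mul, integral_period_eq hq0 hq1 hΦd hΦp hs (by norm_num :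
          (-1 : ℝ) < 0), integral_period_eq hq0 hq1 hGd hGp hs (by norm_num : (-1 : ℝ) < 0)]
      simp only [← hg₀, ← hφ₀]
      ring
  have hΦ1 : Φ (-1) = -ζ⁻¹ * qPochInf q q := obsProd_neg_one hq0 hq1 hζ
  have hG1 : G (-1) = -ζ⁻¹ * (qPochInf q q ^ 2 * Real.log q) :=
    mellinPeriodization_neg_one hq0 hq1 ζ
  have hφ0 : φ₀ ≠ 0 := by
    intro h0
    have := eq_zero_of_quasiPeriodic hq0 hq1 hζ0 hΦd hΦp
      (fun u hu => obsProd_sub_one hq0 hq1 hζ hu) (by norm_num : (-1 : ℝ) < 0) h0 0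
    rw [Complex.ofReal_zero, mul_zero, add_zero, Complex.ofReal_neg, Complex.ofReal_one, hΦ1] at this
    exact mul_ne_zero (neg_ne_zero.2 (inv_ne_zero hζ0)) hqq this
  have h1 := key (-1) (by norm_num) 0
  rw [Complex.ofReal_zero, mul_zero, add_zero, Complex.ofReal_neg, Complex.ofReal_one, hΦ1,
    hG1] at h1
  have hg : g₀ = φ₀ * (qPochInf q q * Real.log q) := by
    apply mul_right_cancel₀ (mul_ne_zero (neg_ne_zero.2 (inv_ne_zero hζ0)) hqq)
    linear_combination h1
  have h2 := key σ hσ x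
  apply mul_left_cancel₀ hφ0
  rw [hg] at h2
  linear_combination -h2

end Observable

/-! ### Unfolding a periodization and termwise torus integration. -/

section Interchange

/-- A continuous function on the line whose translates are summably bounded on the unit interval is
integrable, and its integral is that of its periodization. -/
lemma integrable_and_integral_eq_of_summable_bound {f : ℝ → ℂ} (hf : Continuous f) {b : ℤ → ℝ}
    (hb : Summable b) (h : ∀ (k : ℤ), ∀ x ∈ Icc (0 : ℝ) 1, ‖f (x + k)‖ ≤ b k) :
    Integrable f ∧ ∫ x, f x = ∫ x in (0 : ℝ)..1, ∑' k : ℤ, f (x + k) := by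
  have hb0 : ∀ k, 0 ≤ b k := fun k => (norm_nonneg _).trans (h k 0 (by simp))
  have hint : Integrable f := by
    refine Real.integrable_of_summable_norm_Icc (f := ⟨f, hf⟩)
      (hb.of_nonneg_of_le (fun _ => norm_nonneg _) fun k => ?_)
    rw [ContinuousMap.norm_le _ (hb0 k)]
    rintro ⟨x, hx⟩
    exact h k x hx
  refine ⟨hint, hint.hasSum_intervalIntegral_comp_add_int.unique ?_⟩
  have hI : ∀ {t : ℝ}, t ∈ uIoc (0 : ℝ) 1 → t ∈ Icc (0 : ℝ) 1 := fun ht => by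
    rw [uIoc_of_le zero_le_one] at ht
    exact Ioc_subset_Icc_self ht
  refine intervalIntegral.hasSum_integral_of_dominated_convergence (fun k _ => b k)
    (fun k => (by fun_prop : Continuous fun x : ℝ => f (x + k)).aestronglyMeasurable)
    (fun k => .of_forall fun x hx => h k x (hI hx)) (.of_forall fun _ _ => hb)
    intervalIntegrable_const (.of_forall fun x hx => ?_)
  exact (Summable.of_norm_bounded hb fun k => h k x (hI hx)).hasSum

/-- Termwise integration over a torus. -/
lemma hasSum_torusIntegral {ι : Type*} [Countable ι] {n : ℕ} {F : ι → (Fin n → ℂ) → ℂ}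
    {G h : (Fin n → ℂ) → ℂ} {R : Fin n → ℝ} {b : ι → ℝ}
    (hF : ∀ i, Continuous fun θ => F i (torusMap 0 R θ))
    (hh : Continuous fun θ => h (torusMap 0 R θ)) (hb : Summable b)
    (hFb : ∀ i θ, ‖F i (torusMap 0 R θ)‖ ≤ b i)
    (hG : ∀ θ, HasSum (fun i => F i (torusMap 0 R θ)) (G (torusMap 0 R θ))) :
    HasSum (fun i => torusIntegral (fun z => F i z * h z) 0 R)
      (torusIntegral (fun z => G z * h z) 0 R) := by
  have hj : Continuous fun θ : Fin n → ℝ =>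
      (∏ i, (R i : ℂ) * Complex.exp (θ i * Complex.I) * Complex.I) := by
    refine continuous_finsetProd _ fun i _ => by fun_prop
  simp only [torusIntegral, smul_eq_mul]
  refine hasSum_integral_of_dominated_convergence
    (fun i θ => b i * ‖(∏ i, (R i : ℂ) * Complex.exp (θ i * Complex.I) * Complex.I) *
      h (torusMap 0 R θ)‖) (fun i => ?_) (fun i => .of_forall fun θ => ?_)
    (.of_forall fun θ => hb.mul_right _) ?_ (.of_forall fun θ => ?_)
  · exact (hj.mul ((hF i).mul hh)).aestronglyMeasurable
  · rw [mul_left_comm, norm_mul]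
    exact mul_le_mul_of_nonneg_right (hFb i θ) (norm_nonneg _)
  · simp only [tsum_mul_right]
    exact (((hj.mul hh).norm.const_mul _).continuousOn).integrableOn_compact isCompact_Icc
  · refine hasSum_of_eq ((hG θ).mul_right
      ((∏ i, (R i : ℂ) * Complex.exp (θ i * Complex.I) * Complex.I) * h (torusMap 0 R θ)))
      (fun i => ?_) ?_ <;> ring

end Interchange

/-! ### Holomorphy of the integrands and the expectation as a torus integral. -/

section Density

variable {q : ℝ} {n : ℕ}

lemma differentiableOn_finset_prod {E ι : Type*} [NormedAddCommGroup E] [NormedSpace ℂ E]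
    {s : Set E} {u : Finset ι} {f : ι → E → ℂ} (h : ∀ i ∈ u, DifferentiableOn ℂ (f i) s) :
    DifferentiableOn ℂ (fun x => ∏ i ∈ u, f i x) s := by
  classical
  induction u using Finset.induction_on with
  | empty => simp
  | insert i u hi ih =>
    simp only [Finset.prod_insert hi]
    exact (h i (by simp)).mul (ih fun j hj => h j (by simp [hj]))

lemma ne_zero_of_mem_extDomain {ρ : ℝ} (hρ : 0 ≤ ρ) {z : Fin n → ℂ} (hz : z ∈ extDomain n ρ)
    (i : Fin n) : z i ≠ 0 :=
  norm_pos_iff.1 (hρ.trans_lt (hz i))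

lemma norm_div_lt_one_of_mem_extDomain {ρ : ℝ} (hρ : 0 ≤ ρ) {z : Fin n → ℂ}
    (hz : z ∈ extDomain n ρ) {c : ℂ} (hc : ‖c‖ ≤ ρ) (j : Fin n) : ‖c / z j‖ < 1 := by
  rw [norm_div, div_lt_one (hρ.trans_lt (hz j))]
  exact hc.trans_lt (hz j)

lemma differentiableOn_apply (i : Fin n) (s : Set (Fin n → ℂ)) :
    DifferentiableOn ℂ (fun z : Fin n → ℂ => z i) s :=
  (differentiable_apply i).differentiableOn

/-- The product of the `1 / (c_i / z_j; q)_∞` is holomorphic where all `|z_j|` are large. -/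
lemma differentiableOn_prod_inv_qPochInf (hq0 : 0 < q) (hq1 : q < 1) {ρ : ℝ} (hρ : 0 ≤ ρ)
    {m : ℕ} {c : Fin m → ℂ} (hc : ∀ i, ‖c i‖ ≤ ρ) :
    DifferentiableOn ℂ (fun z : Fin n → ℂ => ∏ i, ∏ j, (qPochInf (c i / z j) q)⁻¹)
      (extDomain n ρ) := by
  refine differentiableOn_finset_prod fun i _ => differentiableOn_finset_prod fun j _ => ?_
  refine DifferentiableOn.inv ?_ fun z hz =>
    qPochInf_ne_zero_of_norm_lt hq0 hq1 (norm_div_lt_one_of_mem_extDomain hρ hz (hc i) j)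
  refine (differentiable_qPochInf hq0 hq1).comp_differentiableOn ?_
  simp only [div_eq_mul_inv]
  exact ((differentiableOn_apply j _).inv fun z hz => ne_zero_of_mem_extDomain hρ hz j).const_mul _

lemma differentiableOn_PiFn (hq0 : 0 < q) (hq1 : q < 1) {ρ : ℝ} (hρ : 0 ≤ ρ) {u : Fin n → ℂ}
    (hu : ∀ i, ‖u i‖ ≤ ρ) (t : ℝ) :
    DifferentiableOn ℂ (fun z : Fin n → ℂ => PiFn q z u t) (extDomain n ρ) := by
  unfold PiFn
  refine (differentiableOn_prod_inv_qPochInf hq0 hq1 hρ hu).mul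
    (differentiableOn_finset_prod fun j _ => ?_)
  exact ((differentiableOn_apply j _).mul_const _).cexp

lemma differentiableOn_sklyanin (hq0 : 0 < q) (hq1 : q < 1) {ρ : ℝ} (hρ : 0 ≤ ρ) :
    DifferentiableOn ℂ (sklyanin q : (Fin n → ℂ) → ℂ) (extDomain n ρ) := by
  unfold sklyanin
  have h : ∀ i j : Fin n, DifferentiableOn ℂ (fun z : Fin n → ℂ => qPochInf (z i / z j) q)
      (extDomain n ρ) := fun i j =>
    (differentiable_qPochInf hq0 hq1).comp_differentiableOn <| by
      simp only [div_eq_mul_inv]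
      exact (differentiableOn_apply i _).mul
        ((differentiableOn_apply j _).inv fun z hz => ne_zero_of_mem_extDomain hρ hz j)
  exact (differentiableOn_finset_prod fun i _ => differentiableOn_finset_prod fun j _ =>
    (h i j).mul (h j i)).const_mul _

lemma differentiableOn_whittakerP (q : ℝ) : ∀ {n : ℕ} (lam : Fin n → ℤ),
    DifferentiableOn ℂ (whittakerP q n lam) {x | ∀ i, x i ≠ 0}
  | 0, lam => by
    have h : whittakerP (q : ℂ) 0 lam = fun _ => 1 := funext fun x => by rw [whittakerP]
    rw [h]
    fun_prop
  | n + 1, lam => by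
    have h : whittakerP (q : ℂ) (n + 1) lam = fun x => ∑ mu ∈ rowBox lam,
        (psi q lam mu : ℂ) * x (Fin.last n) ^ (∑ i, lam i - ∑ i, mu i) *
          whittakerP q n mu (fun i => x i.castSucc) := funext fun x => whittakerP_succ lam x
    rw [h]
    refine DifferentiableOn.fun_sum fun mu _ => ?_
    refine (((differentiableOn_apply (Fin.last n) {x | ∀ i, x i ≠ 0}).zpow
      (Or.inl fun x hx => hx (Fin.last n))).const_mul _).mul ?_
    refine (differentiableOn_whittakerP q mu).comp ?_ fun x hx i => hx i.castSucc
    exact (differentiable_pi.2 fun i => differentiable_apply i.castSucc).differentiableOn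

lemma differentiableOn_whittakerP_inv {ρ : ℝ} (hρ : 0 ≤ ρ) (lam : Fin n → ℤ) :
    DifferentiableOn ℂ (fun z => whittakerP (q : ℂ) n lam fun i => 1 / z i) (extDomain n ρ) := by
  refine (differentiableOn_whittakerP q lam).comp ?_ fun z hz i => ?_
  · refine differentiableOn_pi.2 fun i => ?_
    simp only [one_div]
    exact (differentiableOn_apply i _).inv fun z hz => ne_zero_of_mem_extDomain hρ hz i
  · exact one_div_ne_zero (ne_zero_of_mem_extDomain hρ hz i)

lemma differentiableOn_prod_inv {ρ : ℝ} (hρ : 0 ≤ ρ) :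
    DifferentiableOn ℂ (fun z : Fin n → ℂ => ∏ i, 1 / z i) (extDomain n ρ) := by
  refine differentiableOn_finset_prod fun i _ => ?_
  simp only [one_div]
  exact (differentiableOn_apply i _).inv fun z hz => ne_zero_of_mem_extDomain hρ hz i

/-- The density of the torus integrals, with respect to `∏ dz_i`. -/
def density (q : ℝ) (u : Fin n → ℂ) (t : ℝ) (z : Fin n → ℂ) : ℂ :=
  (∏ i, 1 / z i) * (PiFn q z u t * sklyanin q z)

lemma differentiableOn_density (hq0 : 0 < q) (hq1 : q < 1) {ρ : ℝ} (hρ : 0 ≤ ρ) {u : Fin n → ℂ}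
    (hu : ∀ i, ‖u i‖ ≤ ρ) (t : ℝ) : DifferentiableOn ℂ (density q u t) (extDomain n ρ) :=
  (differentiableOn_prod_inv hρ).mul
    ((differentiableOn_PiFn hq0 hq1 hρ hu t).mul (differentiableOn_sklyanin hq0 hq1 hρ))

/-- The dual function as an integral over any torus with large radii. -/
lemma whittakerQ_eq (hq0 : 0 < q) (hq1 : q < 1) {ρ : ℝ} (hρ : 0 ≤ ρ) (hρ1 : ρ < 1)
    {u : Fin (n + 1) → ℂ} (hu : ∀ i, ‖u i‖ ≤ ρ) (t : ℝ) {R : Fin (n + 1) → ℝ} (hR : ∀ i, ρ < R i)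
    {lam : Fin (n + 1) → ℤ} (hlam : Antitone lam) :
    whittakerQ q lam u t = qPochInf q q ^ n *
      ((∏ j : Fin n, qg q (lam j.castSucc - lam j.succ) : ℝ) : ℂ) *
        torusIntegral (fun z => whittakerP q (n + 1) lam (fun i => 1 / z i) * density q u t z)
          0 R := by
  have h1 : (∏ i : Fin n, qPochInf ((q : ℂ) ^ (lam i.castSucc - lam i.succ + 1)) q) =
      qPochInf q q ^ n * ((∏ j : Fin n, qg q (lam j.castSucc - lam j.succ) : ℝ) : ℂ) := by
    have : ∀ i : Fin n, qPochInf ((q : ℂ) ^ (lam i.castSucc - lam i.succ + 1)) q =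
        qPochInf q q * (qg q (lam i.castSucc - lam i.succ) : ℂ) := fun i =>
      qPochInf_zpow_succ hq0 hq1 (sub_nonneg.2 (hlam (Fin.castSucc_lt_succ).le))
    rw [Finset.prod_congr rfl fun i _ => this i, Finset.prod_mul_distrib, Finset.prod_const,
      Finset.card_univ, Fintype.card_fin]
    push_cast
    rfl
  have h2 : torusIntegral (fun z => whittakerP q (n + 1) lam (fun i => 1 / z i) *
      density q u t z) 0 (fun _ => 1) = torusIntegral (fun z =>
        whittakerP q (n + 1) lam (fun i => 1 / z i) * density q u t z) 0 R :=
    torusIntegral_eq_of_differentiableOn_ext hρ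
      ((differentiableOn_whittakerP_inv hρ lam).mul (differentiableOn_density hq0 hq1 hρ hu t))
      (fun _ => hρ1) hR
  rw [whittakerQ, h1, ← h2]
  congr 1
  refine torusIntegral_congr_on fun θ => ?_
  simp only [density]
  ring

instance (N : ℕ) : Countable (Signature N) :=
  inferInstanceAs (Countable {lam : Fin N → ℤ // Antitone lam})

lemma norm_prod_mul_prod_lt_one {x y : Fin (n + 1) → ℂ} (hx : ∀ i, x i ≠ 0) (hy : ∀ i, y i ≠ 0)
    (hxy : ∀ i j, ‖x i * y j‖ < 1) : ‖(∏ i, x i) * ∏ i, y i‖ < 1 := by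
  rw [← Finset.prod_mul_distrib, norm_prod]
  calc ∏ i, ‖x i * y i‖ < ∏ _i : Fin (n + 1), (1 : ℝ) :=
      Finset.prod_lt_prod_of_nonempty (fun i _ => norm_pos_iff.2 (mul_ne_zero (hx i) (hy i)))
        (fun i _ => hxy i i) Finset.univ_nonempty
    _ = 1 := by simp

/-- The generating function of the `1 / (ζ q^{λ_N}; q)_∞` against two `q`-Whittaker functions. -/
def cauchySum (q : ℝ) (ζ : ℂ) (x y : Fin (n + 1) → ℂ) : ℂ :=
  obsSeries q ζ ((∏ i, x i) * ∏ i, y i) *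
    (qPochInf ((∏ i, x i) * ∏ i, y i) q * ∏ i, ∏ j, (qPochInf (x i * y j) q)⁻¹)

/-- The expectation of the observable as a torus integral. -/
lemma hasSum_obs_mul_weight (hq0 : 0 < q) (hq1 : q < 1) {a α : Fin (n + 1) → ℝ} {t : ℝ} {ζ : ℂ}
    (hζ : ∀ x : ℝ, 0 ≤ x → ζ ≠ x) {ρ : ℝ} (hρ : 0 ≤ ρ) (hρ1 : ρ < 1)
    (hα : ∀ i, ‖qPow q α i‖ ≤ ρ) {R : Fin (n + 1) → ℝ} (hR : ∀ i, ρ < R i)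
    (haR : ∀ i j, q ^ a i < R j) :
    HasSum (fun lam : Signature (n + 1) => obs q ζ (lam.1 (Fin.last n)) * weight q a α t lam)
      (qPochInf q q ^ n / PiFn q (qPow q a) (qPow q α) t *
        torusIntegral (fun z => cauchySum q ζ (qPow q a) (fun i => 1 / z i) *
          density q (qPow q α) t z) 0 R) := by
  have hR0 : ∀ i, 0 < R i := fun i => hρ.trans_lt (hR i)
  have ha0 : ∀ i, 0 < q ^ a i := fun i => Real.rpow_pos_of_pos hq0 _
  have hx : ∀ i, qPow q a i ≠ 0 := fun i => by
    simp only [qPow]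
    exact_mod_cast (ha0 i).ne'
  have hnx : ∀ i, ‖qPow q a i‖ = q ^ a i := fun i => by
    simp only [qPow, Complex.norm_real, Real.norm_of_nonneg (ha0 i).le]
  set c : Signature (n + 1) → ℂ := fun lam => obs q ζ (lam.1 (Fin.last n)) *
    ((∏ j : Fin n, qg q (lam.1 j.castSucc - lam.1 j.succ) : ℝ) : ℂ) *
      whittakerP q (n + 1) lam.1 (qPow q a) with hc
  have hzn : ∀ θ i, ‖torusMap 0 R θ i‖ = R i := fun θ i => by
    rw [norm_torusMap_zero, abs_of_pos (hR0 i)]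
  have hz0 : ∀ θ i, torusMap 0 R θ i ≠ 0 := fun θ i => by
    rw [← norm_pos_iff, hzn]; exact hR0 i
  have hsum : HasSum (fun lam => torusIntegral (fun z =>
      (c lam * whittakerP q (n + 1) lam.1 fun i => 1 / z i) * density q (qPow q α) t z) 0 R)
      (torusIntegral (fun z => cauchySum q ζ (qPow q a) (fun i => 1 / z i) *
          density q (qPow q α) t z) 0 R) := by
    -- On the torus `|1/z_i| = 1/R_i` is constant, so the value of `P_λ` at the moduli bounds the
    -- terms uniformly; `hasSum_signature` at `y_i = 1/R_i` shows that the bounds are summable.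
    refine hasSum_torusIntegral
      (b := fun lam => ‖c lam * whittakerP q (n + 1) lam.1 fun i => ((1 / R i : ℝ) : ℂ)‖)
      (fun lam => ?_) ?_ ?_ (fun lam θ => ?_) (fun θ => ?_)
    · exact continuous_comp_torusMap
        ((differentiableOn_whittakerP_inv hρ lam.1).const_mul _).continuousOn hR
    · exact continuous_comp_torusMap
        (differentiableOn_density hq0 hq1 hρ hα t).continuousOn hR
    · set y : Fin (n + 1) → ℂ := fun i => ((1 / R i : ℝ) : ℂ) with hy
      have hy0 : ∀ i, y i ≠ 0 := fun i => by
        simp only [hy]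
        exact_mod_cast (one_div_pos.2 (hR0 i)).ne'
      have hxy : ∀ i j, ‖qPow q a i * y j‖ < 1 := fun i j => by
        rw [norm_mul, hnx, hy, Complex.norm_real, Real.norm_of_nonneg (one_div_pos.2 (hR0 j)).le,
          mul_one_div, div_lt_one (hR0 j)]
        exact haR i j
      have hs := summable_obs_mul_zpow hq0 hq1 hζ
        (mul_ne_zero (Finset.prod_ne_zero_iff.2 fun i _ => hx i)
          (Finset.prod_ne_zero_iff.2 fun i _ => hy0 i)) (norm_prod_mul_prod_lt_one hx hy0 hxy)
      exact (hasSum_signature hq0 hq1 (qPow q a) y hx hy0 hxy hs.hasSum).summable.norm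
    · rw [norm_mul (c lam), norm_mul (c lam)]
      refine mul_le_mul_of_nonneg_left ?_ (norm_nonneg (c lam))
      refine (whittakerP_abs hq0 hq1 lam.1 fun i => 1 / torusMap 0 R θ i).2.trans_eq ?_
      simp only [norm_div, norm_one, hzn]
    · set y : Fin (n + 1) → ℂ := fun i => 1 / torusMap 0 R θ i with hy
      have hy0 : ∀ i, y i ≠ 0 := fun i => one_div_ne_zero (hz0 θ i)
      have hxy : ∀ i j, ‖qPow q a i * y j‖ < 1 := fun i j => by
        rw [norm_mul, hnx, hy, norm_div, norm_one, hzn, mul_one_div, div_lt_one (hR0 j)]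
        exact haR i j
      have hs := summable_obs_mul_zpow hq0 hq1 hζ
        (mul_ne_zero (Finset.prod_ne_zero_iff.2 fun i _ => hx i)
          (Finset.prod_ne_zero_iff.2 fun i _ => hy0 i)) (norm_prod_mul_prod_lt_one hx hy0 hxy)
      exact hasSum_signature hq0 hq1 (qPow q a) y hx hy0 hxy hs.hasSum
  refine hasSum_of_eq (hsum.mul_left (qPochInf q q ^ n / PiFn q (qPow q a) (qPow q α) t))
    (fun lam => ?_) rfl
  have h1 : torusIntegral (fun z => (c lam * whittakerP q (n + 1) lam.1 fun i => 1 / z i) *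
      density q (qPow q α) t z) 0 R = c lam * torusIntegral (fun z =>
        whittakerP q (n + 1) lam.1 (fun i => 1 / z i) * density q (qPow q α) t z) 0 R := by
    rw [← smul_eq_mul, ← torusIntegral_smul]
    refine torusIntegral_congr_on fun θ => ?_
    simp only [smul_eq_mul]
    ring
  rw [h1, weight, whittakerQ_eq hq0 hq1 hρ hρ1 hα t hR lam.2, hc]
  ring

end Density

/-! ### From the torus to the vertical line. -/

section Contour

variable {q : ℝ} {n : ℕ}

/-- A circle integral about the origin as an integral over a vertical period. -/
lemma circleIntegral_eq_integral_period (hq0 : 0 < q) (hq1 : q < 1) (σ : ℝ) (g : ℂ → ℂ) :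
    (∮ W in C(0, q ^ σ), g W) = 2 * Real.pi * Complex.I *
      ∫ x in (0 : ℝ)..1, (q : ℂ) ^ (σ + qPeriod q * x) * g ((q : ℂ) ^ (σ + qPeriod q * x)) := by
  have h2 : (2 * Real.pi : ℝ) ≠ 0 := by positivity
  have h := intervalIntegral.integral_comp_mul_left (a := 0) (b := 1)
    (fun θ : ℝ => deriv (circleMap 0 (q ^ σ)) θ • g (circleMap 0 (q ^ σ) θ)) h2
  rw [mul_zero, mul_one] at h
  have h3 : (∮ W in C(0, q ^ σ), g W) = (2 * Real.pi : ℝ) • ∫ x in (0 : ℝ)..1,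
      deriv (circleMap 0 (q ^ σ)) (2 * Real.pi * x) • g (circleMap 0 (q ^ σ) (2 * Real.pi * x)) := by
    rw [h, smul_smul, mul_inv_cancel₀ h2, one_smul, circleIntegral]
  rw [h3, Complex.real_smul, mul_assoc, ← intervalIntegral.integral_const_mul Complex.I]
  push_cast
  congr 1
  refine intervalIntegral.integral_congr fun x _ => ?_
  have h4 : circleMap 0 (q ^ σ) (2 * Real.pi * x) = (q : ℂ) ^ (σ + qPeriod q * x) := by
    rw [cpow_add' hq0, cpow_mul_qPeriod hq0 hq1, circleMap_zero, Complex.ofReal_cpow hq0.le]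
    push_cast
    ring_nf
  simp only [deriv_circleMap, h4, smul_eq_mul]
  ring

lemma prod_qPow (hq0 : 0 < q) (a : Fin n → ℝ) :
    ∏ i, qPow q a i = (q : ℂ) ^ (∑ j, (a j : ℂ)) := by
  simp only [qPow, Complex.ofReal_cpow hq0.le, cpow_eq_exp hq0, ← Complex.exp_sum, Finset.mul_sum]

lemma prod_inv_point (q : ℝ) (s : ℂ) {v : Fin n → ℂ} (hv : ∀ i, v i ≠ 0) :
    ∏ i, 1 / point q s v i = 1 / (q : ℂ) ^ s := by
  have h : ∏ i, v i ≠ 0 := Finset.prod_ne_zero_iff.2 fun i _ => hv i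
  rw [Fin.prod_univ_succ]
  simp only [point, Fin.cons_zero, Fin.cons_succ, Finset.prod_div_distrib, Finset.prod_const_one]
  field_simp

lemma PiFn_ne_zero (hq0 : 0 < q) (hq1 : q < 1) {z u : Fin n → ℂ} (h : ∀ i j, ‖u i / z j‖ < 1)
    (t : ℝ) : PiFn q z u t ≠ 0 :=
  mul_ne_zero (Finset.prod_ne_zero_iff.2 fun i _ => Finset.prod_ne_zero_iff.2 fun j _ =>
    inv_ne_zero (qPochInf_ne_zero_of_norm_lt hq0 hq1 (h i j)))
    (Finset.prod_ne_zero_iff.2 fun _ _ => Complex.exp_ne_zero _)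

/-- At `point q s v` the product of the coordinates is `q^s`, so the argument of the bilateral
series is `q^{-(s-A)}` and `obsProd` comes out of the `v`-integral. The factor `(q^s)⁻¹` cancels
against `dW` for `W = q^s`. -/
lemma cauchySum_mul_density_point (hq0 : 0 < q) (a α : Fin (n + 1) → ℝ) (t : ℝ) (ζ s : ℂ)
    (hP : PiFn q (qPow q a) (qPow q α) t ≠ 0) {v : Fin n → ℂ} (hv : ∀ i, v i ≠ 0) :
    cauchySum q ζ (qPow q a) (fun i => 1 / point q s v i) * density q (qPow q α) t (point q s v) /
      ∏ j, v j = (PiFn q (qPow q a) (qPow q α) t * ((q : ℂ) ^ s)⁻¹ *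
        obsProd q ζ (s - ∑ j, (a j : ℂ))) * innerIntegrand q a α t s v := by
  have hX : (∏ i, qPow q a i) * ∏ i, 1 / point q s v i =
      (q : ℂ) ^ (-(s - ∑ j, (a j : ℂ))) := by
    rw [prod_qPow hq0, prod_inv_point q s hv, neg_sub, sub_eq_add_neg, cpow_add' hq0,
      Complex.cpow_neg, one_div]
  have h : ∏ i, v i ≠ 0 := Finset.prod_ne_zero_iff.2 fun i _ => hv i
  have hs := cpow_ne_zero hq0 s
  simp only [cauchySum, hX]
  simp only [density, innerIntegrand, obsProd, prod_inv_point q s hv, mul_one_div,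
    Finset.prod_div_distrib, Finset.prod_const_one, Finset.prod_inv_distrib]
  field_simp

lemma continuousOn_innerIntegrand_factor (hq0 : 0 < q) (hq1 : q < 1) {a α : Fin (n + 1) → ℝ}
    (t : ℝ) {ρ : ℝ} (hρ : 0 ≤ ρ) (ha : ∀ i, ‖qPow q a i‖ ≤ ρ) (hα : ∀ i, ‖qPow q α i‖ ≤ ρ) :
    ContinuousOn (fun z : Fin (n + 1) → ℂ => sklyanin q z *
      (PiFn q z (qPow q α) t / PiFn q (qPow q a) (qPow q α) t) *
      ∏ i, ∏ j, 1 / qPochInf (qPow q a i / z j) q) (extDomain (n + 1) ρ) := by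
  have h := (differentiableOn_prod_inv_qPochInf (n := n + 1) hq0 hq1 hρ ha).continuousOn
  simp only [one_div]
  exact (((differentiableOn_sklyanin hq0 hq1 hρ).continuousOn).mul
    ((differentiableOn_PiFn hq0 hq1 hρ hα t).continuousOn.div_const _)).mul h

lemma continuousOn_cauchySum (hq0 : 0 < q) (hq1 : q < 1) {ζ : ℂ}
    (hζ : ∀ x : ℝ, 0 ≤ x → ζ ≠ x) {ρ : ℝ} (hρ : 0 ≤ ρ) {x : Fin (n + 1) → ℂ}
    (hx0 : ∀ i, x i ≠ 0) (hx : ∀ i, ‖x i‖ ≤ ρ) :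
    ContinuousOn (fun z : Fin (n + 1) → ℂ => cauchySum q ζ x fun i => 1 / z i)
      (extDomain (n + 1) ρ) := by
  have h1 : ContinuousOn (fun z : Fin (n + 1) → ℂ => (∏ i, x i) * ∏ i, 1 / z i)
      (extDomain (n + 1) ρ) := ((differentiableOn_prod_inv hρ).const_mul _).continuousOn
  have h2 := (differentiableOn_prod_inv_qPochInf (n := n + 1) hq0 hq1 hρ hx).continuousOn
  simp only [cauchySum, mul_one_div]
  refine ContinuousOn.mul ?_ (((continuous_qPochInf hq0 hq1).comp_continuousOn h1).mul h2)
  refine (differentiableOn_obsSeries hq0 hq1 hζ).continuousOn.comp h1 fun z hz => ?_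
  have hz0 := ne_zero_of_mem_extDomain hρ hz
  refine ⟨mul_ne_zero (Finset.prod_ne_zero_iff.2 fun i _ => hx0 i)
    (Finset.prod_ne_zero_iff.2 fun i _ => one_div_ne_zero (hz0 i)),
    norm_prod_mul_prod_lt_one hx0 (fun i => one_div_ne_zero (hz0 i)) fun i j => ?_⟩
  rw [mul_one_div]
  exact norm_div_lt_one_of_mem_extDomain hρ hz (hx i) j

lemma innerIntegrand_add_int_mul_qPeriod (hq0 : 0 < q) (hq1 : q < 1) (a α : Fin (n + 1) → ℝ)
    (t : ℝ) (s : ℂ) (k : ℤ) :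
    innerIntegrand q a α t (s + k * qPeriod q) = innerIntegrand q a α t s := by
  funext v
  simp only [innerIntegrand, point, cpow_add_int_mul_qPeriod hq0 hq1]

lemma point_torusMap_mem_extDomain (hq0 : 0 < q) {ρ r σ : ℝ} (hr0 : 0 < r) (hr : ρ < r)
    (hσ : ρ < q ^ σ / r ^ n) {s : ℂ} (hs : s.re = σ) (θ : Fin n → ℝ) :
    point q s (torusMap 0 (fun _ => r) θ) ∈ extDomain (n + 1) ρ := by
  refine cons_mem_extDomain.2 ⟨?_, torusMap_mem_extDomain (fun _ => hr) θ⟩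
  rw [norm_div, norm_cpow_eq hq0, norm_prod, hs]
  simpa only [norm_torusMap_zero, abs_of_pos hr0, Finset.prod_const, Finset.card_univ,
    Fintype.card_fin] using hσ

/-- The inner integrand is jointly continuous along a vertical line and the torus. -/
lemma continuous_innerIntegrand (hq0 : 0 < q) (hq1 : q < 1) {a α : Fin (n + 1) → ℝ}
    (t : ℝ) {ρ : ℝ} (hρ : 0 ≤ ρ) (ha : ∀ i, ‖qPow q a i‖ ≤ ρ) (hα : ∀ i, ‖qPow q α i‖ ≤ ρ)
    {r σ : ℝ} (hr : ρ < r) (hσ : ρ < q ^ σ / r ^ n) :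
    Continuous fun p : ℝ × (Fin n → ℝ) =>
      innerIntegrand q a α t (σ + p.1 * Complex.I) (torusMap 0 (fun _ => r) p.2) := by
  have hr0 := hρ.trans_lt hr
  have hv : Continuous fun p : ℝ × (Fin n → ℝ) => torusMap 0 (fun _ : Fin n => r) p.2 :=
    (continuous_torusMap _ _).comp continuous_snd
  have hvj : ∀ j, Continuous fun p : ℝ × (Fin n → ℝ) => torusMap 0 (fun _ : Fin n => r) p.2 j :=
    fun j => (continuous_apply j).comp hv
  have hv0 : ∀ (p : ℝ × (Fin n → ℝ)) j, torusMap 0 (fun _ : Fin n => r) p.2 j ≠ 0 := fun p j => by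
    rw [← norm_pos_iff, norm_torusMap_zero, abs_of_pos hr0]
    exact hr0
  have hs : Continuous fun p : ℝ × (Fin n → ℝ) => (q : ℂ) ^ ((σ : ℂ) + p.1 * Complex.I) :=
    (differentiable_cpow hq0).continuous.comp (by fun_prop)
  have hpoint : Continuous fun p : ℝ × (Fin n → ℝ) =>
      point q (σ + p.1 * Complex.I) (torusMap 0 (fun _ => r) p.2) := by
    refine continuous_pi (Fin.cases ?_ fun j => ?_)
    · simp only [point, Fin.cons_zero]
      exact hs.div (continuous_finsetProd _ fun j _ => hvj j)
        fun p => Finset.prod_ne_zero_iff.2 fun j _ => hv0 p j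
    · simp only [point, Fin.cons_succ]
      exact hvj j
  unfold innerIntegrand
  refine Continuous.mul (continuous_finsetProd _ fun j _ =>
    continuous_const.div (hvj j) fun p => hv0 p j) ?_
  refine (continuousOn_innerIntegrand_factor hq0 hq1 t hρ ha hα).comp_continuous hpoint fun p => ?_
  exact point_torusMap_mem_extDomain hq0 hr0 hr hσ (by simp) p.2

lemma torusIntegrable_innerIntegrand (hq0 : 0 < q) (hq1 : q < 1) {a α : Fin (n + 1) → ℝ}
    (t : ℝ) {ρ : ℝ} (hρ : 0 ≤ ρ) (ha : ∀ i, ‖qPow q a i‖ ≤ ρ) (hα : ∀ i, ‖qPow q α i‖ ≤ ρ)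
    {r σ : ℝ} (hr : ρ < r) (hσ : ρ < q ^ σ / r ^ n) (y : ℝ) :
    TorusIntegrable (innerIntegrand q a α t (σ + y * Complex.I)) 0 (fun _ => r) := by
  have h := continuous_innerIntegrand hq0 hq1 t hρ ha hα hr hσ
  have h2 : Continuous fun θ : Fin n → ℝ => (y, θ) := continuous_const.prodMk continuous_id
  have h3 := h.comp h2
  simp only [Function.comp_def] at h3
  exact torusIntegrable_of_continuous h3

lemma continuous_torusIntegral_innerIntegrand (hq0 : 0 < q) (hq1 : q < 1)
    {a α : Fin (n + 1) → ℝ} (t : ℝ) {ρ : ℝ} (hρ : 0 ≤ ρ) (ha : ∀ i, ‖qPow q a i‖ ≤ ρ)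
    (hα : ∀ i, ‖qPow q α i‖ ≤ ρ) {r σ : ℝ} (hr : ρ < r) (hσ : ρ < q ^ σ / r ^ n) :
    Continuous fun y : ℝ =>
      torusIntegral (innerIntegrand q a α t (σ + y * Complex.I)) 0 fun _ => r := by
  unfold torusIntegral
  refine continuous_parametric_integral_of_continuous (f := fun (y : ℝ) (θ : Fin n → ℝ) =>
    (∏ i, (r : ℂ) * Complex.exp (θ i * Complex.I) * Complex.I) •
      innerIntegrand q a α t (σ + y * Complex.I) (torusMap 0 (fun _ => r) θ)) ?_ isCompact_Icc
  have h : Continuous fun p : ℝ × (Fin n → ℝ) =>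
      ∏ i, (r : ℂ) * Complex.exp (p.2 i * Complex.I) * Complex.I :=
    continuous_finsetProd _ fun i _ => by fun_prop
  exact h.smul (continuous_innerIntegrand hq0 hq1 t hρ ha hα hr hσ)

/-- The expectation of the observable as an integral over a vertical period. -/
lemma torusIntegral_cauchySum_eq (hq0 : 0 < q) (hq1 : q < 1) {a α : Fin (n + 1) → ℝ} (t : ℝ)
    {ζ : ℂ} (hζ : ∀ x : ℝ, 0 ≤ x → ζ ≠ x) {ρ : ℝ} (hρ : 0 ≤ ρ) (ha : ∀ i, ‖qPow q a i‖ ≤ ρ)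
    (hα : ∀ i, ‖qPow q α i‖ ≤ ρ) (hP : PiFn q (qPow q a) (qPow q α) t ≠ 0) {r σ : ℝ} (hr : ρ < r)
    (hσ : ρ < q ^ σ / r ^ n) :
    torusIntegral (fun z => cauchySum q ζ (qPow q a) (fun i => 1 / z i) *
      density q (qPow q α) t z) 0 (Fin.cons (q ^ σ / r ^ n) fun _ => r) =
    PiFn q (qPow q a) (qPow q α) t * (2 * Real.pi * Complex.I *
      ∫ x in (0 : ℝ)..1, obsProd q ζ (σ + qPeriod q * x - ∑ j, (a j : ℂ)) *
        torusIntegral (innerIntegrand q a α t (σ + qPeriod q * x)) 0 fun _ => r) := by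
  have hr0 := hρ.trans_lt hr
  have hx0 : ∀ i, qPow q a i ≠ 0 := fun i => by
    simp only [qPow]
    exact_mod_cast (Real.rpow_pos_of_pos hq0 _).ne'
  have hprod : ∏ _i : Fin n, r = r ^ n := by simp
  rw [← hprod] at hσ ⊢
  rw [torusIntegral_eq_circleIntegral_div (f := fun z => cauchySum q ζ (qPow q a)
    (fun i => 1 / z i) * density q (qPow q α) t z) hρ ((continuousOn_cauchySum hq0 hq1 hζ hρ hx0 ha).mul
    (differentiableOn_density hq0 hq1 hρ hα t).continuousOn) (fun _ => hr) hσ,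
    circleIntegral_eq_integral_period hq0 hq1, mul_left_comm,
    ← intervalIntegral.integral_const_mul (PiFn q (qPow q a) (qPow q α) t)]
  congr 1
  refine intervalIntegral.integral_congr fun x _ => ?_
  set s : ℂ := σ + qPeriod q * x
  have h : torusIntegral (fun v : Fin n → ℂ =>
      cauchySum q ζ (qPow q a) (fun i => 1 / (Fin.cons ((q : ℂ) ^ s / ∏ j, v j) v : Fin (n + 1) → ℂ) i) *
        density q (qPow q α) t (Fin.cons ((q : ℂ) ^ s / ∏ j, v j) v) / ∏ j, v j) 0 (fun _ => r) =
      (PiFn q (qPow q a) (qPow q α) t * ((q : ℂ) ^ s)⁻¹ *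
        obsProd q ζ (s - ∑ j, (a j : ℂ))) *
          torusIntegral (innerIntegrand q a α t s) 0 (fun _ => r) := by
    rw [← torusIntegral_const_mul]
    refine torusIntegral_congr_on fun θ => ?_
    refine cauchySum_mul_density_point hq0 a α t ζ s hP fun j => ?_
    rw [← norm_pos_iff, norm_torusMap_zero, abs_of_pos hr0]
    exact hr0
  simp only [h]
  have hs := cpow_ne_zero hq0 s
  field_simp

lemma sum_ofReal_re (a : Fin n → ℝ) : (∑ j, (a j : ℂ)).re = ∑ j, a j := by
  rw [← Complex.ofReal_sum, Complex.ofReal_re]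

/-- At an integer `s - A` the division by zero gives `outerIntegrand` the value `0`, while
`mellinKernel` takes the limit of the removable singularity; hence the hypothesis. On the line of
integration this can only concern the real point, a null set. -/
lemma outerIntegrand_eq (q : ℝ) (a α : Fin (n + 1) → ℝ) (t : ℝ) (ζ : ℂ) (r : ℝ) {s : ℂ}
    (hs : Complex.sin (Real.pi * (s - ∑ j, (a j : ℂ))) ≠ 0) :
    outerIntegrand q a α t ζ r s = mellinKernel q ζ (s - ∑ j, (a j : ℂ)) *
      torusIntegral (innerIntegrand q a α t s) 0 fun _ => r := by
  rw [mellinKernel, thetaE, if_neg hs, thetaB, outerIntegrand, neg_sub]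
  change _ * torusIntegral (innerIntegrand q a α t s) 0 _ = _
  ring

/-- Unfolding the integral over the vertical line into one over a period. -/
lemma integrable_and_integral_outerIntegrand_eq (hq0 : 0 < q) (hq1 : q < 1)
    {a α : Fin (n + 1) → ℝ} (ha0 : ∀ i, 0 ≤ a i) (t : ℝ)
    {ζ : ℂ} (hζ : ∀ x : ℝ, 0 ≤ x → ζ ≠ x) {ρ : ℝ} (hρ : 0 ≤ ρ) (ha : ∀ i, ‖qPow q a i‖ ≤ ρ)
    (hα : ∀ i, ‖qPow q α i‖ ≤ ρ) {r σ : ℝ} (hσ0 : σ < 0) (hr : ρ < r)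
    (hσ : ρ < q ^ σ / r ^ n) :
    Integrable (fun y : ℝ => outerIntegrand q a α t ζ r (σ + y * Complex.I)) ∧
      ∫ y : ℝ, outerIntegrand q a α t ζ r (σ + y * Complex.I) = -(2 * Real.pi * qPochInf q q *
        ∫ x in (0 : ℝ)..1, obsProd q ζ (σ + qPeriod q * x - ∑ j, (a j : ℂ)) *
          torusIntegral (innerIntegrand q a α t (σ + qPeriod q * x)) 0 fun _ => r) := by
  set A : ℂ := ∑ j, (a j : ℂ) with hA
  set J : ℂ → ℂ := fun s => torusIntegral (innerIntegrand q a α t s) 0 fun _ => r with hJ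
  -- The period is `τ = iT` with `T < 0`. Rescaling `y = T x` therefore brings in `|T⁻¹| = -T⁻¹`,
  -- the source of the minus sign in the result.
  set T : ℝ := 2 * Real.pi / Real.log q with hT
  have hL := Real.log_neg hq0 hq1
  have hT0 : T < 0 := div_neg_of_pos_of_neg (by positivity) hL
  set f₀ : ℝ → ℂ := fun y => mellinKernel q ζ (σ + y * Complex.I - A) * J (σ + y * Complex.I)
    with hf₀
  have hline : ∀ x : ℝ, (σ : ℂ) + ((T * x : ℝ) : ℂ) * Complex.I = σ + qPeriod q * x := fun x => by
    rw [qPeriod_eq, ← hT]; push_cast; ring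
  have hf₀c : Continuous f₀ :=
    ((differentiable_mellinKernel hq0 hq1 hζ).continuous.comp (by fun_prop)).mul
      (continuous_torusIntegral_innerIntegrand hq0 hq1 t hρ ha hα hr hσ)
  have hJT : Continuous fun x : ℝ => J (σ + ((T * x : ℝ) : ℂ) * Complex.I) :=
    (continuous_torusIntegral_innerIntegrand hq0 hq1 t hρ ha hα hr hσ).comp
      (continuous_const.mul continuous_id)
  obtain ⟨M, hM⟩ := isCompact_Icc.exists_bound_of_continuousOn (hJT.continuousOn (s := Icc 0 1))
  obtain ⟨b, hb, hbk⟩ := exists_summable_bound_mellinKernel hq0 hq1 hζ (σ - ∑ j, a j)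
    (σ - ∑ j, a j) |T|
  have hshift : ∀ (x : ℝ) (k : ℤ), (σ : ℂ) + ((T * (x + k) : ℝ) : ℂ) * Complex.I =
      (σ + qPeriod q * x) + k * qPeriod q := fun x k => by
    rw [hline]; push_cast; ring
  have hJk : ∀ (x : ℝ) (k : ℤ), J (σ + qPeriod q * x + k * qPeriod q) = J (σ + qPeriod q * x) :=
    fun x k => by simp only [hJ, innerIntegrand_add_int_mul_qPeriod hq0 hq1]
  have hfk : ∀ (x : ℝ) (k : ℤ), f₀ (T * (x + k)) =
      mellinKernel q ζ (σ + qPeriod q * x - A + k * qPeriod q) * J (σ + qPeriod q * x) := by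
    intro x k
    simp only [hf₀]
    rw [hshift, hJk, add_sub_right_comm]
  have hAre : A.re = ∑ j, a j := sum_ofReal_re a
  have hAim : A.im = 0 := by rw [hA, ← Complex.ofReal_sum, Complex.ofReal_im]
  obtain ⟨hint, hval⟩ := integrable_and_integral_eq_of_summable_bound (f := fun x => f₀ (T * x))
    (b := fun k => b k * M) (hf₀c.comp (continuous_const.mul continuous_id)) (hb.mul_right M) (by
      intro k x hx
      have hxM := hM x hx
      rw [hline] at hxM
      simp only [hfk, norm_mul]
      have hre : (σ + qPeriod q * x - A).re = σ - ∑ j, a j := by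
        rw [Complex.sub_re, line_re, hAre]
      have him : |(σ + qPeriod q * x - A).im| ≤ |T| := by
        rw [Complex.sub_im, hAim, ← hline]
        simp only [Complex.add_im, Complex.ofReal_im, Complex.mul_im, Complex.ofReal_re,
          Complex.I_im, Complex.I_re, mul_one, mul_zero, add_zero, zero_add, sub_zero]
        rw [abs_mul, abs_of_nonneg hx.1]
        exact mul_le_of_le_one_right (abs_nonneg _) hx.2
      have h1 := hbk k _ hre.ge hre.le him
      exact mul_le_mul h1 hxM (norm_nonneg _) ((norm_nonneg _).trans h1))
  have hae : (fun y : ℝ => outerIntegrand q a α t ζ r (σ + y * Complex.I)) =ᵐ[volume] f₀ := by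
    filter_upwards [compl_mem_ae_iff.2 (measure_singleton (0 : ℝ))] with y hy
    refine outerIntegrand_eq q a α t ζ r fun h => hy ?_
    obtain ⟨m, hm⟩ := (sin_pi_mul_eq_zero_iff _).1 h
    have := congrArg Complex.im hm
    rw [← hA, Complex.sub_im, hAim] at this
    simpa using this
  have hf₀i : Integrable f₀ := (integrable_comp_mul_left_iff f₀ hT0.ne).1 hint
  refine ⟨hf₀i.congr hae.symm, ?_⟩
  rw [integral_congr_ae hae]
  have hscale := Measure.integral_comp_mul_left f₀ T
  rw [hval, abs_of_neg (inv_lt_zero.2 hT0)] at hscale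
  have hper : (∫ x in (0 : ℝ)..1, ∑' k : ℤ, f₀ (T * (x + k))) = qPochInf q q * Real.log q *
      ∫ x in (0 : ℝ)..1, obsProd q ζ (σ + qPeriod q * x - A) * J (σ + qPeriod q * x) := by
    rw [← intervalIntegral.integral_const_mul]
    refine intervalIntegral.integral_congr fun x _ => ?_
    simp only [hfk, tsum_mul_right]
    -- Since `A ≥ 0`, the line stays in the half-plane `Re u < 0` where the bilateral series
    -- converges.
    have hσA : σ - ∑ j, a j < 0 := by
      have := Finset.sum_nonneg fun i (_ : i ∈ Finset.univ) => ha0 i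
      linarith
    have h1 := mellinPeriodization_eq hq0 hq1 hζ hσA x
    have h2 : (((σ - ∑ j, a j : ℝ) : ℂ) + qPeriod q * x) = σ + qPeriod q * x - A := by
      rw [hA]; push_cast; ring
    rw [h2] at h1
    rw [← mellinPeriodization, h1]
    ring
  rw [hper] at hscale
  have hTinv : ((-T⁻¹ : ℝ) : ℂ) ≠ 0 := by
    exact_mod_cast (neg_pos.2 (inv_lt_zero.2 hT0)).ne'
  rw [Complex.real_smul] at hscale
  apply mul_left_cancel₀ hTinv
  rw [← hscale, hT]
  have hLc : (Real.log q : ℂ) ≠ 0 := by exact_mod_cast hL.ne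
  have hpi : (Real.pi : ℂ) ≠ 0 := by exact_mod_cast Real.pi_ne_zero
  push_cast
  field_simp
  rfl

end Contour

end QWhittaker
end

/-! ### The main theorem. -/

theorem proposition3 (n : ℕ) (q : ℝ) (hq0 : 0 < q) (hq1 : q < 1)
    (a α : Fin (n + 1) → ℝ) (ha : ∀ i, 0 ≤ a i) (haα : ∀ i j, a j < α i)
    (t : ℝ) (ht : 0 ≤ t) (ζ : ℂ) (hζ : ∀ x : ℝ, 0 ≤ x → ζ ≠ (x : ℂ))
    (ε : ℝ) (hε : 0 < ε)
    -- the radius of the circle for `w_2, …, w_N`; `r = 1` is admissible if all `a i` are positive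
    (r : ℝ) (hr : ∀ i, q ^ a i < r) (hrε : ∀ i, q ^ a i * r ^ n < q ^ (-ε)) :
    (∀ y : ℝ, TorusIntegrable
      (QWhittaker.innerIntegrand q a α t (-(ε : ℂ) + (y : ℂ) * Complex.I))
      (fun _ => 0) (fun _ => r)) ∧
    MeasureTheory.Integrable
      (fun y : ℝ => QWhittaker.outerIntegrand q a α t ζ r (-(ε : ℂ) + (y : ℂ) * Complex.I)) ∧
    HasSum
      (fun lam : QWhittaker.Signature (n + 1) =>
        1 / QWhittaker.qPochInf (ζ * (q : ℂ) ^ lam.1 (Fin.last n)) q *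
          QWhittaker.weight q a α t lam)
      (-(QWhittaker.qPochInf q q) ^ ((n : ℤ) - 1) *
        (Complex.I *
          ∫ y : ℝ, QWhittaker.outerIntegrand q a α t ζ r (-(ε : ℂ) + (y : ℂ) * Complex.I))) := by
  have hpow : ∀ (c : Fin (n + 1) → ℝ) i, ‖QWhittaker.qPow q c i‖ = q ^ c i := fun c i => by
    simp only [QWhittaker.qPow, Complex.norm_real, Real.norm_of_nonneg (Real.rpow_pos_of_pos hq0 _).le]
  -- Two exterior radii are needed. The definition of `Q` uses the unit torus, and its integrand
  -- only asks for radii larger than all `q^{α_i}`, whose maximum is below `1`. After summation the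
  -- radii must also exceed all `q^{a_i}`, whose maximum equals `1` when some `a_i = 0`; hence the
  -- torus is moved inside each `Q_λ`, before summing.
  obtain ⟨i₀, -, hi₀⟩ := Finset.exists_max_image Finset.univ (fun i => q ^ α i)
    Finset.univ_nonempty
  obtain ⟨j₀, -, hj₀⟩ := Finset.exists_max_image Finset.univ (fun i => q ^ a i)
    Finset.univ_nonempty
  have hαa : ∀ i j, q ^ α i < q ^ a j := fun i j =>
    Real.rpow_lt_rpow_of_exponent_gt hq0 hq1 (haα i j)
  have hr0 : 0 < r := (Real.rpow_pos_of_pos hq0 _).trans (hr 0)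
  have hρ0 : ∀ c : ℝ, 0 ≤ q ^ c := fun c => (Real.rpow_pos_of_pos hq0 c).le
  have hR : ∀ i, q ^ a i < q ^ (-ε) / r ^ n := fun i => by
    rw [lt_div_iff₀ (by positivity)]
    exact hrε i
  have ha' : ∀ i, ‖QWhittaker.qPow q a i‖ ≤ q ^ a j₀ := fun i => by
    rw [hpow]; exact hj₀ i (Finset.mem_univ _)
  have hα' : ∀ i, ‖QWhittaker.qPow q α i‖ ≤ q ^ a j₀ := fun i => by
    rw [hpow]; exact (hαa i j₀).le
  have hα'' : ∀ i, ‖QWhittaker.qPow q α i‖ ≤ q ^ α i₀ := fun i => by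
    rw [hpow]; exact hi₀ i (Finset.mem_univ _)
  have hP : QWhittaker.PiFn q (QWhittaker.qPow q a) (QWhittaker.qPow q α) t ≠ 0 := by
    refine QWhittaker.PiFn_ne_zero hq0 hq1 (fun i j => ?_) t
    rw [norm_div, hpow, hpow, div_lt_one (Real.rpow_pos_of_pos hq0 _)]
    exact hαa i j
  have hqq : QWhittaker.qPochInf q q ≠ 0 :=
    QWhittaker.qPochInf_ne_zero_of_norm_lt hq0 hq1 (by simpa [abs_of_pos hq0] using hq1)
  have hεc : -(ε : ℂ) = ((-ε : ℝ) : ℂ) := by push_cast; rfl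
  simp only [hεc]
  obtain ⟨hint, hval⟩ := QWhittaker.integrable_and_integral_outerIntegrand_eq hq0 hq1 ha t hζ (hρ0 (a j₀))
    ha' hα' (neg_lt_zero.2 hε) (hr j₀) (hR j₀)
  refine ⟨QWhittaker.torusIntegrable_innerIntegrand hq0 hq1 t (hρ0 (a j₀)) ha' hα' (hr j₀) (hR j₀),
    hint, ?_⟩
  -- The chosen torus has first radius `q^{-ε}/r^n` and all others `r`, so the product of the radii
  -- is `|q^s| = q^{-ε}`.
  · have hrad : ∀ i j, q ^ a i < (Fin.cons (q ^ (-ε) / r ^ n) fun _ => r : Fin (n + 1) → ℝ) j :=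
      fun i => Fin.cases (by simpa using hR i) fun j => by simpa using hr i
    have hsum := QWhittaker.hasSum_obs_mul_weight (t := t) hq0 hq1 hζ (hρ0 (α i₀))
      ((hαa i₀ j₀).trans_le (Real.rpow_le_one hq0.le hq1.le (ha j₀))) hα''
      (fun j => (hαa i₀ j₀).trans (hrad j₀ j)) hrad
    refine QWhittaker.hasSum_of_eq hsum (fun lam => by rw [QWhittaker.obs, one_div]) ?_
    rw [QWhittaker.torusIntegral_cauchySum_eq hq0 hq1 t hζ (hρ0 (a j₀)) ha' hα' hP (hr j₀) (hR j₀), hval,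
      zpow_sub_one₀ hqq, zpow_natCast]
    field_simp
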